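/- Let $\nu>0$, $\alpha_1,\alpha_2\in\mathbb R$, $\gamma\ge 0$ and $T>0$. Let $\dot L^2$ be the space of real functions in $L^2(0,2\pi)$ with mean zero, and let $\dot H^s$ be the Sobolev space of $2\pi$-periodic functions with mean zero whose weak derivatives up to order $s$ are square integrable over a period. Let $u_{0,1},u_{0,2}\in\dot H^2$ be initial data, let $\bar u_1,\bar u_2\in L^2(0,2\pi)$ be target functions (for example a steady state of the uncontrolled system), and let $F_{ad}$ be a nonempty, bounded, closed and convex subset of $L^2((0,2\pi)\times(0,T))$ that is contained in $L^2(0,T;\dot L^2)$. Consider the problem of minimising $$\mathcal C(U,F)=\frac12\int_0^T\Big(\|u_1(\cdot,t)-\bar u_1\|_{L^2}^2+\|u_2(\cdot,t)-\bar u_2\|_{L^2}^2\Big)\,dt+\frac12\Big(\|u_1(\cdot,T)-\bar u_1\|_{L^2}^2+\|u_2(\cdot,T)-\bar u_2\|_{L^2}^2\Big)+\frac\gamma2\int_0^T\Big(\|f_1(\cdot,t)\|_{L^2}^2+\|f_2(\cdot,t)\|_{L^2}^2\Big)\,dt$$ over all controls $F=(f_1,f_2)\in F_{ad}\times F_{ad}$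 and associated states $U=(u_1,u_2)$, where $U$ is a state associated with $F$ if $u_i(\cdot,t)\in\dot H^2$ for every $t\in[0,T]$, $u_i\in L^2(0,T;\dot H^4)\cap H^1(0,T;\dot L^2)$ for $i=1,2$, and $$u_{1,t}+\nu u_{1,xxxx}+u_{1,xx}+u_1u_{1,x}+\alpha_1u_{2,xx}=f_1,$$ $$u_{2,t}+\nu u_{2,xxxx}+u_{2,xx}+u_2u_{2,x}+\alpha_2u_{1,xx}=f_2$$ hold almost everywhere in $(0,2\pi)\times(0,T)$, with $2\pi$-periodic boundary conditions in $x$ (for $\partial_x^ju_i$, $j=0,1,2,3$) and initial values $u_i(\cdot,0)=u_{0,i}$. Then this problem has at least one optimal control $F^*=(f_1^*,f_2^*)$ with an associated optimal state $U^*=(u_1^*,u_2^*)$: $F^*\in F_{ad}\times F_{ad}$, $U^*$ is a state associated with $F^*$, and $\mathcal C(U^*,F^*)\le\mathcal C(U,F)$ for every $F\in F_{ad}\times F_{ad}$ and every state $U$ associated with $F$. -/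

import Mathlib

open MeasureTheory Set

namespace CoupledKS

/-- The real Hilbert space `L²(0,2π)` (the endpoint `2π` is a null set). -/
abbrev L2 : Type := Lp ℝ 2 (volume.restrict (Ioc (0 : ℝ) (2 * Real.pi)))

/-- The Bochner space `L²(0,T; L²(0,2π))`, i.e. `L²((0,2π) × (0,T))`. -/
abbrev Control (T : ℝ) : Type := Lp L2 2 (volume.restrict (Ioc (0 : ℝ) T))

/-- `u` belongs to the space of square integrable functions on `(0,2π)` with mean zero. -/
def HasZeroMean (u : L2) : Prop :=
  ∫ x in Ioc (0 : ℝ) (2 * Real.pi), u x = 0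

/-- Smooth `2π`-periodic test functions. -/
def IsPeriodicTest (φ : ℝ → ℝ) : Prop :=
  ContDiff ℝ (⊤ : ℕ∞) φ ∧ Function.Periodic φ (2 * Real.pi)

/-- `v` is the weak derivative of order `k` of the `2π`-periodic function `u`. As the test functions
are periodic and need not vanish at the endpoints, this includes the periodic boundary conditions
`∂ʲu(x + 2π) = ∂ʲu(x)` for `j < k`. -/
def IsWeakDeriv (k : ℕ) (u v : L2) : Prop :=
  ∀ φ : ℝ → ℝ, IsPeriodicTest φ →
    ∫ x in Ioc (0 : ℝ) (2 * Real.pi), u x * iteratedDeriv k φ x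
      = (-1) ^ k * ∫ x in Ioc (0 : ℝ) (2 * Real.pi), v x * φ x

/-- The Sobolev space of `2π`-periodic functions of mean zero all of whose weak derivatives up to
order `s` are square integrable. -/
def MemHdot (s : ℕ) (u : L2) : Prop :=
  HasZeroMean u ∧ ∀ k ≤ s, ∃ v : L2, IsWeakDeriv k u v

/-- `v ∈ L²(0,T; L²(0,2π))` is the weak space derivative of order `k` of `u`. -/
def IsSpaceDeriv (T : ℝ) (k : ℕ) (u v : ℝ → L2) : Prop :=
  MemLp v 2 (volume.restrict (Ioc (0 : ℝ) T)) ∧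
    ∀ᵐ t ∂(volume.restrict (Ioc (0 : ℝ) T)), IsWeakDeriv k (u t) (v t)

/-- `v ∈ L²(0,T; L²(0,2π))` is the weak time derivative of `u`, and `u` is the (absolutely)
continuous representative on `[0,T]`, so that `u ∈ H¹(0,T; L²(0,2π))`. -/
def IsTimeDeriv (T : ℝ) (u v : ℝ → L2) : Prop :=
  MemLp v 2 (volume.restrict (Ioc (0 : ℝ) T)) ∧
    ∀ t ∈ Icc (0 : ℝ) T, u t = u 0 + ∫ s in (0 : ℝ)..t, v s

/-- `(u₁, u₂)` is a (strong) solution on `[0,T]` of the controlled coupled system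
`∂ₜu₁ + ν ∂ₓ⁴u₁ + ∂ₓ²u₁ + u₁ ∂ₓu₁ + α₁ ∂ₓ²u₂ = f₁`,
`∂ₜu₂ + ν ∂ₓ⁴u₂ + ∂ₓ²u₂ + u₂ ∂ₓu₂ + α₂ ∂ₓ²u₁ = f₂`
with `2π`-periodic boundary conditions and initial values `u₀₁`, `u₀₂`: each component has mean
zero, lies in `H²` at all times and in `L²(0,T; H⁴) ∩ H¹(0,T; L²)`, and the equations hold almost
everywhere. Here `vᵢ` is the time derivative of `uᵢ`, and `Dᵢ k` its space derivative of
order `k`. -/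
def IsState (ν α₁ α₂ T : ℝ) (u₀₁ u₀₂ : L2) (f₁ f₂ : Control T) (u₁ u₂ : ℝ → L2) : Prop :=
  u₁ 0 = u₀₁ ∧ u₂ 0 = u₀₂ ∧
  (∀ t ∈ Icc (0 : ℝ) T, MemHdot 2 (u₁ t) ∧ MemHdot 2 (u₂ t)) ∧
  ∃ (v₁ v₂ : ℝ → L2) (D₁ D₂ : ℕ → ℝ → L2),
    IsTimeDeriv T u₁ v₁ ∧ IsTimeDeriv T u₂ v₂ ∧
    (∀ k ≤ 4, IsSpaceDeriv T k u₁ (D₁ k) ∧ IsSpaceDeriv T k u₂ (D₂ k)) ∧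
    ∀ᵐ t ∂(volume.restrict (Ioc (0 : ℝ) T)),
      ∀ᵐ x ∂(volume.restrict (Ioc (0 : ℝ) (2 * Real.pi))),
        v₁ t x + ν * D₁ 4 t x + D₁ 2 t x + u₁ t x * D₁ 1 t x + α₁ * D₂ 2 t x = f₁ t x ∧
        v₂ t x + ν * D₂ 4 t x + D₂ 2 t x + u₂ t x * D₂ 1 t x + α₂ * D₁ 2 t x = f₂ t x

/-- The quadratic cost functional with target `(ubar₁, ubar₂)` and control weight `γ`. -/
noncomputable def cost (γ T : ℝ) (ubar₁ ubar₂ : L2) (u₁ u₂ : ℝ → L2) (f₁ f₂ : Control T) : ℝ :=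
  1 / 2 * (∫ t in (0 : ℝ)..T, (‖u₁ t - ubar₁‖ ^ 2 + ‖u₂ t - ubar₂‖ ^ 2))
    + 1 / 2 * (‖u₁ T - ubar₁‖ ^ 2 + ‖u₂ T - ubar₂‖ ^ 2)
    + γ / 2 * (∫ t in (0 : ℝ)..T, (‖f₁ t‖ ^ 2 + ‖f₂ t‖ ^ 2))

/-- `(f₁, f₂)` is an optimal control with associated optimal state `(u₁, u₂)`: the pair is
admissible, and it minimises the cost among all admissible controls and their states. -/
def IsOptimal (ν α₁ α₂ γ T : ℝ) (u₀₁ u₀₂ ubar₁ ubar₂ : L2) (Fad : Set (Control T))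
    (f₁ f₂ : Control T) (u₁ u₂ : ℝ → L2) : Prop :=
  f₁ ∈ Fad ∧ f₂ ∈ Fad ∧ IsState ν α₁ α₂ T u₀₁ u₀₂ f₁ f₂ u₁ u₂ ∧
  ∀ g₁ ∈ Fad, ∀ g₂ ∈ Fad, ∀ w₁ w₂ : ℝ → L2,
    IsState ν α₁ α₂ T u₀₁ u₀₂ g₁ g₂ w₁ w₂ →
      cost γ T ubar₁ ubar₂ u₁ u₂ f₁ f₂ ≤ cost γ T ubar₁ ubar₂ w₁ w₂ g₁ g₂

end CoupledKS

/-! ### Fourier coefficients, Parseval and Fourier multipliers on L²(0,2π) -/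

namespace CoupledKS

open Filter Topology ComplexConjugate

/-! The proof is the direct method. The infimum runs over pairs of a control and a state, so
uniqueness of the state never enters. Three things are needed: some state exists, a minimising
sequence has a limit that is again a state, and the cost is lower semicontinuous along it.

Everything is read off the Fourier coefficients `fc m`. Weak differentiation is multiplication by
`(m * I) ^ k` (`isWeakDeriv_iff`), and the system becomes one scalar identity per mode
(`ae_eq_iff_fc_eq`). In it the convection term is `m * I / 2` times the coefficient `sqc m` of u², a
quantity that involves no derivative of u and is continuous on L².

A priori bounds (`exists_isBounded`): testing with u kills convection, because u²u_x = (u³/3)_x has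
mean zero. Young's inequality absorbs the second-order terms into ν‖u_xx‖², and Grönwall's
inequality gives bounds in L^∞(L²) and L²(H²). Since ‖u u_x‖ ≤ C‖u‖‖u_xx‖, the combination u_t +
νu_xxxx is then bounded in L²(L²). Testing each mode with the fourth derivative upgrades this to
L^∞(H²) and L²(H⁴), and u_t is bounded by difference. The argument uses only that the modal
equations hold on a set `S` of modes and that u and u_t vanish off `S`. Hence `IsApprox` serves both
Galerkin solutions and true states, with bounds independent of `S`.

Compactness (`exists_limit_state`): the H² bound and Hölder continuity of exponent 1/2 in time give
uniform convergence in L² along an ultrafilter, by Rellich and Arzelà–Ascoli. Controls and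
derivatives converge weakly. In each modal equation the linear terms pass to the limit weakly and
`sqc m` uniformly. This is applied to Galerkin solutions, which gives existence of a state
(`exists_isState`), and to a minimising sequence (`exists_state_cost_le`).

The limit controls are admissible because closed convex sets are weakly closed. The control cost is
weakly lower semicontinuous, and the tracking terms are handled by the uniform convergence. -/

/-- Lebesgue measure on one period. -/
noncomputable abbrev circ : Measure ℝ := volume.restrict (Ioc (0 : ℝ) (2 * Real.pi))

/-- The `m`-th Fourier coefficient of a function on `(0,2π)`, normalised so that Parseval's identity
holds without a factor. -/
noncomputable def coef (m : ℤ) (h : ℝ → ℂ) : ℂ :=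
  (((√(2 * Real.pi))⁻¹ : ℝ) : ℂ) * ∫ x, Complex.exp (-(m * x * Complex.I)) * h x ∂circ

theorem norm_exp_mode (m : ℤ) (x : ℝ) : ‖Complex.exp (-(m * x * Complex.I))‖ = 1 := by
  have : -((m : ℂ) * x * Complex.I) = ((-(m * x) : ℝ) : ℂ) * Complex.I := by push_cast; ring
  rw [this, Complex.norm_exp_ofReal_mul_I]

theorem continuous_exp_mode (m : ℤ) :
    Continuous fun x : ℝ => Complex.exp (-((m : ℂ) * (x : ℂ) * Complex.I)) := by fun_prop

theorem integrable_mode_mul (m : ℤ) {h : ℝ → ℂ} (hh : Integrable h circ) :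
    Integrable (fun x : ℝ => Complex.exp (-(m * x * Complex.I)) * h x) circ :=
  hh.bdd_mul (c := 1) (continuous_exp_mode m).aestronglyMeasurable
    (Eventually.of_forall fun x => (norm_exp_mode m x).le)

theorem coef_add (m : ℤ) {g h : ℝ → ℂ} (hg : Integrable g circ) (hh : Integrable h circ) :
    coef m (fun x => g x + h x) = coef m g + coef m h := by
  unfold coef
  rw [← mul_add, ← integral_add (integrable_mode_mul m hg) (integrable_mode_mul m hh)]
  congr 2; funext x; ring

theorem coef_const_mul (m : ℤ) (c : ℂ) (h : ℝ → ℂ) :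
    coef m (fun x => c * h x) = c * coef m h := by
  unfold coef
  rw [mul_left_comm, ← integral_const_mul c]
  congr 2; funext x; ring

theorem coef_congr (m : ℤ) {g h : ℝ → ℂ} (hgh : g =ᵐ[circ] h) : coef m g = coef m h := by
  unfold coef
  rw [integral_congr_ae]
  filter_upwards [hgh] with x hx
  simp [hx]

theorem norm_coef_le (m : ℤ) (h : ℝ → ℂ) : ‖coef m h‖ ≤ ∫ x, ‖h x‖ ∂circ := by
  unfold coef
  have h1 : ‖∫ x, Complex.exp (-(m * x * Complex.I)) * h x ∂circ‖ ≤ ∫ x, ‖h x‖ ∂circ := by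
    refine (norm_integral_le_integral_norm _).trans (le_of_eq ?_)
    simp only [norm_mul, norm_exp_mode, one_mul]
  have h2 : (√(2 * Real.pi))⁻¹ ≤ 1 := by
    apply inv_le_one_of_one_le₀
    rw [Real.one_le_sqrt]
    linarith [Real.pi_gt_three]
  rw [norm_mul, Complex.norm_real, Real.norm_of_nonneg (by positivity)]
  calc _ ≤ 1 * ∫ x, ‖h x‖ ∂circ := by gcongr
    _ = _ := one_mul _

theorem coef_conj (m : ℤ) (h : ℝ → ℂ) : coef (-m) (fun x => conj (h x)) = conj (coef m h) := by
  unfold coef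
  rw [map_mul, Complex.conj_ofReal, ← integral_conj]
  congr 2; ext x
  rw [map_mul, ← Complex.exp_conj]
  simp

theorem coef_eq_fourierCoeffOn (m : ℤ) (h : ℝ → ℂ) :
    coef m h = (√(2 * Real.pi) : ℝ) * fourierCoeffOn Real.two_pi_pos h m := by
  have hp : (0:ℝ) < 2 * Real.pi := Real.two_pi_pos
  rw [fourierCoeffOn_eq_integral, intervalIntegral.integral_of_le hp.le]
  unfold coef
  simp only [sub_zero, fourier_coe_apply, smul_eq_mul, Complex.real_smul]
  rw [← mul_assoc]
  congr 1
  · rw [← Complex.ofReal_mul]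
    congr 1
    nth_rw 3 [← Real.mul_self_sqrt hp.le]
    field_simp
  · congr 1; ext x; congr 2
    have : (Real.pi : ℂ) ≠ 0 := by exact_mod_cast Real.pi_ne_zero
    push_cast
    field_simp

theorem memLp_ofReal (u : L2) : MemLp (fun x => (u x : ℂ)) 2 circ :=
  (Lp.memLp u).ofReal

theorem integrable_ofReal (u : L2) : Integrable (fun x => (u x : ℂ)) circ :=
  (memLp_ofReal u).integrable (by norm_num)

theorem norm_sq_eq_integral (u : L2) : ‖u‖ ^ 2 = ∫ x, u x ^ 2 ∂circ := by
  rw [← real_inner_self_eq_norm_sq, L2.inner_def]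
  congr 1; ext x; simp [sq]

theorem hasSum_coef_sq (u : L2) :
    HasSum (fun m : ℤ => ‖coef m (fun x => (u x : ℂ))‖ ^ 2) (‖u‖ ^ 2) := by
  have h := (hasSum_sq_fourierCoeffOn Real.two_pi_pos (memLp_ofReal u)).mul_left (2 * Real.pi)
  convert! h using 1
  · funext m
    rw [coef_eq_fourierCoeffOn, norm_mul, mul_pow, Complex.norm_real, Real.norm_of_nonneg
      (by positivity), Real.sq_sqrt Real.two_pi_pos.le]
  · rw [norm_sq_eq_integral, intervalIntegral.integral_of_le Real.two_pi_pos.le, sub_zero,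
      smul_eq_mul, ← mul_assoc, mul_inv_cancel₀ Real.two_pi_pos.ne', one_mul]
    simp

/-- The `m`-th Fourier coefficient as a bounded functional on the real space `L²(0,2π)`. -/
noncomputable def fc (m : ℤ) : L2 →L[ℝ] ℂ :=
  LinearMap.mkContinuous
    { toFun := fun u => coef m (fun x => (u x : ℂ))
      map_add' := fun u w => by
        rw [← coef_add m (integrable_ofReal u) (integrable_ofReal w)]
        refine coef_congr m ?_
        filter_upwards [Lp.coeFn_add u w] with x hx
        rw [hx, Pi.add_apply, Complex.ofReal_add]
      map_smul' := fun c u => by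
        rw [RingHom.id_apply, Complex.real_smul, ← coef_const_mul]
        refine coef_congr m ?_
        filter_upwards [Lp.coeFn_smul c u] with x hx
        rw [hx, Pi.smul_apply, smul_eq_mul, Complex.ofReal_mul] }
    1 fun u => by
      rw [one_mul]
      exact (sq_le_sq₀ (norm_nonneg _) (norm_nonneg _)).1
        (le_hasSum (hasSum_coef_sq u) m fun _ _ => by positivity)

theorem fc_apply (m : ℤ) (u : L2) : fc m u = coef m (fun x => (u x : ℂ)) := rfl

theorem hasSum_fc_sq (u : L2) : HasSum (fun m : ℤ => ‖fc m u‖ ^ 2) (‖u‖ ^ 2) := hasSum_coef_sq u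

theorem sum_fc_sq_le (u : L2) (F : Finset ℤ) : ∑ m ∈ F, ‖fc m u‖ ^ 2 ≤ ‖u‖ ^ 2 :=
  sum_le_hasSum F (fun _ _ => by positivity) (hasSum_fc_sq u)

theorem norm_fc_le (m : ℤ) (u : L2) : ‖fc m u‖ ≤ ‖u‖ :=
  (sq_le_sq₀ (norm_nonneg _) (norm_nonneg _)).1
    (le_hasSum (hasSum_fc_sq u) m fun _ _ => by positivity)

theorem eq_of_fc_eq {u w : L2} (h : ∀ m, fc m u = fc m w) : u = w := by
  have h1 := hasSum_fc_sq (u - w)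
  have h2 : (fun m : ℤ => ‖fc m (u - w)‖ ^ 2) = fun _ => 0 := by
    ext m; simp [h m]
  rw [h2] at h1
  have := h1.unique hasSum_zero
  rw [← sub_eq_zero, ← norm_eq_zero]
  exact pow_eq_zero_iff (two_ne_zero) |>.1 this

theorem norm_sq_le_of_sum_le {u : L2} {M : ℝ} (h : ∀ F : Finset ℤ, ∑ m ∈ F, ‖fc m u‖ ^ 2 ≤ M) :
    ‖u‖ ^ 2 ≤ M :=
  le_of_tendsto (hasSum_fc_sq u) (Eventually.of_forall h)

/-- Polarisation of Parseval's identity. -/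
theorem hasSum_inner_fc (u w : L2) :
    HasSum (fun m : ℤ => inner ℝ (fc m u) (fc m w)) (inner ℝ u w) := by
  have h := ((hasSum_fc_sq (u + w)).sub ((hasSum_fc_sq u).add (hasSum_fc_sq w))).div_const 2
  convert! h using 1
  · funext m
    rw [map_add, norm_add_sq_real]; ring
  · rw [norm_add_sq_real]; ring

theorem fc_neg (m : ℤ) (u : L2) : fc (-m) u = conj (fc m u) := by
  rw [fc_apply, fc_apply, ← coef_conj]
  simp

theorem fc_zero_eq (u : L2) :
    fc 0 u = (((√(2 * Real.pi))⁻¹ * ∫ x in Ioc (0 : ℝ) (2 * Real.pi), u x : ℝ) : ℂ) := by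
  rw [fc_apply]
  unfold coef
  push_cast
  rw [← integral_complex_ofReal]
  simp

theorem hasZeroMean_iff (u : L2) : HasZeroMean u ↔ fc 0 u = 0 := by
  have : (√(2 * Real.pi))⁻¹ ≠ 0 := by
    have := Real.two_pi_pos
    positivity
  rw [fc_zero_eq, Complex.ofReal_eq_zero, mul_eq_zero, or_iff_right this, HasZeroMean]

/-- Riesz–Fischer for real functions. The Fourier basis of the circle gives a complex function with
these coefficients. Passing to its real part replaces `a m` by the average of `a m` and `conj (a
(-m))`, which changes nothing under `hconj`. -/
theorem exists_fc_eq (a : ℤ → ℂ) (hconj : ∀ m, a (-m) = conj (a m))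
    (hsum : Summable fun m => ‖a m‖ ^ 2) : ∃ u : L2, ∀ m, fc m u = a m := by
  have hp : (0 : ℝ) < 2 * Real.pi := Real.two_pi_pos
  have : Fact ((0 : ℝ) < 2 * Real.pi) := ⟨hp⟩
  set r : ℝ := √(2 * Real.pi) with hr
  have hr0 : r ≠ 0 := by positivity
  have hmem : Memℓp (fun m => ((r⁻¹ : ℝ) : ℂ) * a m) 2 := by
    refine memℓp_gen ?_
    have := hsum.mul_left (r⁻¹ ^ 2)
    refine this.congr fun m => ?_
    rw [norm_mul, Complex.norm_real, ENNReal.toReal_ofNat, Real.rpow_two, mul_pow, Real.norm_eq_abs,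
      sq_abs]
  set F : Lp ℂ 2 (@AddCircle.haarAddCircle (2 * Real.pi) _) :=
    fourierBasis.repr.symm ⟨_, hmem⟩ with hF
  have hco : ∀ m, fourierCoeff F m = ((r⁻¹ : ℝ) : ℂ) * a m := fun m => by
    rw [← fourierBasis_repr, hF, LinearIsometryEquiv.apply_symm_apply]
  have hFmem : MemLp F 2 (volume : Measure (AddCircle (2 * Real.pi))) :=
    memLp_haarAddCircle_iff.1 (Lp.memLp F)
  have hmp := AddCircle.measurePreserving_mk (2 * Real.pi) 0
  rw [zero_add] at hmp
  have hfmem : MemLp (fun x : ℝ => F (x : AddCircle (2 * Real.pi))) 2 circ :=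
    hFmem.comp_measurePreserving hmp
  have hcoef : ∀ m, coef m (fun x : ℝ => F (x : AddCircle (2 * Real.pi))) = a m := fun m => by
    have h := hco m
    rw [fourierCoeff_eq_intervalIntegral _ _ 0, zero_add,
      intervalIntegral.integral_of_le hp.le] at h
    have h2 : ∫ x in Ioc 0 (2 * Real.pi), (fourier (-m)) (x : AddCircle (2 * Real.pi)) • F x
        = ∫ x, Complex.exp (-(m * x * Complex.I)) * F (x : AddCircle (2 * Real.pi)) ∂circ := by
      congr 1; ext x
      rw [fourier_coe_apply, smul_eq_mul]
      congr 2
      have : (Real.pi : ℂ) ≠ 0 := by exact_mod_cast Real.pi_ne_zero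
      push_cast
      field_simp
    rw [h2, Complex.real_smul] at h
    unfold coef
    rw [← hr]
    have h3 : a m = ((r : ℝ) : ℂ) * (((r⁻¹ : ℝ) : ℂ) * a m) := by
      rw [← mul_assoc, ← Complex.ofReal_mul, mul_inv_cancel₀ hr0]; simp
    rw [h3, ← h, ← mul_assoc]
    congr 1
    rw [← Complex.ofReal_mul]
    congr 1
    rw [← Real.mul_self_sqrt hp.le, ← hr]
    field_simp
  have hint : Integrable (fun x : ℝ => F (x : AddCircle (2 * Real.pi))) circ :=
    hfmem.integrable (by norm_num)
  refine ⟨hfmem.re.toLp, fun m => ?_⟩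
  have h1 : (fun x => ((hfmem.re.toLp : L2) x : ℂ)) =ᵐ[circ] fun x : ℝ =>
      (1 / 2 : ℂ) * (F (x : AddCircle (2 * Real.pi)) + conj (F (x : AddCircle (2 * Real.pi)))) := by
    filter_upwards [hfmem.re.coeFn_toLp] with x hx
    rw [hx, Complex.add_conj]
    simp
  have hint' : Integrable (fun x : ℝ => conj (F (x : AddCircle (2 * Real.pi)))) circ :=
    (hfmem.star).integrable (by norm_num)
  rw [fc_apply, coef_congr m h1, coef_const_mul, coef_add m hint hint', hcoef,
    ← neg_neg m, coef_conj, hcoef, hconj, hconj]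
  simp
  ring

theorem exists_multiplier (a : ℤ → ℂ) (hconj : ∀ m, a (-m) = conj (a m)) {C : ℝ}
    (hC : ∀ m, ‖a m‖ ≤ C) : ∃ A : L2 →L[ℝ] L2, ∀ u m, fc m (A u) = a m * fc m u := by
  have hC0 : 0 ≤ C := (norm_nonneg _).trans (hC 0)
  have hb : ∀ u m, ‖a m * fc m u‖ ^ 2 ≤ C ^ 2 * ‖fc m u‖ ^ 2 := fun u m => by
    rw [norm_mul, mul_pow]; gcongr; exact hC m
  have hex : ∀ u : L2, ∃ w : L2, ∀ m, fc m w = a m * fc m u := fun u =>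
    exists_fc_eq _ (fun m => by rw [hconj, fc_neg, map_mul])
      (Summable.of_nonneg_of_le (fun _ => by positivity) (hb u)
        ((hasSum_fc_sq u).summable.mul_left _))
  choose A hA using hex
  refine ⟨LinearMap.mkContinuous
    { toFun := A
      map_add' := fun u w => eq_of_fc_eq fun m => by simp only [map_add, hA]; ring
      map_smul' := fun c u => eq_of_fc_eq fun m => by
        simp only [map_smul, hA, RingHom.id_apply, Complex.real_smul]; ring } C fun u => ?_, hA⟩
  rw [← sq_le_sq₀ (norm_nonneg _) (by positivity), mul_pow]
  refine norm_sq_le_of_sum_le fun F => ?_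
  calc ∑ m ∈ F, ‖fc m (A u)‖ ^ 2 ≤ ∑ m ∈ F, C ^ 2 * ‖fc m u‖ ^ 2 :=
        Finset.sum_le_sum fun m _ => by rw [hA]; exact hb u m
    _ ≤ C ^ 2 * ‖u‖ ^ 2 := by rw [← Finset.mul_sum]; gcongr; exact sum_fc_sq_le u F

end CoupledKS

/-! ### Weak derivatives as Fourier multipliers -/

namespace CoupledKS

open Filter Topology ComplexConjugate

theorem integral_mul_re_mode (u : L2) (m : ℤ) (b : ℂ) :
    ∫ x, u x * (b * Complex.exp (-(m * x * Complex.I))).re ∂circ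
      = √(2 * Real.pi) * (b * fc m u).re := by
  have hr : (√(2 * Real.pi) : ℝ) ≠ 0 := by have := Real.two_pi_pos; positivity
  have h1 : b * fc m u = (((√(2 * Real.pi))⁻¹ : ℝ) : ℂ) *
      ∫ x, b * (Complex.exp (-(m * x * Complex.I)) * (u x : ℂ)) ∂circ := by
    rw [integral_const_mul b, fc_apply, coef]; ring
  have hint := (integrable_mode_mul m (integrable_ofReal u)).const_mul b
  rw [h1, Complex.re_ofReal_mul, ← mul_assoc, mul_inv_cancel₀ hr, one_mul,
    ← RCLike.re_eq_complex_re, ← integral_re hint]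
  refine integral_congr_ae (Eventually.of_forall fun x => ?_)
  simp only [RCLike.re_eq_complex_re]
  rw [← mul_assoc, mul_comm _ (u x : ℂ), Complex.re_ofReal_mul]

theorem hasDerivAt_re_mode (m : ℤ) (a : ℂ) (x : ℝ) :
    HasDerivAt (fun x : ℝ => (a * Complex.exp (-(m * x * Complex.I))).re)
      ((a * -(m * Complex.I)) * Complex.exp (-(m * x * Complex.I))).re x := by
  have h1 : HasDerivAt (fun x : ℝ => -((m : ℂ) * x * Complex.I)) (-(m * Complex.I)) x := by
    convert! (Complex.ofRealCLM.hasDerivAt (x := x)).const_mul (-(m * Complex.I)) using 1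
    · funext x; simp only [Complex.ofRealCLM_apply]; ring
    · simp
  have h2 := (h1.cexp.const_mul a)
  have h3 := Complex.reCLM.hasFDerivAt.comp_hasDerivAt x h2
  convert! h3 using 1
  simp only [Complex.reCLM_apply]
  congr 1; ring

theorem iteratedDeriv_re_mode (m : ℤ) (k : ℕ) (a : ℂ) :
    iteratedDeriv k (fun x : ℝ => (a * Complex.exp (-(m * x * Complex.I))).re)
      = fun x : ℝ => ((a * (-(m * Complex.I)) ^ k) * Complex.exp (-(m * x * Complex.I))).re := by
  induction k generalizing a with
  | zero => simp
  | succ k ih =>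
    rw [iteratedDeriv_succ', show deriv (fun x : ℝ => (a * Complex.exp (-(m * x * Complex.I))).re)
      = _ from funext fun x => (hasDerivAt_re_mode m a x).deriv, ih]
    funext x
    rw [pow_succ']; congr 2; ring

theorem isPeriodicTest_re_mode (m : ℤ) (a : ℂ) :
    IsPeriodicTest fun x : ℝ => (a * Complex.exp (-(m * x * Complex.I))).re := by
  constructor
  · have h1 : ContDiff ℝ (⊤ : ℕ∞) fun x : ℝ => a * Complex.exp (-((m : ℂ) * (x : ℂ) * Complex.I)) :=
      contDiff_const.mul (((contDiff_const.mul Complex.ofRealCLM.contDiff).mul contDiff_const).neg.cexp)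
    exact Complex.reCLM.contDiff.comp h1
  · intro x
    have : -((m : ℂ) * ((x + 2 * Real.pi : ℝ) : ℂ) * Complex.I)
        = -(m * x * Complex.I) + ((-m : ℤ) : ℂ) * (2 * Real.pi * Complex.I) := by
      push_cast; ring
    simp only
    rw [this, Complex.exp_add, Complex.exp_int_mul_two_pi_mul_I, mul_one]

/-- Test functions are real, so the definition is tested with real parts of `a * exp (-(m * x *
I))`. Taking `a = 1` and `a = -I` recovers the real and imaginary parts of the identity. -/
theorem IsWeakDeriv.fc_eq {k : ℕ} {u v : L2} (h : IsWeakDeriv k u v) (m : ℤ) :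
    fc m v = (m * Complex.I) ^ k * fc m u := by
  have hr : (√(2 * Real.pi) : ℝ) ≠ 0 := by have := Real.two_pi_pos; positivity
  have key : ∀ a : ℂ, (a * ((m * Complex.I) ^ k * fc m u)).re = (a * fc m v).re := fun a => by
    have h1 := h _ (isPeriodicTest_re_mode m a)
    rw [iteratedDeriv_re_mode, integral_mul_re_mode, integral_mul_re_mode, mul_left_comm] at h1
    have h2 := mul_left_cancel₀ hr h1
    have h3 : a * (-(m * Complex.I)) ^ k * fc m u
        = (((-1) ^ k : ℝ) : ℂ) * (a * ((m * Complex.I) ^ k * fc m u)) := by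
      rw [neg_pow]; push_cast; ring
    rw [h3, Complex.re_ofReal_mul] at h2
    exact mul_left_cancel₀ (pow_ne_zero k (by norm_num)) h2
  refine Complex.ext ?_ ?_
  · simpa using (key 1).symm
  · have := key (-Complex.I)
    simp only [neg_mul, Complex.neg_re, Complex.I_mul_re, neg_neg] at this
    exact this.symm

theorem memLp_of_continuous {φ : ℝ → ℝ} (h : Continuous φ) : MemLp φ 2 circ := by
  obtain ⟨C, hC⟩ := (isCompact_Icc (a := (0 : ℝ)) (b := 2 * Real.pi)).exists_bound_of_continuousOn
    h.continuousOn
  refine MemLp.of_bound h.aestronglyMeasurable C ?_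
  filter_upwards [ae_restrict_mem measurableSet_Ioc] with x hx
  exact hC x (Ioc_subset_Icc_self hx)

/-- A continuous function as an element of `L²(0,2π)`. -/
noncomputable def contL2 (φ : ℝ → ℝ) (h : Continuous φ) : L2 := (memLp_of_continuous h).toLp φ

theorem coeFn_contL2 {φ : ℝ → ℝ} (h : Continuous φ) : contL2 φ h =ᵐ[circ] φ :=
  (memLp_of_continuous h).coeFn_toLp

/-- Integration by parts over one period: the boundary terms cancel because `φ` and the test
function each agree at the two endpoints. -/
theorem isWeakDeriv_contL2 {φ φ' : ℝ → ℝ} (hφ : ∀ x, HasDerivAt φ (φ' x) x) (hφ' : Continuous φ')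
    (hper : φ (2 * Real.pi) = φ 0) :
    IsWeakDeriv 1 (contL2 φ (continuous_iff_continuousAt.2 fun x => (hφ x).continuousAt))
      (contL2 φ' hφ') := by
  rintro ψ ⟨hψ, hψper⟩
  have hc : Continuous φ := continuous_iff_continuousAt.2 fun x => (hφ x).continuousAt
  have hψd : ∀ x, HasDerivAt ψ (deriv ψ x) x := fun x =>
    (hψ.differentiable (by simp) x).hasDerivAt
  have hψc : Continuous (deriv ψ) := hψ.continuous_deriv (by simp)
  have h := intervalIntegral.integral_mul_deriv_eq_deriv_mul (a := 0) (b := 2 * Real.pi)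
    (fun x _ => hφ x) (fun x _ => hψd x) (hφ'.intervalIntegrable _ _) (hψc.intervalIntegrable _ _)
  have h0 : ψ (2 * Real.pi) = ψ 0 := by simpa using hψper 0
  rw [hper, h0, sub_self, zero_sub, intervalIntegral.integral_of_le Real.two_pi_pos.le,
    intervalIntegral.integral_of_le Real.two_pi_pos.le] at h
  rw [iteratedDeriv_one, pow_one, neg_one_mul]
  have e1 : ∫ x, contL2 φ hc x * deriv ψ x ∂circ = ∫ x, φ x * deriv ψ x ∂circ := by
    refine integral_congr_ae ?_
    filter_upwards [coeFn_contL2 hc] with x hx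
    rw [hx]
  have e2 : ∫ x, contL2 φ' hφ' x * ψ x ∂circ = ∫ x, φ' x * ψ x ∂circ := by
    refine integral_congr_ae ?_
    filter_upwards [coeFn_contL2 hφ'] with x hx
    rw [hx]
  rw [e1, e2, h]

theorem IsPeriodicTest.deriv {φ : ℝ → ℝ} (h : IsPeriodicTest φ) : IsPeriodicTest (deriv φ) := by
  refine ⟨(contDiff_infty_iff_deriv.1 h.1).2, fun x => ?_⟩
  have : (fun y => φ (y + 2 * Real.pi)) = φ := funext h.2
  conv_rhs => rw [← this]
  rw [deriv_comp_add_const]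

theorem IsPeriodicTest.iteratedDeriv {φ : ℝ → ℝ} (h : IsPeriodicTest φ) (k : ℕ) :
    IsPeriodicTest (iteratedDeriv k φ) := by
  induction k with
  | zero => simpa using h
  | succ k ih => rw [iteratedDeriv_succ]; exact ih.deriv

theorem fc_iteratedDeriv {φ : ℝ → ℝ} (h : IsPeriodicTest φ) (k : ℕ) (m : ℤ) :
    fc m (contL2 _ (h.iteratedDeriv k).1.continuous)
      = (m * Complex.I) ^ k * fc m (contL2 φ h.1.continuous) := by
  induction k with
  | zero => simp
  | succ k ih =>
    have hk := h.iteratedDeriv k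
    have hw := (isWeakDeriv_contL2 (φ := _root_.iteratedDeriv k φ)
      (fun x => (hk.1.differentiable (by simp) x).hasDerivAt)
      (hk.1.continuous_deriv (by simp)) (by simpa using hk.2 0)).fc_eq m
    rw [pow_one, ih] at hw
    rw [pow_succ', mul_assoc, ← hw]
    congr 2
    rw [iteratedDeriv_succ]

theorem inner_contL2 (u : L2) {φ : ℝ → ℝ} (h : Continuous φ) :
    inner ℝ u (contL2 φ h) = ∫ x, u x * φ x ∂circ := by
  rw [L2.inner_def]
  refine integral_congr_ae ?_
  filter_upwards [coeFn_contL2 h] with x hx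
  rw [hx, real_inner_eq_re_inner]
  simp [mul_comm]

/-- For the converse, both integrals are expanded by Parseval. Differentiating the test function
multiplies its coefficients by `(m * I) ^ k`, and moving this factor across the real inner product
conjugates it, which produces the sign `(-1) ^ k`. -/
theorem isWeakDeriv_iff {k : ℕ} {u v : L2} :
    IsWeakDeriv k u v ↔ ∀ m : ℤ, fc m v = (m * Complex.I) ^ k * fc m u := by
  refine ⟨fun h => h.fc_eq, fun h φ hφ => ?_⟩
  rw [← inner_contL2 u (hφ.iteratedDeriv k).1.continuous, ← inner_contL2 v hφ.1.continuous]
  refine (hasSum_inner_fc _ _).unique ?_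
  convert! (hasSum_inner_fc v (contL2 φ hφ.1.continuous)).mul_left ((-1) ^ k) using 1
  funext m
  rw [fc_iteratedDeriv hφ, h m]
  simp only [Complex.inner]
  have : ((m : ℂ) * Complex.I) ^ k = (-1) ^ k * conj (((m : ℂ) * Complex.I) ^ k) := by
    rw [map_pow, map_mul, Complex.conj_I, map_intCast, ← mul_pow]; congr 1; ring
  rw [map_mul]
  conv_lhs => rw [this]
  rw [show ((-1 : ℝ) ^ k) * _ = _ from (Complex.re_ofReal_mul _ _).symm]
  congr 1; push_cast; ring

end CoupledKS

/-! ### Energy identity and Grönwall's inequality for absolutely continuous curves in a Hilbert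
space -/

namespace CoupledKS

open Filter Topology

section Time

variable {H : Type*} [NormedAddCommGroup H]

theorem intervalIntegrable_of_mem {v : ℝ → H} {T s t : ℝ} (hT : 0 ≤ T)
    (hv : IntervalIntegrable v volume 0 T) (hs : s ∈ Icc 0 T) (ht : t ∈ Icc 0 T) :
    IntervalIntegrable v volume s t :=
  hv.mono_set (uIcc_subset_uIcc (by rwa [uIcc_of_le hT]) (by rwa [uIcc_of_le hT]))

variable [InnerProductSpace ℝ H]

theorem continuousOn_of_eq_add_integral {u v : ℝ → H} {T : ℝ} (hT : 0 ≤ T)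
    (hv : IntervalIntegrable v volume 0 T)
    (hu : ∀ t ∈ Icc 0 T, u t = u 0 + ∫ s in (0 : ℝ)..t, v s) : ContinuousOn u (Icc 0 T) := by
  have h := intervalIntegral.continuousOn_primitive_interval' hv left_mem_uIcc
  rw [uIcc_of_le hT] at h
  exact (continuousOn_const.add h).congr hu

theorem sub_eq_integral {u v : ℝ → H} {T : ℝ} (hT : 0 ≤ T)
    (hv : IntervalIntegrable v volume 0 T)
    (hu : ∀ t ∈ Icc 0 T, u t = u 0 + ∫ s in (0 : ℝ)..t, v s) {s t : ℝ}
    (hs : s ∈ Icc 0 T) (ht : t ∈ Icc 0 T) : u t - u s = ∫ r in s..t, v r := by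
  rw [hu t ht, hu s hs, add_sub_add_left_eq_sub]
  have h0 : (0 : ℝ) ∈ Icc 0 T := ⟨le_rfl, hT⟩
  exact intervalIntegral.integral_interval_sub_left (intervalIntegrable_of_mem hT hv h0 ht)
    (intervalIntegrable_of_mem hT hv h0 hs)

/-- Increments of `u` are dominated by those of the primitive of `‖v‖`, which is absolutely
continuous. Squaring is Lipschitz with constant `2 * M` on the range of the norm; the extra `1`
keeps the divisor positive. -/
theorem norm_sq_absolutelyContinuous {u v : ℝ → H} {T : ℝ} (hT : 0 ≤ T)
    (hv : IntervalIntegrable v volume 0 T)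
    (hu : ∀ t ∈ Icc 0 T, u t = u 0 + ∫ s in (0 : ℝ)..t, v s) :
    AbsolutelyContinuousOnInterval (fun t => ‖u t‖ ^ 2) 0 T := by
  obtain ⟨M, hM⟩ := isCompact_Icc.exists_bound_of_continuousOn
    (continuousOn_of_eq_add_integral hT hv hu)
  have hM0 : 0 ≤ M := (norm_nonneg _).trans (hM 0 ⟨le_rfl, hT⟩)
  have hW := hv.norm.absolutelyContinuousOnInterval_intervalIntegral (c := 0) left_mem_uIcc
  rw [absolutelyContinuousOnInterval_iff] at hW ⊢
  intro ε hε
  obtain ⟨δ, hδ, h⟩ := hW (ε / (2 * M + 1)) (by positivity)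
  refine ⟨δ, hδ, fun E hE hlen => ?_⟩
  have h1 := h E hE hlen
  have hmem : ∀ i ∈ Finset.range E.1, (E.2 i).1 ∈ Icc 0 T ∧ (E.2 i).2 ∈ Icc 0 T := by
    have := hE.1
    rwa [uIcc_of_le hT] at this
  calc ∑ i ∈ Finset.range E.1, dist (‖u (E.2 i).1‖ ^ 2) (‖u (E.2 i).2‖ ^ 2)
      ≤ ∑ i ∈ Finset.range E.1, (2 * M + 1) * dist (∫ r in (0 : ℝ)..(E.2 i).1, ‖v r‖)
          (∫ r in (0 : ℝ)..(E.2 i).2, ‖v r‖) := by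
        refine Finset.sum_le_sum fun i hi => ?_
        obtain ⟨ha, hb⟩ := hmem i hi
        set a := (E.2 i).1
        set b := (E.2 i).2
        have e1 : ‖u a - u b‖ ≤ dist (∫ r in (0 : ℝ)..a, ‖v r‖) (∫ r in (0 : ℝ)..b, ‖v r‖) := by
          have h0 : (0 : ℝ) ∈ Icc 0 T := ⟨le_rfl, hT⟩
          rw [sub_eq_integral hT hv hu hb ha, Real.dist_eq,
            intervalIntegral.integral_interval_sub_left
              (intervalIntegrable_of_mem hT hv h0 ha).norm
              (intervalIntegrable_of_mem hT hv h0 hb).norm]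
          exact intervalIntegral.norm_integral_le_abs_integral_norm
        have e2 : dist (‖u a‖ ^ 2) (‖u b‖ ^ 2) ≤ 2 * M * ‖u a - u b‖ := by
          rw [Real.dist_eq, sq_sub_sq, abs_mul]
          have := abs_norm_sub_norm_le (u a) (u b)
          have h3 : |‖u a‖ + ‖u b‖| ≤ 2 * M := by
            rw [abs_of_nonneg (by positivity)]; linarith [hM a ha, hM b hb]
          gcongr
        have e3 : 0 ≤ ‖u a - u b‖ := norm_nonneg _
        nlinarith
    _ < ε := by
        rw [← Finset.mul_sum]
        rw [lt_div_iff₀ (by positivity)] at h1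
        linarith

variable [CompleteSpace H]

/-- Since `v` is merely integrable, the chain rule holds only almost everywhere (Lebesgue
differentiation). Absolute continuity of `‖u‖ ^ 2` is what allows the derivative to be integrated
back. -/
theorem norm_sq_eq_add_integral {u v : ℝ → H} {T : ℝ} (hT : 0 ≤ T)
    (hv : IntervalIntegrable v volume 0 T)
    (hu : ∀ t ∈ Icc 0 T, u t = u 0 + ∫ s in (0 : ℝ)..t, v s) {t : ℝ} (ht : t ∈ Icc 0 T) :
    ‖u t‖ ^ 2 = ‖u 0‖ ^ 2 + ∫ s in (0 : ℝ)..t, 2 * inner ℝ (u s) (v s) := by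
  have hv' := intervalIntegrable_of_mem hT hv ⟨le_rfl, hT⟩ ht
  have hu' : ∀ s ∈ Icc 0 t, u s = u 0 + ∫ r in (0 : ℝ)..s, v r := fun s hs =>
    hu s ⟨hs.1, hs.2.trans ht.2⟩
  have hac := norm_sq_absolutelyContinuous ht.1 hv' hu'
  rw [← sub_eq_iff_eq_add', ← hac.integral_deriv_eq_sub]
  refine intervalIntegral.integral_congr_ae ?_
  have hne : ∀ᵐ x : ℝ, x ≠ t := by simp [ae_iff, measure_singleton]
  filter_upwards [hv'.ae_hasDerivAt_integral, hne] with x hx hxt hxm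
  rw [uIoc_of_le ht.1] at hxm
  have hd := hx (by rw [uIcc_of_le ht.1]; exact ⟨hxm.1.le, hxm.2⟩) 0 left_mem_uIcc
  have hd' : HasDerivAt u (v x) x := by
    refine (hd.const_add (u 0)).congr_of_eventuallyEq ?_
    filter_upwards [Ioo_mem_nhds hxm.1 (lt_of_le_of_ne hxm.2 hxt)] with y hy
    exact hu' y ⟨hy.1.le, hy.2.le⟩
  exact hd'.norm_sq.deriv

/-- Grönwall: `exp (-(C * t))` times the right-hand side of `h` is antitone. The bound is on that
right-hand side and not only on `y`, because in `energy_estimate` it also dominates the dissipation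
integral. -/
theorem add_integral_le_exp {y : ℝ → ℝ} {T K C : ℝ} (hT : 0 ≤ T) (hy : ContinuousOn y (Icc 0 T))
    (hC : 0 ≤ C) (h : ∀ t ∈ Icc 0 T, y t ≤ K + C * ∫ s in (0 : ℝ)..t, y s) {t : ℝ}
    (ht : t ∈ Icc 0 T) : K + C * ∫ s in (0 : ℝ)..t, y s ≤ K * Real.exp (C * t) := by
  have hi : IntervalIntegrable y volume 0 T := (by rwa [uIcc_of_le hT] :
    ContinuousOn y (uIcc 0 T)).intervalIntegrable
  set z : ℝ → ℝ := fun t => K + C * ∫ s in (0 : ℝ)..t, y s with hz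
  have hzc : ContinuousOn z (Icc 0 T) := by
    have := intervalIntegral.continuousOn_primitive_interval' hi left_mem_uIcc
    rw [uIcc_of_le hT] at this
    exact continuousOn_const.add (continuousOn_const.mul this)
  have hzd : ∀ x ∈ Ioo 0 T, HasDerivAt z (C * y x) x := fun x hx => by
    refine ((intervalIntegral.integral_hasDerivAt_right
      (intervalIntegrable_of_mem hT hi ⟨le_rfl, hT⟩ (Ioo_subset_Icc_self hx)) ?_ ?_).const_mul
        C).const_add K
    · exact (hy.mono Ioo_subset_Icc_self).stronglyMeasurableAtFilter isOpen_Ioo x hx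
    · exact hy.continuousAt (Icc_mem_nhds hx.1 hx.2)
  have hwd : ∀ x ∈ Ioo 0 T, HasDerivAt (fun t => Real.exp (-(C * t)) * z t)
      (Real.exp (-(C * x)) * (C * (y x - z x))) x := fun x hx => by
    have h1 : HasDerivAt (fun t => Real.exp (-(C * t))) (Real.exp (-(C * x)) * (-C)) x := by
      have : HasDerivAt (fun t => -(C * t)) (-C) x := by
        simpa using ((hasDerivAt_id x).const_mul C).fun_neg
      exact this.exp
    convert! h1.mul (hzd x hx) using 1
    ring
  have hanti : AntitoneOn (fun t => Real.exp (-(C * t)) * z t) (Icc 0 T) := by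
    refine antitoneOn_of_deriv_nonpos (convex_Icc _ _) ?_ ?_ ?_
    · exact ContinuousOn.mul (by fun_prop) hzc
    · rw [interior_Icc]
      exact fun x hx => (hwd x hx).differentiableAt.differentiableWithinAt
    · rw [interior_Icc]
      intro x hx
      rw [(hwd x hx).deriv]
      have := h x (Ioo_subset_Icc_self hx)
      refine mul_nonpos_of_nonneg_of_nonpos (Real.exp_pos _).le
        (mul_nonpos_of_nonneg_of_nonpos hC ?_)
      simp only [hz]; linarith
  have h2 := hanti ⟨le_rfl, hT⟩ ht ht.1
  have h3 : z 0 = K := by simp [hz]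
  simp only [mul_zero, neg_zero, Real.exp_zero, one_mul, h3] at h2
  rw [Real.exp_neg, inv_mul_le_iff₀ (Real.exp_pos _)] at h2
  rw [mul_comm K]
  exact h2

/-- The common form of every energy argument below: `d` is the dissipation and `h` the forcing. It
serves the coupled L² estimate, the estimate of each single mode and the a priori bound for the
Galerkin equation. -/
theorem energy_estimate {u v : ℝ → H} {d h : ℝ → ℝ} {T C : ℝ} (hT : 0 ≤ T) (hC : 0 ≤ C)
    (hv : IntervalIntegrable v volume 0 T)
    (hu : ∀ t ∈ Icc 0 T, u t = u 0 + ∫ s in (0 : ℝ)..t, v s)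
    (hd : IntervalIntegrable d volume 0 T) (hd0 : ∀ t, 0 ≤ d t)
    (hh : IntervalIntegrable h volume 0 T) (hh0 : ∀ t, 0 ≤ h t)
    (hle : ∀ᵐ s ∂(volume.restrict (Ioc 0 T)),
      2 * inner ℝ (u s) (v s) ≤ -d s + C * ‖u s‖ ^ 2 + h s) {t : ℝ} (ht : t ∈ Icc 0 T) :
    ‖u t‖ ^ 2 + ∫ s in (0 : ℝ)..t, d s
      ≤ (‖u 0‖ ^ 2 + ∫ s in (0 : ℝ)..T, h s) * Real.exp (C * T) := by
  have huc := continuousOn_of_eq_add_integral hT hv hu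
  have hyc : ContinuousOn (fun t => ‖u t‖ ^ 2) (Icc 0 T) := huc.norm.pow 2
  have h0 : (0 : ℝ) ∈ Icc 0 T := ⟨le_rfl, hT⟩
  have hyi : IntervalIntegrable (fun t => ‖u t‖ ^ 2) volume 0 T := (by rwa [uIcc_of_le hT] :
    ContinuousOn (fun t => ‖u t‖ ^ 2) (uIcc 0 T)).intervalIntegrable
  have hii : IntervalIntegrable (fun s => 2 * inner ℝ (u s) (v s)) volume 0 T := by
    obtain ⟨M, hM⟩ := isCompact_Icc.exists_bound_of_continuousOn huc
    rw [intervalIntegrable_iff_integrableOn_Ioc_of_le hT] at hv ⊢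
    refine Integrable.const_mul ?_ 2
    refine Integrable.mono' (g := fun s => M * ‖v s‖) (hv.norm.const_mul M) ?_ ?_
    · exact ((huc.mono Ioc_subset_Icc_self).aestronglyMeasurable measurableSet_Ioc).inner
        hv.aestronglyMeasurable
    · filter_upwards [ae_restrict_mem measurableSet_Ioc] with s hs
      refine (norm_inner_le_norm _ _).trans ?_
      gcongr
      exact hM s (Ioc_subset_Icc_self hs)
  have key : ∀ t ∈ Icc 0 T, ‖u t‖ ^ 2 + ∫ s in (0 : ℝ)..t, d s
      ≤ (‖u 0‖ ^ 2 + ∫ s in (0 : ℝ)..T, h s) + C * ∫ s in (0 : ℝ)..t, ‖u s‖ ^ 2 := by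
    intro t ht
    have hsub : ∀ {f : ℝ → ℝ}, IntervalIntegrable f volume 0 T → IntervalIntegrable f volume 0 t :=
      fun hf => intervalIntegrable_of_mem hT hf h0 ht
    rw [norm_sq_eq_add_integral hT hv hu ht, add_assoc, add_assoc]
    gcongr ‖u 0‖ ^ 2 + ?_
    rw [← intervalIntegral.integral_add (hsub hii) (hsub hd)]
    have e1 : ∫ s in (0 : ℝ)..t, h s ≤ ∫ s in (0 : ℝ)..T, h s :=
      intervalIntegral.integral_mono_interval le_rfl ht.1 ht.2 (Eventually.of_forall hh0) hh
    refine le_trans ?_ (add_le_add_left e1 _)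
    rw [← intervalIntegral.integral_const_mul,
      ← intervalIntegral.integral_add (hsub hh) ((hsub hyi).const_mul C)]
    refine intervalIntegral.integral_mono_ae_restrict ht.1 ((hsub hii).add (hsub hd))
      ((hsub hh).add ((hsub hyi).const_mul C)) ?_
    rw [Measure.restrict_congr_set Ioc_ae_eq_Icc.symm]
    have := ae_restrict_of_ae_restrict_of_subset (Ioc_subset_Ioc_right ht.2) hle
    filter_upwards [this] with s hs
    linarith
  have hK0 : 0 ≤ ‖u 0‖ ^ 2 + ∫ s in (0 : ℝ)..T, h s :=
    add_nonneg (by positivity) (intervalIntegral.integral_nonneg hT fun s _ => hh0 s)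
  refine (key t ht).trans ((add_integral_le_exp hT hyc hC (fun t ht => ?_) ht).trans ?_)
  · refine le_trans ?_ (key t ht)
    have := intervalIntegral.integral_nonneg ht.1 (μ := volume) fun s _ => hd0 s
    linarith
  · gcongr
    exact ht.2

end Time

end CoupledKS

/-! ### Global solvability of dissipative ODEs with square integrable forcing -/

namespace CoupledKS

open Filter Topology NNReal

section ODE

variable {H : Type*} [NormedAddCommGroup H]

/-- The continuous cutoff equal to `1` for `r ≤ R` and to `0` for `r ≥ R + 1`. -/
noncomputable def cutoff (R r : ℝ) : ℝ := max 0 (min 1 (R + 1 - r))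

theorem cutoff_nonneg (R r : ℝ) : 0 ≤ cutoff R r := le_max_left _ _

theorem cutoff_le_one (R r : ℝ) : cutoff R r ≤ 1 := max_le zero_le_one (min_le_left _ _)

theorem cutoff_eq_one {R r : ℝ} (h : r ≤ R) : cutoff R r = 1 := by
  unfold cutoff
  rw [min_eq_left (by linarith), max_eq_right zero_le_one]

theorem cutoff_eq_zero {R r : ℝ} (h : R + 1 ≤ r) : cutoff R r = 0 := by
  unfold cutoff
  rw [max_eq_left]
  exact (min_le_right _ _).trans (by linarith)

theorem abs_cutoff_sub_le (R r s : ℝ) : |cutoff R r - cutoff R s| ≤ |r - s| := by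
  unfold cutoff
  refine (abs_max_sub_max_le_max _ _ _ _).trans ?_
  rw [sub_self, abs_zero]
  refine max_le (abs_nonneg _) ((abs_min_sub_min_le_max _ _ _ _).trans ?_)
  rw [sub_self, abs_zero]
  refine max_le (abs_nonneg _) (le_of_eq ?_)
  rw [abs_sub_comm]; congr 1; ring

variable [NormedSpace ℝ H]

/-- Only one of the two points has to lie in the ball: the factor vanishes outside, so the other
point contributes nothing there. A single `L` is made to serve as Lipschitz constant and as bound.
-/
theorem cutoff_smul_lipschitz {G : H → H} {R : ℝ} (hR : 0 ≤ R) {K : ℝ≥0}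
    (hG : LipschitzOnWith K G (Metric.closedBall 0 (R + 1))) :
    ∃ L : ℝ≥0, LipschitzWith L (fun x => cutoff R ‖x‖ • G x) ∧
      ∀ x, ‖cutoff R ‖x‖ • G x‖ ≤ L := by
  set B : ℝ≥0 := ‖G 0‖₊ + K * ⟨R + 1, by linarith⟩ with hB
  have h0 : (0 : H) ∈ Metric.closedBall (0 : H) (R + 1) := Metric.mem_closedBall_self (by linarith)
  have hGb : ∀ x, ‖x‖ ≤ R + 1 → ‖G x‖ ≤ B := fun x hx => by
    have h1 := hG.norm_sub_le (mem_closedBall_zero_iff.2 hx) h0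
    rw [sub_zero] at h1
    have h2 : ‖G x‖ ≤ ‖G 0‖ + ‖G x - G 0‖ := by
      have := norm_add_le (G 0) (G x - G 0)
      rwa [add_sub_cancel] at this
    have h3 : (K : ℝ) * ‖x‖ ≤ K * (R + 1) := by gcongr
    have h4 : (B : ℝ) = ‖G 0‖ + K * (R + 1) := rfl
    rw [h4]; linarith
  have hmain : ∀ x y : H, ‖x‖ ≤ R + 1 →
      ‖cutoff R ‖x‖ • G x - cutoff R ‖y‖ • G y‖ ≤ (B + K) * ‖x - y‖ := fun x y hx => by
    have hc : |cutoff R ‖x‖ - cutoff R ‖y‖| ≤ ‖x - y‖ :=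
      (abs_cutoff_sub_le R _ _).trans (abs_norm_sub_norm_le x y)
    have e : cutoff R ‖x‖ • G x - cutoff R ‖y‖ • G y
        = (cutoff R ‖x‖ - cutoff R ‖y‖) • G x + cutoff R ‖y‖ • (G x - G y) := by
      rw [sub_smul, smul_sub]; abel
    have h1 : ‖(cutoff R ‖x‖ - cutoff R ‖y‖) • G x‖ ≤ ‖x - y‖ * B := by
      rw [norm_smul, Real.norm_eq_abs]
      gcongr
      exact hGb x hx
    have h2 : ‖cutoff R ‖y‖ • (G x - G y)‖ ≤ K * ‖x - y‖ := by
      rcases le_total ‖y‖ (R + 1) with hy | hy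
      · rw [norm_smul, Real.norm_of_nonneg (cutoff_nonneg _ _)]
        have := hG.norm_sub_le (mem_closedBall_zero_iff.2 hx) (mem_closedBall_zero_iff.2 hy)
        calc _ ≤ 1 * (K * ‖x - y‖) := by
              gcongr
              exact cutoff_le_one _ _
          _ = _ := one_mul _
      · rw [cutoff_eq_zero hy, zero_smul, norm_zero]; positivity
    rw [e]
    refine (norm_add_le _ _).trans ?_
    linarith
  refine ⟨B + K, LipschitzWith.of_dist_le_mul fun x y => ?_, fun x => ?_⟩
  · rw [dist_eq_norm, dist_eq_norm, NNReal.coe_add]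
    rcases le_total ‖x‖ (R + 1) with hx | hx
    · exact hmain x y hx
    rcases le_total ‖y‖ (R + 1) with hy | hy
    · rw [norm_sub_rev, norm_sub_rev x]; exact hmain y x hy
    · rw [cutoff_eq_zero hx, cutoff_eq_zero hy]
      simp only [zero_smul, sub_self, norm_zero]
      positivity
  · have : ((B + K : ℝ≥0) : ℝ) = B + K := rfl
    rw [this]
    rcases le_total ‖x‖ (R + 1) with hx | hx
    · rw [norm_smul, Real.norm_of_nonneg (cutoff_nonneg _ _)]
      have := hGb x hx
      have h1 : cutoff R ‖x‖ * ‖G x‖ ≤ 1 * B := by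
        gcongr
        exact cutoff_le_one _ _
      have := K.2
      linarith [show (0 : ℝ) ≤ K from this]
    · rw [cutoff_eq_zero hx, zero_smul, norm_zero]; positivity

/-- The forcing `g` need not be continuous, so its primitive `Φ` is subtracted first: the remainder
solves an equation whose field `G (x + Φ t)` is continuous in time. Boundedness of `G` keeps the
solution in a ball of radius `L * T`, so Picard–Lindelöf covers all of `[0, T]` at once. -/
theorem exists_solution_of_lipschitz [CompleteSpace H] {G : H → H} {L : ℝ≥0}
    (hG : LipschitzWith L G) (hGL : ∀ x, ‖G x‖ ≤ L) {g : ℝ → H} {T : ℝ} (hT : 0 ≤ T)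
    (hg : IntervalIntegrable g volume 0 T) (x₀ : H) :
    ∃ u : ℝ → H, ContinuousOn u (Icc 0 T) ∧ u 0 = x₀ ∧
      ∀ t ∈ Icc 0 T, u t = x₀ + ∫ s in (0 : ℝ)..t, (G (u s) + g s) := by
  set Φ : ℝ → H := fun t => ∫ s in (0 : ℝ)..t, g s with hΦ
  have hΦc : ContinuousOn Φ (Icc 0 T) := by
    have := intervalIntegral.continuousOn_primitive_interval' hg left_mem_uIcc
    rwa [uIcc_of_le hT] at this
  have hpl : IsPicardLindelof (fun t x => G (x + Φ t)) (⟨0, le_rfl, hT⟩ : Icc 0 T) x₀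
      (L * ⟨T, hT⟩) 0 L L := by
    refine ⟨fun t _ => ?_, fun x _ => ?_, fun t _ x _ => hGL _, ?_⟩
    · refine LipschitzWith.lipschitzOnWith (LipschitzWith.of_dist_le_mul fun x y => ?_)
      simpa using hG.dist_le_mul (x + Φ t) (y + Φ t)
    · exact hG.continuous.comp_continuousOn (continuousOn_const.add hΦc)
    · simp only [sub_zero, sub_self, max_eq_left hT, NNReal.coe_zero]
      exact le_rfl
  obtain ⟨α, hα0, hα⟩ := hpl.exists_eq_forall_mem_Icc_hasDerivWithinAt₀
  have hαc : ContinuousOn α (Icc 0 T) := fun t ht => (hα t ht).continuousWithinAt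
  have huc : ContinuousOn (fun t => α t + Φ t) (Icc 0 T) := hαc.add hΦc
  have hGi : ContinuousOn (fun t => G (α t + Φ t)) (Icc 0 T) := hG.continuous.comp_continuousOn huc
  refine ⟨fun t => α t + Φ t, huc, by simp [hΦ, hα0], fun t ht => ?_⟩
  have hsub : Icc 0 t ⊆ Icc 0 T := Icc_subset_Icc_right ht.2
  have hGt : IntervalIntegrable (fun t => G (α t + Φ t)) volume 0 t :=
    (by rw [uIcc_of_le ht.1]; exact hGi.mono hsub :
      ContinuousOn (fun t => G (α t + Φ t)) (uIcc 0 t)).intervalIntegrable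
  have h1 : ∫ s in (0 : ℝ)..t, G (α s + Φ s) = α t - α 0 :=
    intervalIntegral.integral_eq_sub_of_hasDerivAt_of_le ht.1 (hαc.mono hsub)
      (fun s hs => (hα s ⟨hs.1.le, hs.2.le.trans ht.2⟩).hasDerivAt
        (Icc_mem_nhds hs.1 (hs.2.trans_le ht.2))) hGt
  rw [intervalIntegral.integral_add hGt (intervalIntegrable_of_mem hT hg ⟨le_rfl, hT⟩ ht), h1]
  have h2 : α 0 = x₀ := hα0
  rw [h2]
  change α t + Φ t = x₀ + (α t - x₀ + Φ t)
  abel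

end ODE

/-- The truncated field is still dissipative because the cutoff lies between 0 and 1. The resulting
bound `M` does not depend on the cutoff radius, so the radius can be chosen so large that the cutoff
is never active. -/
theorem exists_solution_of_dissipative {H : Type*} [NormedAddCommGroup H] [InnerProductSpace ℝ H]
    [CompleteSpace H] {G : H → H}
    (hG : ∀ R : ℝ, ∃ K : ℝ≥0, LipschitzOnWith K G (Metric.closedBall 0 R)) {C : ℝ} (hC : 0 ≤ C)
    (hdiss : ∀ x, inner ℝ x (G x) ≤ C * ‖x‖ ^ 2) {g : ℝ → H} {T : ℝ} (hT : 0 ≤ T)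
    (hg : MemLp g 2 (volume.restrict (Ioc 0 T))) (x₀ : H) :
    ∃ u : ℝ → H, ContinuousOn u (Icc 0 T) ∧ u 0 = x₀ ∧
      ∀ t ∈ Icc 0 T, u t = x₀ + ∫ s in (0 : ℝ)..t, (G (u s) + g s) := by
  have hgi : IntervalIntegrable g volume 0 T :=
    (intervalIntegrable_iff_integrableOn_Ioc_of_le hT).2 (hg.integrable (by norm_num))
  have hg2 : IntervalIntegrable (fun s => ‖g s‖ ^ 2) volume 0 T :=
    (intervalIntegrable_iff_integrableOn_Ioc_of_le hT).2 (hg.integrable_norm_pow (by norm_num))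
  set M : ℝ := (‖x₀‖ ^ 2 + ∫ s in (0 : ℝ)..T, ‖g s‖ ^ 2) * Real.exp ((2 * C + 1) * T) with hM
  have hM0 : 0 ≤ M := by
    have := intervalIntegral.integral_nonneg hT (μ := volume) (f := fun s => ‖g s‖ ^ 2)
      fun s _ => by positivity
    positivity
  -- From `‖u t‖ ^ 2 ≤ M` one gets `‖u t‖ ≤ M + 1`, without a square root.
  set R : ℝ := M + 1 with hR
  obtain ⟨K, hK⟩ := hG (R + 1)
  obtain ⟨L, hL, hLb⟩ := cutoff_smul_lipschitz (by linarith : 0 ≤ R) hK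
  obtain ⟨u, huc, hu0, hu⟩ := exists_solution_of_lipschitz hL hLb hT hgi x₀
  refine ⟨u, huc, hu0, fun t ht => ?_⟩
  have hbd : ∀ t ∈ Icc 0 T, ‖u t‖ ≤ R := fun t ht => by
    have hvi : IntervalIntegrable (fun s => cutoff R ‖u s‖ • G (u s) + g s) volume 0 T := by
      refine IntervalIntegrable.add (ContinuousOn.intervalIntegrable ?_) hgi
      rw [uIcc_of_le hT]
      exact hL.continuous.comp_continuousOn huc
    have := energy_estimate (u := u) (d := fun _ => 0) (h := fun s => ‖g s‖ ^ 2) (C := 2 * C + 1) hT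
      (by linarith) hvi (by rw [hu0]; exact hu) (by simp) (fun _ => le_rfl) hg2
      (fun _ => by positivity) (Eventually.of_forall fun s => ?_) ht
    · rw [intervalIntegral.integral_zero, add_zero, hu0, ← hM] at this
      nlinarith [norm_nonneg (u t)]
    · rw [inner_add_right, inner_smul_right]
      have h1 : cutoff R ‖u s‖ * inner ℝ (u s) (G (u s)) ≤ C * ‖u s‖ ^ 2 :=
        (mul_le_mul_of_nonneg_left (hdiss _) (cutoff_nonneg _ _)).trans
          (mul_le_of_le_one_left (by positivity) (cutoff_le_one _ _))
      have h2 := real_inner_le_norm (u s) (g s)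
      nlinarith [sq_nonneg (‖u s‖ - ‖g s‖)]
  rw [hu t ht]
  congr 1
  refine intervalIntegral.integral_congr fun s hs => ?_
  rw [uIcc_of_le ht.1] at hs
  rw [cutoff_eq_one (hbd s ⟨hs.1, hs.2.trans ht.2⟩), one_smul]

end CoupledKS

/-! ### The convection term u u_x -/

namespace CoupledKS

open Filter Topology ComplexConjugate

/-- The `m`-th Fourier coefficient of the integrable function `u²`. -/
noncomputable def sqc (m : ℤ) (u : L2) : ℂ := coef m (fun x => ((u x ^ 2 : ℝ) : ℂ))

theorem integrable_mul_L2 (u w : L2) : Integrable (fun x => u x * w x) circ :=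
  (Lp.memLp u).integrable_mul (Lp.memLp w)

theorem integral_abs_mul_le (u w : L2) : ∫ x, |u x * w x| ∂circ ≤ ‖u‖ * ‖w‖ := by
  have hu := (Lp.memLp u).norm
  have hw := (Lp.memLp w).norm
  have h := real_inner_le_norm (hu.toLp : L2) (hw.toLp : L2)
  rw [Lp.norm_toLp, Lp.norm_toLp, eLpNorm_norm, eLpNorm_norm, ← Lp.norm_def, ← Lp.norm_def,
    L2.inner_def] at h
  refine le_trans (le_of_eq (integral_congr_ae ?_)) h
  filter_upwards [hu.coeFn_toLp, hw.coeFn_toLp] with x h1 h2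
  rw [h1, h2, abs_mul]
  simp [mul_comm]

theorem integrable_sq (u : L2) : Integrable (fun x => ((u x ^ 2 : ℝ) : ℂ)) circ := by
  refine Integrable.ofReal ((integrable_mul_L2 u u).congr (Eventually.of_forall fun x => ?_))
  exact (sq (u x)).symm

/-- Factor u² − w² = (u − w)(u + w) and apply Cauchy–Schwarz. Strong L² convergence of the states is
therefore enough to pass to the limit in the nonlinearity. -/
theorem norm_sqc_sub_le (m : ℤ) (u w : L2) : ‖sqc m u - sqc m w‖ ≤ ‖u - w‖ * ‖u + w‖ := by
  have h1 : sqc m u - sqc m w = coef m (fun x => (((u - w : L2) x * (u + w : L2) x : ℝ) : ℂ)) := by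
    rw [sub_eq_iff_eq_add, sqc, sqc,
      ← coef_add m (g := fun x => (((u - w : L2) x * (u + w : L2) x : ℝ) : ℂ))
        (Integrable.ofReal (integrable_mul_L2 _ _)) (integrable_sq w)]
    refine coef_congr m ?_
    filter_upwards [Lp.coeFn_sub u w, Lp.coeFn_add u w] with x h1 h2
    rw [h1, h2, Pi.sub_apply, Pi.add_apply]
    push_cast; ring
  rw [h1]
  refine (norm_coef_le m _).trans (le_trans (le_of_eq ?_) (integral_abs_mul_le (u - w) (u + w)))
  congr 1; funext x
  rw [Complex.norm_real, Real.norm_eq_abs]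

theorem sqc_neg (m : ℤ) (u : L2) : sqc (-m) u = conj (sqc m u) := by
  rw [sqc, sqc, ← coef_conj]
  simp

/-- The sum of `1 / m²` over the nonzero integers. -/
noncomputable def invSqSum : ℝ := ∑' m : ℤ, 1 / (m : ℝ) ^ 2

/-- Cauchy–Schwarz against `1 / |m|`. This is the embedding of H¹ with mean zero into absolutely
convergent Fourier series, hence into continuous functions. -/
theorem sum_norm_fc_le {u d : L2} (h0 : fc 0 u = 0) (hd : ∀ m : ℤ, fc m d = m * Complex.I * fc m u)
    (F : Finset ℤ) : ∑ m ∈ F, ‖fc m u‖ ≤ √invSqSum * ‖d‖ := by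
  have hs : Summable fun m : ℤ => 1 / (m : ℝ) ^ 2 := Real.summable_one_div_int_pow.2 (by norm_num)
  have hS0 : 0 ≤ invSqSum := tsum_nonneg fun _ => by positivity
  rw [← sq_le_sq₀ (Finset.sum_nonneg fun _ _ => norm_nonneg _) (by positivity), mul_pow,
    Real.sq_sqrt hS0]
  have h1 : ∀ m : ℤ, ‖fc m u‖ = (1 / |(m : ℝ)|) * ‖fc m d‖ := fun m => by
    rcases eq_or_ne m 0 with rfl | hm
    · simp [h0]
    · have : |(m : ℝ)| ≠ 0 := by simpa using hm
      rw [hd, norm_mul, norm_mul, Complex.norm_I, Complex.norm_intCast]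
      field_simp
  simp only [h1]
  refine (Finset.sum_mul_sq_le_sq_mul_sq F _ _).trans ?_
  gcongr
  · simp only [div_pow, one_pow, sq_abs]
    exact hs.sum_le_tsum F fun _ _ => by positivity
  · exact sum_fc_sq_le d F

theorem summable_norm_fc {u d : L2} (h0 : fc 0 u = 0)
    (hd : ∀ m : ℤ, fc m d = m * Complex.I * fc m u) : Summable fun m : ℤ => ‖fc m u‖ :=
  summable_of_sum_le (fun _ => norm_nonneg _) (sum_norm_fc_le h0 hd)

theorem integral_exp_int (n : ℤ) :
    ∫ x : ℝ, Complex.exp (n * x * Complex.I) ∂circ = if n = 0 then 2 * Real.pi else 0 := by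
  rw [← intervalIntegral.integral_of_le Real.two_pi_pos.le]
  split_ifs with h
  · subst h; simp
  · have hc : (n : ℂ) * Complex.I ≠ 0 := mul_ne_zero (by exact_mod_cast h) Complex.I_ne_zero
    have h1 : (fun x : ℝ => Complex.exp (n * x * Complex.I))
        = fun x : ℝ => Complex.exp ((n * Complex.I) * x) := by
      funext x; congr 1; ring
    rw [h1, integral_exp_mul_complex hc]
    have h2 : (n : ℂ) * Complex.I * ((2 * Real.pi : ℝ) : ℂ) = n * (2 * Real.pi * Complex.I) := by
      push_cast; ring
    rw [h2, Complex.exp_int_mul_two_pi_mul_I]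
    simp

/-- The Fourier series with the coefficients of `u`. -/
noncomputable def series (u : L2) (x : ℝ) : ℂ :=
  ∑' n : ℤ, (((√(2 * Real.pi))⁻¹ : ℝ) : ℂ) * fc n u * Complex.exp (n * x * Complex.I)

theorem norm_exp_int_mul_I (n : ℤ) (x : ℝ) : ‖Complex.exp (n * x * Complex.I)‖ = 1 := by
  simpa using norm_exp_mode (-n) x

theorem norm_series_term_le (u : L2) (n : ℤ) (x : ℝ) :
    ‖(((√(2 * Real.pi))⁻¹ : ℝ) : ℂ) * fc n u * Complex.exp (n * x * Complex.I)‖ ≤ ‖fc n u‖ := by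
  have h2 : (√(2 * Real.pi))⁻¹ ≤ 1 := by
    apply inv_le_one_of_one_le₀
    rw [Real.one_le_sqrt]
    linarith [Real.pi_gt_three]
  rw [norm_mul, norm_mul, norm_exp_int_mul_I, mul_one, Complex.norm_real,
    Real.norm_of_nonneg (by positivity)]
  exact mul_le_of_le_one_left (norm_nonneg _) h2

theorem continuous_series {u : L2} (hs : Summable fun m : ℤ => ‖fc m u‖) :
    Continuous (series u) :=
  continuous_tsum (fun n => by fun_prop) hs (norm_series_term_le u)

theorem coef_series {u : L2} (hs : Summable fun m : ℤ => ‖fc m u‖) (m : ℤ) :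
    coef m (series u) = fc m u := by
  have hr : (√(2 * Real.pi) : ℝ) ≠ 0 := by have := Real.two_pi_pos; positivity
  have hint : ∀ n : ℤ, Integrable (fun x : ℝ => Complex.exp (-(m * x * Complex.I)) *
      ((((√(2 * Real.pi))⁻¹ : ℝ) : ℂ) * fc n u * Complex.exp (n * x * Complex.I))) circ := fun n =>
    integrable_mode_mul m (Continuous.integrableOn_Ioc (by fun_prop))
  have hnorm : ∀ (n : ℤ) (x : ℝ), ‖Complex.exp (-(m * x * Complex.I)) *
      ((((√(2 * Real.pi))⁻¹ : ℝ) : ℂ) * fc n u * Complex.exp (n * x * Complex.I))‖ ≤ ‖fc n u‖ :=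
    fun n x => by
      rw [norm_mul, norm_exp_mode, one_mul]; exact norm_series_term_le u n x
  have hsum : Summable fun n : ℤ => ∫ x : ℝ, ‖Complex.exp (-(m * x * Complex.I)) *
      ((((√(2 * Real.pi))⁻¹ : ℝ) : ℂ) * fc n u * Complex.exp (n * x * Complex.I))‖ ∂circ := by
    refine Summable.of_nonneg_of_le (fun n => integral_nonneg fun x => norm_nonneg _)
      (fun n => ?_) (hs.mul_left (2 * Real.pi))
    refine (integral_mono (hint n).norm (integrable_const _) (hnorm n)).trans (le_of_eq ?_)
    simp [Real.two_pi_pos.le]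
  unfold coef series
  have e : ∀ x : ℝ, Complex.exp (-(m * x * Complex.I)) *
      ∑' n : ℤ, (((√(2 * Real.pi))⁻¹ : ℝ) : ℂ) * fc n u * Complex.exp (n * x * Complex.I)
      = ∑' n : ℤ, Complex.exp (-(m * x * Complex.I)) *
        ((((√(2 * Real.pi))⁻¹ : ℝ) : ℂ) * fc n u * Complex.exp (n * x * Complex.I)) := fun x =>
    tsum_mul_left.symm
  simp only [e]
  rw [← integral_tsum_of_summable_integral_norm hint hsum]
  have e2 : ∀ n : ℤ, ∫ x : ℝ, Complex.exp (-(m * x * Complex.I)) *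
      ((((√(2 * Real.pi))⁻¹ : ℝ) : ℂ) * fc n u * Complex.exp (n * x * Complex.I)) ∂circ
      = if n = m then ((√(2 * Real.pi) : ℝ) : ℂ) * fc m u else 0 := fun n => by
    have e3 : ∀ x : ℝ, Complex.exp (-(m * x * Complex.I)) *
      ((((√(2 * Real.pi))⁻¹ : ℝ) : ℂ) * fc n u * Complex.exp (n * x * Complex.I))
      = (((√(2 * Real.pi))⁻¹ : ℝ) : ℂ) * fc n u *
        Complex.exp (((n - m : ℤ) : ℂ) * x * Complex.I) := fun x => by
      rw [mul_left_comm, ← Complex.exp_add]; congr 2; push_cast; ring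
    simp only [e3]
    rw [integral_const_mul, integral_exp_int]
    split_ifs with h1 h2 h2
    · have : n = m := by omega
      subst this
      have h3 : ((2 * Real.pi : ℝ) : ℂ) = ((√(2 * Real.pi) : ℝ) : ℂ) * ((√(2 * Real.pi) : ℝ) : ℂ) := by
        rw [← Complex.ofReal_mul, Real.mul_self_sqrt Real.two_pi_pos.le]
      rw [h3, Complex.ofReal_inv]
      have : ((√(2 * Real.pi) : ℝ) : ℂ) ≠ 0 := by exact_mod_cast hr
      field_simp
    · omega
    · omega
    · simp
  simp only [e2]
  rw [tsum_ite_eq, ← mul_assoc, ← Complex.ofReal_mul, inv_mul_cancel₀ hr]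
  simp

theorem contL2_re_series {u : L2} (hs : Summable fun m : ℤ => ‖fc m u‖) :
    contL2 (fun x => (series u x).re) (Complex.continuous_re.comp (continuous_series hs)) = u := by
  refine eq_of_fc_eq fun m => ?_
  have hc := continuous_series hs
  have h1 : (fun x => ((contL2 (fun x => (series u x).re)
      (Complex.continuous_re.comp hc) x : ℝ) : ℂ)) =ᵐ[circ]
      fun x : ℝ => (1 / 2 : ℂ) * (series u x + conj (series u x)) := by
    filter_upwards [coeFn_contL2 (Complex.continuous_re.comp hc)] with x hx
    have hx' : contL2 (fun x => (series u x).re) (Complex.continuous_re.comp hc) x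
      = (series u x).re := hx
    rw [hx', Complex.add_conj]
    simp
  rw [fc_apply, coef_congr m h1, coef_const_mul, coef_add m hc.integrableOn_Ioc
    (h := fun x => conj (series u x)) (Complex.continuous_conj.comp hc).integrableOn_Ioc, coef_series hs, ← neg_neg m, coef_conj,
    coef_series hs, fc_neg]
  simp
  ring

theorem hasDerivAt_series {u d : L2} (hs : Summable fun m : ℤ => ‖fc m u‖)
    (hsd : Summable fun m : ℤ => ‖fc m d‖) (hd : ∀ m : ℤ, fc m d = m * Complex.I * fc m u) (x : ℝ) :
    HasDerivAt (series u) (series d x) x := by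
  unfold series
  refine hasDerivAt_tsum hsd (fun n y => ?_) (norm_series_term_le d) (y₀ := 0) ?_ x
  · have h1 : HasDerivAt (fun x : ℝ => (n : ℂ) * x * Complex.I) (n * Complex.I) y := by
      convert! (Complex.ofRealCLM.hasDerivAt (x := y)).const_mul (n * Complex.I) using 1
      · funext x; simp only [Complex.ofRealCLM_apply]; ring
      · simp
    convert! h1.cexp.const_mul ((((√(2 * Real.pi))⁻¹ : ℝ) : ℂ) * fc n u) using 1
    rw [hd]; ring
  · exact Summable.of_norm_bounded hs fun n => norm_series_term_le u n 0

theorem series_periodic (u : L2) : series u (2 * Real.pi) = series u 0 := by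
  unfold series
  congr 1; funext n; congr 1
  have : (n : ℂ) * ((2 * Real.pi : ℝ) : ℂ) * Complex.I = n * (2 * Real.pi * Complex.I) := by
    push_cast; ring
  rw [this, Complex.exp_int_mul_two_pi_mul_I]; simp

/-- Interpolation by one integration by parts, carried out on coefficients: ‖u_x‖² = −⟨u, u_xx⟩. -/
theorem norm_sq_deriv_le {u d₁ d₂ : L2} (h₁ : ∀ m : ℤ, fc m d₁ = m * Complex.I * fc m u)
    (h₂ : ∀ m : ℤ, fc m d₂ = (m * Complex.I) ^ 2 * fc m u) : ‖d₁‖ ^ 2 ≤ ‖u‖ * ‖d₂‖ := by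
  have h : ‖d₁‖ ^ 2 = inner ℝ u (-d₂) := by
    refine (hasSum_fc_sq d₁).unique ?_
    convert! hasSum_inner_fc u (-d₂) using 1
    funext m
    have e : fc m (-d₂) = (((m : ℝ) ^ 2 : ℝ) : ℂ) * fc m u := by
      rw [map_neg, h₂, mul_pow, Complex.I_sq]; push_cast; ring
    rw [e, h₁, ← Complex.real_smul, inner_smul_right, real_inner_self_eq_norm_sq, norm_mul,
      norm_mul, Complex.norm_I, Complex.norm_intCast, mul_one, mul_pow, sq_abs]
  rw [h]
  simpa using real_inner_le_norm u (-d₂)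

/-- Two derivatives in L² make `u` a C¹ periodic function, namely its Fourier series, so the
classical chain rule applies: the coefficients come from (u²/2)_x and the orthogonality from
(u³/3)_x. The norm bound combines sup|u| ≤ C‖u_x‖ with ‖u_x‖² ≤ ‖u‖‖u_xx‖. Being linear in ‖u_xx‖,
it only needs `u` in L^∞(L²) ∩ L²(H²). -/
theorem exists_convection {u d₁ d₂ : L2} (h0 : fc 0 u = 0)
    (h₁ : ∀ m : ℤ, fc m d₁ = m * Complex.I * fc m u)
    (h₂ : ∀ m : ℤ, fc m d₂ = (m * Complex.I) ^ 2 * fc m u) :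
    ∃ b : L2, (b =ᵐ[circ] fun x => u x * d₁ x) ∧ (∀ m : ℤ, fc m b = m * Complex.I / 2 * sqc m u) ∧
      inner ℝ b u = 0 ∧ ‖b‖ ≤ √invSqSum * (‖u‖ * ‖d₂‖) := by
  have h₂' : ∀ m : ℤ, fc m d₂ = m * Complex.I * fc m d₁ := fun m => by rw [h₂, h₁]; ring
  have hs := summable_norm_fc h0 h₁
  have hs₁ := summable_norm_fc (by rw [h₁]; simp) h₂'
  set φ : ℝ → ℝ := fun x => (series u x).re with hφ
  set φ' : ℝ → ℝ := fun x => (series d₁ x).re with hφ'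
  have hd : ∀ x, HasDerivAt φ (φ' x) x := fun x =>
    Complex.reCLM.hasFDerivAt.comp_hasDerivAt x (hasDerivAt_series hs hs₁ h₁ x)
  have hc : Continuous φ := Complex.continuous_re.comp (continuous_series hs)
  have hc' : Continuous φ' := Complex.continuous_re.comp (continuous_series hs₁)
  have hper : φ (2 * Real.pi) = φ 0 := by rw [hφ]; simp only [series_periodic]
  have hu : u =ᵐ[circ] φ := by
    conv_lhs => rw [← contL2_re_series hs]
    exact coeFn_contL2 _
  have hd₁ : d₁ =ᵐ[circ] φ' := by
    conv_lhs => rw [← contL2_re_series hs₁]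
    exact coeFn_contL2 _
  have hcb : Continuous fun x => φ x * φ' x := hc.mul hc'
  have hb : contL2 _ hcb =ᵐ[circ] fun x => φ x * φ' x := coeFn_contL2 hcb
  refine ⟨contL2 _ hcb, ?_, fun m => ?_, ?_, ?_⟩
  · filter_upwards [hb, hu, hd₁] with x e1 e2 e3
    rw [e1, e2, e3]
  · have hsq : ∀ x, HasDerivAt (fun x => 1 / 2 * φ x ^ 2) (φ x * φ' x) x := fun x => by
      convert! ((hd x).pow 2).const_mul (1 / 2 : ℝ) using 1
      push_cast; ring
    have hw := (isWeakDeriv_contL2 hsq hcb (by simp only [hper])).fc_eq m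
    rw [pow_one] at hw
    rw [hw, fc_apply, sqc, div_mul_eq_mul_div, mul_div_assoc]
    congr 1
    refine Eq.trans ?_ (div_eq_inv_mul _ _).symm
    rw [← coef_const_mul m (2⁻¹ : ℂ)]
    refine coef_congr m ?_
    filter_upwards [coeFn_contL2 (show Continuous fun x => 1 / 2 * φ x ^ 2 by fun_prop), hu]
      with x e1 e2
    rw [e1, e2]; push_cast; ring
  · have hcu : ∀ x, HasDerivAt (fun x => 1 / 3 * φ x ^ 3) (φ x ^ 2 * φ' x) x := fun x => by
      convert! ((hd x).pow 3).const_mul (1 / 3 : ℝ) using 1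
      push_cast; ring
    have hcc : Continuous fun x => φ x ^ 2 * φ' x := (hc.pow 2).mul hc'
    have hw := (isWeakDeriv_contL2 hcu hcc (by simp only [hper])).fc_eq 0
    rw [Int.cast_zero, zero_mul, pow_one, zero_mul, ← hasZeroMean_iff] at hw
    rw [L2.inner_def]
    refine (integral_congr_ae ?_).trans hw
    filter_upwards [hb, hu, coeFn_contL2 hcc] with x e1 e2 e3
    rw [e1, e2, e3]
    simp only [RCLike.inner_apply, conj_trivial]
    ring
  · have hsup : ∀ x, |φ x| ≤ √invSqSum * ‖d₁‖ := fun x => by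
      refine (Complex.abs_re_le_norm _).trans ?_
      refine (tsum_of_norm_bounded hs.hasSum fun n => norm_series_term_le u n x).trans ?_
      exact Real.tsum_le_of_sum_le (fun _ => norm_nonneg _) (sum_norm_fc_le h0 h₁)
    have h := Lp.norm_le_mul_norm_of_ae_le_mul (c := √invSqSum * ‖d₁‖) (f := contL2 _ hcb)
      (g := d₁) (by
        filter_upwards [hb, hd₁] with x e1 e2
        rw [e1, e2, norm_mul]
        gcongr
        exact hsup x)
    refine h.trans ?_
    rw [mul_assoc, ← sq]
    gcongr
    exact norm_sq_deriv_le h₁ h₂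

end CoupledKS

/-! ### Estimates at a fixed time -/

namespace CoupledKS

open Filter Topology

/-- Lebesgue measure on the time interval. -/
noncomputable abbrev timeMeasure (T : ℝ) : Measure ℝ := volume.restrict (Ioc (0 : ℝ) T)

section ControlSpace

variable {T : ℝ}

theorem control_norm_sq (f : Control T) : ‖f‖ ^ 2 = ∫ s, ‖f s‖ ^ 2 ∂(timeMeasure T) := by
  rw [← real_inner_self_eq_norm_sq, L2.inner_def]
  simp only [real_inner_self_eq_norm_sq]

theorem integrable_norm_sq (f : Control T) : Integrable (fun s => ‖f s‖ ^ 2) (timeMeasure T) :=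
  (Lp.memLp f).integrable_norm_pow (by norm_num)

theorem control_integrable (f : Control T) : Integrable f (timeMeasure T) :=
  (Lp.memLp f).integrable (by norm_num)

theorem control_intervalIntegrable (hT : 0 ≤ T) (f : Control T) :
    IntervalIntegrable f volume 0 T :=
  (intervalIntegrable_iff_integrableOn_Ioc_of_le hT).2 (control_integrable f)

theorem intervalIntegrable_norm_sq (hT : 0 ≤ T) (f : Control T) :
    IntervalIntegrable (fun s => ‖f s‖ ^ 2) volume 0 T :=
  (intervalIntegrable_iff_integrableOn_Ioc_of_le hT).2 (integrable_norm_sq f)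

theorem norm_fc_comp_sq_integrable (f : Control T) (m : ℤ) :
    Integrable (fun s => ‖fc m (f s)‖ ^ 2) (timeMeasure T) := by
  refine (integrable_norm_sq f).mono' ?_ (Eventually.of_forall fun s => ?_)
  · exact (((fc m).continuous.comp_aestronglyMeasurable
      (Lp.aestronglyMeasurable f)).norm.pow 2)
  · rw [norm_pow, norm_norm]
    gcongr
    exact norm_fc_le m _

theorem control_norm_sq_le_of_sum_le (w : Control T) {M : ℝ}
    (h : ∀ F : Finset ℤ, ∫ s, ∑ m ∈ F, ‖fc m (w s)‖ ^ 2 ∂(timeMeasure T) ≤ M) : ‖w‖ ^ 2 ≤ M := by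
  rw [control_norm_sq]
  have hlim : Tendsto (fun N : ℕ => ∫ s, ∑ m ∈ Finset.Icc (-(N : ℤ)) N, ‖fc m (w s)‖ ^ 2
      ∂(timeMeasure T)) atTop (𝓝 (∫ s, ‖w s‖ ^ 2 ∂(timeMeasure T))) := by
    refine tendsto_integral_of_dominated_convergence (fun s => ‖w s‖ ^ 2) (fun N => ?_)
      (integrable_norm_sq w) (fun N => Eventually.of_forall fun s => ?_)
      (Eventually.of_forall fun s => ?_)
    · exact (integrable_finsetSum _ fun m _ =>
        norm_fc_comp_sq_integrable w m).aestronglyMeasurable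
    · rw [Real.norm_of_nonneg (Finset.sum_nonneg fun _ _ => by positivity)]
      exact sum_fc_sq_le _ _
    · exact (hasSum_fc_sq (w s)).comp Finset.tendsto_Icc_neg
  exact le_of_tendsto hlim (Eventually.of_forall fun N => h _)

end ControlSpace

theorem inner_fourth_deriv {u d₂ d₄ : L2} (h₂ : ∀ m : ℤ, fc m d₂ = (m * Complex.I) ^ 2 * fc m u)
    (h₄ : ∀ m : ℤ, fc m d₄ = (m * Complex.I) ^ 4 * fc m u) : inner ℝ u d₄ = ‖d₂‖ ^ 2 := by
  refine (hasSum_inner_fc u d₄).unique ?_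
  convert! hasSum_fc_sq d₂ using 1
  funext m
  have e : fc m d₄ = (((m : ℝ) ^ 4 : ℝ) : ℂ) * fc m u := by
    rw [h₄, mul_pow, Complex.I_pow_four]; push_cast; ring
  rw [e, h₂, ← Complex.real_smul, inner_smul_right, real_inner_self_eq_norm_sq, norm_mul,
    norm_pow, norm_mul, Complex.norm_I, Complex.norm_intCast, mul_one, mul_pow, sq_abs]
  ring

/-- The relations, at a fixed time, between a state `u`, its space derivatives `d₁, d₂, d₄`, its
time derivative `v`, the control `f` and the coupling term `e`, projected to the modes in `S`. -/
structure IsSlice (S : Set ℤ) (ν α : ℝ) (f u v d₁ d₂ d₄ e : L2) : Prop where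
  mean : fc 0 u = 0
  deriv₁ : ∀ m : ℤ, fc m d₁ = m * Complex.I * fc m u
  deriv₂ : ∀ m : ℤ, fc m d₂ = (m * Complex.I) ^ 2 * fc m u
  deriv₄ : ∀ m : ℤ, fc m d₄ = (m * Complex.I) ^ 4 * fc m u
  out : ∀ m ∉ S, fc m u = 0 ∧ fc m v = 0
  eqn : ∀ m ∈ S, fc m v + ν * fc m d₄ + fc m d₂ + m * Complex.I / 2 * sqc m u + α * fc m e = fc m f

namespace IsSlice

variable {S : Set ℤ} {ν α : ℝ} {f u v d₁ d₂ d₄ e : L2}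

/-- Modes outside `S` do not contribute to the pairing with `u`, so the unprojected right-hand side
may be used. There convection is orthogonal to `u` and the fourth derivative gives ‖d₂‖². -/
theorem inner_le (h : IsSlice S ν α f u v d₁ d₂ d₄ e) :
    inner ℝ u v ≤ -(ν * ‖d₂‖ ^ 2) + ‖u‖ * ‖d₂‖ + |α| * (‖u‖ * ‖e‖) + ‖u‖ * ‖f‖ := by
  obtain ⟨b, -, hb, hbu, -⟩ := exists_convection h.mean h.deriv₁ h.deriv₂
  have h1 : inner ℝ u v = inner ℝ u (f - ν • d₄ - d₂ - b - α • e) := by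
    refine (hasSum_inner_fc u v).unique ?_
    convert! hasSum_inner_fc u (f - ν • d₄ - d₂ - b - α • e) using 1
    funext m
    by_cases hm : m ∈ S
    · congr 1
      simp only [map_sub, map_smul, Complex.real_smul, hb, ← h.eqn m hm]
      ring
    · rw [(h.out m hm).1, inner_zero_left, inner_zero_left]
  rw [h1]
  simp only [inner_sub_right, inner_smul_right, inner_fourth_deriv h.deriv₂ h.deriv₄,
    real_inner_comm b u, hbu]
  have e1 := abs_le.1 (abs_real_inner_le_norm u f)
  have e2 := abs_le.1 (abs_real_inner_le_norm u d₂)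
  have e3 : -(α * inner ℝ u e) ≤ |α| * (‖u‖ * ‖e‖) := by
    refine (neg_le_abs _).trans ?_
    rw [abs_mul]
    gcongr
    exact abs_real_inner_le_norm u e
  linarith [e1.2, e2.1]

/-- On `S` the equation turns each summand into a coefficient of `f - d₂ - b - α • e`, with `b` the
convection term; off `S` it is zero. The factor 4 is (p + q + r + s)² ≤ 4(p² + q² + r² + s²). -/
theorem sum_le (h : IsSlice S ν α f u v d₁ d₂ d₄ e) (F : Finset ℤ) :
    ∑ m ∈ F, ‖fc m v + ν * fc m d₄‖ ^ 2
      ≤ 4 * (‖f‖ ^ 2 + ‖d₂‖ ^ 2 + α ^ 2 * ‖e‖ ^ 2 + invSqSum * (‖u‖ ^ 2 * ‖d₂‖ ^ 2)) := by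
  obtain ⟨b, -, hb, -, hbn⟩ := exists_convection h.mean h.deriv₁ h.deriv₂
  have hS0 : 0 ≤ invSqSum := tsum_nonneg fun _ => by positivity
  have h1 : ∑ m ∈ F, ‖fc m v + ν * fc m d₄‖ ^ 2 ≤ ∑ m ∈ F, ‖fc m (f - d₂ - b - α • e)‖ ^ 2 := by
    refine Finset.sum_le_sum fun m _ => ?_
    by_cases hm : m ∈ S
    · refine le_of_eq ?_
      congr 2
      simp only [map_sub, map_smul, Complex.real_smul, hb, ← h.eqn m hm]
      ring
    · rw [h.deriv₄, (h.out m hm).1, (h.out m hm).2]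
      simp
  refine h1.trans ((sum_fc_sq_le _ F).trans ?_)
  have h2 : ‖f - d₂ - b - α • e‖ ≤ ‖f‖ + ‖d₂‖ + ‖b‖ + |α| * ‖e‖ := by
    refine (norm_sub_le _ _).trans ?_
    rw [norm_smul, Real.norm_eq_abs]
    gcongr
    refine (norm_sub_le _ _).trans ?_
    gcongr
    exact norm_sub_le _ _
  have h3 : ‖b‖ ^ 2 ≤ invSqSum * (‖u‖ ^ 2 * ‖d₂‖ ^ 2) := by
    have : ‖b‖ ^ 2 ≤ (√invSqSum * (‖u‖ * ‖d₂‖)) ^ 2 := by gcongr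
    rwa [mul_pow, Real.sq_sqrt hS0, mul_pow] at this
  have h4 : ‖f - d₂ - b - α • e‖ ^ 2 ≤ (‖f‖ + ‖d₂‖ + ‖b‖ + |α| * ‖e‖) ^ 2 := by gcongr
  have h5 : (|α| * ‖e‖) ^ 2 = α ^ 2 * ‖e‖ ^ 2 := by rw [mul_pow, sq_abs]
  nlinarith [sq_nonneg (‖f‖ - ‖d₂‖), sq_nonneg (‖f‖ - ‖b‖), sq_nonneg (‖f‖ - |α| * ‖e‖),
    sq_nonneg (‖d₂‖ - ‖b‖), sq_nonneg (‖d₂‖ - |α| * ‖e‖), sq_nonneg (‖b‖ - |α| * ‖e‖)]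

end IsSlice

/-- Young's inequality for the coupled pair: `a` stands for ‖u_xx‖, `n` for ‖u‖ and `p` for ‖f‖.
Each coupling term involves the second derivative of the other component, so the two inequalities
must be added before absorbing; half of the total dissipation is spent. -/
theorem energy_arith {ν a₁ a₂ n₁ n₂ p₁ p₂ α₁ α₂ A i₁ i₂ : ℝ} (hν : 0 < ν) (ha₁ : 0 ≤ a₁)
    (ha₂ : 0 ≤ a₂) (hn₁ : 0 ≤ n₁) (hn₂ : 0 ≤ n₂) (hA : A = 1 + |α₁| + |α₂|)
    (h₁ : i₁ ≤ -(ν * a₁ ^ 2) + n₁ * a₁ + |α₁| * (n₁ * a₂) + n₁ * p₁)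
    (h₂ : i₂ ≤ -(ν * a₂ ^ 2) + n₂ * a₂ + |α₂| * (n₂ * a₁) + n₂ * p₂) :
    2 * (i₁ + i₂) ≤ -(ν * (a₁ ^ 2 + a₂ ^ 2)) + (4 * A ^ 2 / ν + 1) * (n₁ ^ 2 + n₂ ^ 2)
      + (p₁ ^ 2 + p₂ ^ 2) := by
  have hα₁ := abs_nonneg α₁
  have hα₂ := abs_nonneg α₂
  have e1 : n₁ * a₁ + |α₁| * (n₁ * a₂) + n₂ * a₂ + |α₂| * (n₂ * a₁)
      ≤ A * ((n₁ + n₂) * (a₁ + a₂)) := by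
    rw [hA]
    have b1 : 0 ≤ n₁ * a₁ := by positivity
    have b2 : 0 ≤ n₁ * a₂ := by positivity
    have b3 : 0 ≤ n₂ * a₁ := by positivity
    have b4 : 0 ≤ n₂ * a₂ := by positivity
    nlinarith [mul_nonneg hα₁ b1, mul_nonneg hα₁ b2, mul_nonneg hα₁ b3, mul_nonneg hα₁ b4,
      mul_nonneg hα₂ b1, mul_nonneg hα₂ b2, mul_nonneg hα₂ b3, mul_nonneg hα₂ b4]
  have e2 : 2 * (A * ((n₁ + n₂) * (a₁ + a₂)))
      ≤ ν / 2 * (a₁ + a₂) ^ 2 + 2 * A ^ 2 / ν * (n₁ + n₂) ^ 2 := by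
    have : ν / 2 * (a₁ + a₂) ^ 2 + 2 * A ^ 2 / ν * (n₁ + n₂) ^ 2
        - 2 * (A * ((n₁ + n₂) * (a₁ + a₂)))
        = 1 / (2 * ν) * (ν * (a₁ + a₂) - 2 * A * (n₁ + n₂)) ^ 2 := by
      field_simp; ring
    have h0 : 0 ≤ 1 / (2 * ν) * (ν * (a₁ + a₂) - 2 * A * (n₁ + n₂)) ^ 2 := by positivity
    linarith
  have e3 : ν / 2 * (a₁ + a₂) ^ 2 ≤ ν * (a₁ ^ 2 + a₂ ^ 2) := by
    nlinarith [mul_nonneg hν.le (sq_nonneg (a₁ - a₂))]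
  have e4 : 2 * A ^ 2 / ν * (n₁ + n₂) ^ 2 ≤ 4 * A ^ 2 / ν * (n₁ ^ 2 + n₂ ^ 2) := by
    have h0 : 0 ≤ 2 * A ^ 2 / ν := by positivity
    have h1 : 4 * A ^ 2 / ν = 2 * (2 * A ^ 2 / ν) := by ring
    rw [h1]
    nlinarith [mul_nonneg h0 (sq_nonneg (n₁ - n₂))]
  nlinarith [sq_nonneg (n₁ - p₁), sq_nonneg (n₂ - p₂)]

end CoupledKS

/-! ### Higher regularity from mode-by-mode estimates -/

namespace CoupledKS

open Filter Topology

/-- One component `u` of a solution of the system projected to the modes in `S`, with time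
derivative `v` and space derivatives `D k`; `e` is the second derivative of the other component. -/
structure IsApprox (S : Set ℤ) (ν α : ℝ) {T : ℝ} (f : Control T) (u : ℝ → L2) (v : Control T)
    (D : ℕ → Control T) (e : Control T) : Prop where
  eq_add : ∀ t ∈ Icc 0 T, u t = u 0 + ∫ s in (0 : ℝ)..t, v s
  mean : ∀ t ∈ Icc 0 T, fc 0 (u t) = 0
  deriv : ∀ᵐ s ∂(timeMeasure T), ∀ k ≤ 4, ∀ m : ℤ, fc m (D k s) = (m * Complex.I) ^ k * fc m (u s)
  out : ∀ᵐ s ∂(timeMeasure T), ∀ m ∉ S, fc m (u s) = 0 ∧ fc m (v s) = 0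
  eqn : ∀ᵐ s ∂(timeMeasure T), ∀ m ∈ S, fc m (v s) + ν * fc m (D 4 s) + fc m (D 2 s)
    + m * Complex.I / 2 * sqc m (u s) + α * fc m (e s) = fc m (f s)

theorem control_norm_sq_le_integral {T : ℝ} {g : Control T} {R : ℝ → ℝ}
    (hR : Integrable R (timeMeasure T)) (h : ∀ᵐ s ∂(timeMeasure T), ‖g s‖ ^ 2 ≤ R s) :
    ‖g‖ ^ 2 ≤ ∫ s, R s ∂(timeMeasure T) := by
  rw [control_norm_sq]
  exact integral_mono_ae (integrable_norm_sq g) hR h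

namespace IsApprox

variable {S : Set ℤ} {ν α T : ℝ} {f : Control T} {u : ℝ → L2} {v : Control T}
  {D : ℕ → Control T} {e : Control T}

theorem slice (h : IsApprox S ν α f u v D e) : ∀ᵐ s ∂(timeMeasure T),
    IsSlice S ν α (f s) (u s) (v s) (D 1 s) (D 2 s) (D 4 s) (e s) := by
  filter_upwards [h.deriv, h.out, h.eqn, ae_restrict_mem measurableSet_Ioc] with s h1 h2 h3 hs
  exact ⟨h.mean s (Ioc_subset_Icc_self hs), fun m => by simpa using h1 1 (by norm_num) m,
    h1 2 (by norm_num), h1 4 le_rfl, h2, h3⟩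

/-- Poincaré: the zero mode is absent and `|m| ≥ 1` on the others. -/
theorem norm_deriv_le (h : IsApprox S ν α f u v D e) {k : ℕ} (hk : k ≤ 4) : ‖D k‖ ≤ ‖D 4‖ := by
  refine Lp.norm_le_norm_of_ae_le ?_
  filter_upwards [h.deriv, ae_restrict_mem measurableSet_Ioc] with s h1 hs
  rw [← sq_le_sq₀ (norm_nonneg _) (norm_nonneg _)]
  refine norm_sq_le_of_sum_le fun F => le_trans (Finset.sum_le_sum fun m _ => ?_)
    (sum_fc_sq_le (D 4 s) F)
  gcongr
  rw [h1 k hk, h1 4 le_rfl]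
  rcases eq_or_ne m 0 with rfl | hm
  · simp [h.mean s (Ioc_subset_Icc_self hs)]
  · simp only [norm_mul, norm_pow, Complex.norm_I, mul_one, Complex.norm_intCast]
    have : (1 : ℝ) ≤ |(m : ℝ)| := by exact_mod_cast Int.one_le_abs hm
    gcongr

theorem norm_add_smul_le (h : IsApprox S ν α f u v D e) {M : ℝ}
    (hM : ∀ t ∈ Icc 0 T, ‖u t‖ ^ 2 ≤ M) :
    ‖v + ν • D 4‖ ^ 2
      ≤ 4 * (‖f‖ ^ 2 + ‖D 2‖ ^ 2 + α ^ 2 * ‖e‖ ^ 2 + invSqSum * (M * ‖D 2‖ ^ 2)) := by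
  have hS0 : 0 ≤ invSqSum := tsum_nonneg fun _ => by positivity
  have i1 := integrable_norm_sq f
  have i2 := integrable_norm_sq (D 2)
  have i3 := (integrable_norm_sq e).const_mul (α ^ 2)
  have i4 := ((integrable_norm_sq (D 2)).const_mul M).const_mul invSqSum
  have hR : ∫ s, 4 * (‖f s‖ ^ 2 + ‖D 2 s‖ ^ 2 + α ^ 2 * ‖e s‖ ^ 2
      + invSqSum * (M * ‖D 2 s‖ ^ 2)) ∂(timeMeasure T)
      = 4 * (‖f‖ ^ 2 + ‖D 2‖ ^ 2 + α ^ 2 * ‖e‖ ^ 2 + invSqSum * (M * ‖D 2‖ ^ 2)) := by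
    rw [integral_const_mul, integral_add (by fun_prop) i4, integral_add (by fun_prop) i3,
      integral_add i1 i2, integral_const_mul, integral_const_mul, integral_const_mul,
      control_norm_sq, control_norm_sq, control_norm_sq]
  rw [← hR]
  refine control_norm_sq_le_integral (((i1.add i2).add i3).add i4 |>.const_mul 4) ?_
  filter_upwards [h.slice, Lp.coeFn_add v (ν • D 4), Lp.coeFn_smul ν (D 4),
    ae_restrict_mem measurableSet_Ioc] with s hs h1 h2 hsT
  refine norm_sq_le_of_sum_le fun F => ?_
  have : ∀ m, fc m ((v + ν • D 4 : Control T) s) = fc m (v s) + ν * fc m (D 4 s) := fun m => by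
    rw [h1, Pi.add_apply, h2, Pi.smul_apply, map_add, map_smul, Complex.real_smul]
  simp only [this]
  refine (hs.sum_le F).trans ?_
  have := hM s (Ioc_subset_Icc_self hsT)
  gcongr

/-- Maximal regularity of ∂ₜ + ν∂ₓ⁴, where each mode is a scalar equation. Weighting the mode by `m
^ 2` amounts to testing with the fourth derivative. No lower-order term remains, so the energy
estimate applies with `C = 0` and summing over modes costs nothing. -/
theorem mode_estimate (h : IsApprox S ν α f u v D e) (hν : 0 < ν) (hT : 0 ≤ T) (m : ℤ) {t : ℝ}
    (ht : t ∈ Icc 0 T) :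
    (m : ℝ) ^ 4 * ‖fc m (u t)‖ ^ 2 + ∫ s in (0 : ℝ)..t, ν * ‖fc m (D 4 s)‖ ^ 2
      ≤ (m : ℝ) ^ 4 * ‖fc m (u 0)‖ ^ 2
        + ∫ s in (0 : ℝ)..T, ν⁻¹ * ‖fc m ((v + ν • D 4 : Control T) s)‖ ^ 2 := by
  set A : L2 →L[ℝ] ℂ := ((m : ℝ) ^ 2) • fc m with hA
  have hAn : ∀ w, ‖A w‖ ^ 2 = (m : ℝ) ^ 4 * ‖fc m w‖ ^ 2 := fun w => by
    rw [hA, smul_apply, norm_smul, mul_pow, Real.norm_eq_abs, sq_abs]; ring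
  have hvi := control_intervalIntegrable hT v
  have hii : ∀ (c : ℝ) (w : Control T),
      IntervalIntegrable (fun s => c * ‖fc m (w s)‖ ^ 2) volume 0 T := fun c w =>
    (intervalIntegrable_iff_integrableOn_Ioc_of_le hT).2
      ((norm_fc_comp_sq_integrable w m).const_mul c)
  have key := energy_estimate (u := fun t => A (u t)) (v := fun s => A (v s))
    (d := fun s => ν * ‖fc m (D 4 s)‖ ^ 2)
    (h := fun s => ν⁻¹ * ‖fc m ((v + ν • D 4 : Control T) s)‖ ^ 2) (C := 0) hT le_rfl
    ?_ (fun t ht => ?_) (hii _ _) (fun _ => by positivity) (hii _ _) (fun _ => by positivity)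
    ?_ ht
  · simpa only [hAn, zero_mul, Real.exp_zero, mul_one] using key
  · rw [intervalIntegrable_iff_integrableOn_Ioc_of_le hT] at hvi ⊢
    exact A.integrable_comp hvi
  · rw [h.eq_add t ht, map_add, A.intervalIntegral_comp_comm
      (intervalIntegrable_of_mem hT hvi ⟨le_rfl, hT⟩ ht)]
  · filter_upwards [h.deriv, Lp.coeFn_add v (ν • D 4), Lp.coeFn_smul ν (D 4)] with s hs h1 h2
    have e1 : fc m ((v + ν • D 4 : Control T) s) = fc m (v s) + ν • fc m (D 4 s) := by
      rw [h1, Pi.add_apply, h2, Pi.smul_apply, map_add, map_smul]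
    have e2 : fc m (D 4 s) = ((m : ℝ) ^ 4) • fc m (u s) := by
      rw [hs 4 le_rfl, mul_pow, Complex.I_pow_four, Complex.real_smul]; push_cast; ring
    set g := fc m ((v + ν • D 4 : Control T) s)
    have e3 : fc m (v s) = g - ν • fc m (D 4 s) := by rw [e1]; abel
    have e4 : inner ℝ (A (u s)) (A (v s))
        = inner ℝ (fc m (D 4 s)) g - ν * ‖fc m (D 4 s)‖ ^ 2 := by
      rw [hA, smul_apply, smul_apply, inner_smul_left,
        inner_smul_right, e3, inner_sub_right, inner_smul_right, ← real_inner_self_eq_norm_sq, e2]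
      simp only [inner_smul_left, inner_smul_right, conj_trivial]
      ring
    have e5 : 2 * inner ℝ (fc m (D 4 s)) g ≤ ν * ‖fc m (D 4 s)‖ ^ 2 + ν⁻¹ * ‖g‖ ^ 2 := by
      have c1 := real_inner_le_norm (fc m (D 4 s)) g
      have c2 : 0 ≤ ν⁻¹ * (ν * ‖fc m (D 4 s)‖ - ‖g‖) ^ 2 := by positivity
      have c3 : ν⁻¹ * (ν * ‖fc m (D 4 s)‖ - ‖g‖) ^ 2 = ν * ‖fc m (D 4 s)‖ ^ 2
          - 2 * (‖fc m (D 4 s)‖ * ‖g‖) + ν⁻¹ * ‖g‖ ^ 2 := by field_simp; ring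
      linarith
    simp only [zero_mul, add_zero]
    rw [e4]
    linarith

theorem sum_mode_estimate (h : IsApprox S ν α f u v D e) (hν : 0 < ν) (hT : 0 ≤ T) {K : ℝ}
    (hK : ∀ F : Finset ℤ, ∑ m ∈ F, (m : ℝ) ^ 4 * ‖fc m (u 0)‖ ^ 2 ≤ K) (F : Finset ℤ) {t : ℝ}
    (ht : t ∈ Icc 0 T) :
    ∑ m ∈ F, (m : ℝ) ^ 4 * ‖fc m (u t)‖ ^ 2
        + ν * ∑ m ∈ F, ∫ s in (0 : ℝ)..t, ‖fc m (D 4 s)‖ ^ 2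
      ≤ K + ν⁻¹ * ‖v + ν • D 4‖ ^ 2 := by
  have h1 := Finset.sum_le_sum fun m (_ : m ∈ F) => h.mode_estimate hν hT m ht
  simp only [Finset.sum_add_distrib, intervalIntegral.integral_const_mul] at h1
  rw [← Finset.mul_sum, ← Finset.mul_sum] at h1
  have h2 : ∑ m ∈ F, ∫ s in (0 : ℝ)..T, ‖fc m ((v + ν • D 4 : Control T) s)‖ ^ 2
      ≤ ‖v + ν • D 4‖ ^ 2 := by
    simp only [intervalIntegral.integral_of_le hT]
    rw [← integral_finsetSum F fun m _ => norm_fc_comp_sq_integrable _ m, control_norm_sq]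
    exact integral_mono (integrable_finsetSum F fun m _ => norm_fc_comp_sq_integrable _ m)
      (integrable_norm_sq _) fun s => sum_fc_sq_le _ F
  have h3 := hK F
  have h4 : ν⁻¹ * ∑ m ∈ F, ∫ s in (0 : ℝ)..T, ‖fc m ((v + ν • D 4 : Control T) s)‖ ^ 2
      ≤ ν⁻¹ * ‖v + ν • D 4‖ ^ 2 := by gcongr
  linarith

theorem sum_mode_le (h : IsApprox S ν α f u v D e) (hν : 0 < ν) (hT : 0 ≤ T) {K : ℝ}
    (hK : ∀ F : Finset ℤ, ∑ m ∈ F, (m : ℝ) ^ 4 * ‖fc m (u 0)‖ ^ 2 ≤ K) (F : Finset ℤ) {t : ℝ}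
    (ht : t ∈ Icc 0 T) :
    ∑ m ∈ F, (m : ℝ) ^ 4 * ‖fc m (u t)‖ ^ 2 ≤ K + ν⁻¹ * ‖v + ν • D 4‖ ^ 2 := by
  refine le_trans (le_add_of_nonneg_right ?_) (h.sum_mode_estimate hν hT hK F ht)
  exact mul_nonneg hν.le (Finset.sum_nonneg fun m _ =>
    intervalIntegral.integral_nonneg ht.1 fun s _ => by positivity)

theorem norm_sq_fourth_deriv_le (h : IsApprox S ν α f u v D e) (hν : 0 < ν) (hT : 0 ≤ T) {K : ℝ}
    (hK : ∀ F : Finset ℤ, ∑ m ∈ F, (m : ℝ) ^ 4 * ‖fc m (u 0)‖ ^ 2 ≤ K) :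
    ‖D 4‖ ^ 2 ≤ ν⁻¹ * (K + ν⁻¹ * ‖v + ν • D 4‖ ^ 2) := by
  refine control_norm_sq_le_of_sum_le _ fun F => ?_
  rw [integral_finsetSum F fun m _ => norm_fc_comp_sq_integrable _ m, le_inv_mul_iff₀ hν]
  have := h.sum_mode_estimate hν hT hK F ⟨hT, le_rfl⟩
  simp only [intervalIntegral.integral_of_le hT] at this
  refine le_trans (le_add_of_nonneg_left ?_) this
  exact Finset.sum_nonneg fun m _ => by positivity

end IsApprox

end CoupledKS

/-! ### Uniform a priori bounds for the coupled system -/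

namespace CoupledKS

open Filter Topology

/-- The Hilbert space of pairs of components. -/
abbrev L2Pair : Type := WithLp 2 (L2 × L2)

theorem norm_sq_toLp (a b : L2) : ‖(WithLp.toLp 2 (a, b) : L2Pair)‖ ^ 2 = ‖a‖ ^ 2 + ‖b‖ ^ 2 :=
  WithLp.prod_norm_sq_eq_of_L2 _

theorem inner_toLp (a b c d : L2) : inner ℝ (WithLp.toLp 2 (a, b) : L2Pair) (WithLp.toLp 2 (c, d))
    = inner ℝ a c + inner ℝ b d :=
  WithLp.prod_inner_apply _ _

/-- The embedding of the first component. -/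
noncomputable def pairInl : L2 →L[ℝ] L2Pair :=
  ((WithLp.prodContinuousLinearEquiv 2 ℝ L2 L2).symm : L2 × L2 →L[ℝ] L2Pair).comp
    (ContinuousLinearMap.inl ℝ L2 L2)

/-- The embedding of the second component. -/
noncomputable def pairInr : L2 →L[ℝ] L2Pair :=
  ((WithLp.prodContinuousLinearEquiv 2 ℝ L2 L2).symm : L2 × L2 →L[ℝ] L2Pair).comp
    (ContinuousLinearMap.inr ℝ L2 L2)

/-- The projection to the first component. -/
noncomputable def pairFst : L2Pair →L[ℝ] L2 :=
  (ContinuousLinearMap.fst ℝ L2 L2).comp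
    (WithLp.prodContinuousLinearEquiv 2 ℝ L2 L2 : L2Pair →L[ℝ] L2 × L2)

/-- The projection to the second component. -/
noncomputable def pairSnd : L2Pair →L[ℝ] L2 :=
  (ContinuousLinearMap.snd ℝ L2 L2).comp
    (WithLp.prodContinuousLinearEquiv 2 ℝ L2 L2 : L2Pair →L[ℝ] L2 × L2)

theorem toLp_pairFst_pairSnd (x : L2Pair) : WithLp.toLp 2 (pairFst x, pairSnd x) = x := rfl

theorem toLp_eq_add (a b : L2) : (WithLp.toLp 2 (a, b) : L2Pair) = pairInl a + pairInr b := by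
  have h : (a, b) = ((a, 0) + (0, b) : L2 × L2) := by simp
  rw [h]; rfl

theorem intervalIntegral_toLp {v w : ℝ → L2} {a b : ℝ} (hv : IntervalIntegrable v volume a b)
    (hw : IntervalIntegrable w volume a b) :
    ∫ s in a..b, (WithLp.toLp 2 (v s, w s) : L2Pair)
      = WithLp.toLp 2 (∫ s in a..b, v s, ∫ s in a..b, w s) := by
  simp only [toLp_eq_add]
  rw [intervalIntegral.integral_add ⟨pairInl.integrable_comp hv.1, pairInl.integrable_comp hv.2⟩
    ⟨pairInr.integrable_comp hw.1, pairInr.integrable_comp hw.2⟩,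
    pairInl.intervalIntegral_comp_comm hv, pairInr.intervalIntegral_comp_comm hw]

/-- Uniform bounds for a component `u` of an approximate solution, its time derivative and its space
derivatives. -/
structure IsBounded {T : ℝ} (M : ℝ) (u : ℝ → L2) (v : Control T) (D : ℕ → Control T) : Prop where
  sum_le : ∀ t ∈ Icc 0 T, ∀ F : Finset ℤ, ∑ m ∈ F, (m : ℝ) ^ 4 * ‖fc m (u t)‖ ^ 2 ≤ M
  deriv_le : ∀ k ≤ 4, ‖D k‖ ≤ M
  time_le : ‖v‖ ≤ M

theorem IsBounded.mono {T M M' : ℝ} (hM : M ≤ M') {u : ℝ → L2} {v : Control T}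
    {D : ℕ → Control T} (h : IsBounded M u v D) : IsBounded M' u v D :=
  ⟨fun t ht F => (h.sum_le t ht F).trans hM, fun k hk => (h.deriv_le k hk).trans hM,
    h.time_le.trans hM⟩

/-- The bootstrap from L^∞(L²) ∩ L²(H²). First v + νD₄ is bounded by the equation, then D₄ and the
H² norm by maximal regularity, then v by difference. -/
theorem exists_isBounded_of_second_deriv {ν T : ℝ} (hν : 0 < ν) (hT : 0 ≤ T) (α K M₀ : ℝ) :
    ∃ M, ∀ (S : Set ℤ) (f : Control T) (u : ℝ → L2) (v : Control T) (D : ℕ → Control T)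
      (e : Control T), IsApprox S ν α f u v D e → ‖f‖ ^ 2 ≤ K →
      (∀ F : Finset ℤ, ∑ m ∈ F, (m : ℝ) ^ 4 * ‖fc m (u 0)‖ ^ 2 ≤ K) →
      (∀ t ∈ Icc 0 T, ‖u t‖ ^ 2 ≤ M₀) → ‖D 2‖ ^ 2 ≤ M₀ → ‖e‖ ^ 2 ≤ M₀ → IsBounded M u v D := by
  have hS0 : 0 ≤ invSqSum := tsum_nonneg fun _ => by positivity
  set W := 4 * (K + M₀ + α ^ 2 * M₀ + invSqSum * (M₀ * M₀)) with hW
  set N := K + ν⁻¹ * W with hN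
  set P := √(ν⁻¹ * N) with hP
  -- The bound is fixed before `K` and `M₀` are known to be nonnegative, hence the absolute value of
  -- `N`.
  refine ⟨|N| + P + (√W + ν * P), fun S f u v D e h hf hK hu hD he => ?_⟩
  have hM0 : 0 ≤ M₀ := (sq_nonneg _).trans hD
  have h1 : ‖v + ν • D 4‖ ^ 2 ≤ W := (h.norm_add_smul_le hu).trans (by rw [hW]; gcongr)
  have h2 : ∀ t ∈ Icc 0 T, ∀ F : Finset ℤ, ∑ m ∈ F, (m : ℝ) ^ 4 * ‖fc m (u t)‖ ^ 2 ≤ N :=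
    fun t ht F => (h.sum_mode_le hν hT hK F ht).trans (by rw [hN]; gcongr)
  have h3 : ‖D 4‖ ≤ P := by
    refine Real.le_sqrt_of_sq_le ((h.norm_sq_fourth_deriv_le hν hT hK).trans ?_)
    rw [hN]; gcongr
  have h4 : ‖v‖ ≤ √W + ν * P := by
    have e1 : v = (v + ν • D 4) - ν • D 4 := by abel
    rw [e1]
    refine (norm_sub_le _ _).trans ?_
    rw [norm_smul, Real.norm_of_nonneg hν.le]
    gcongr
    exact Real.le_sqrt_of_sq_le h1
  have hP0 : 0 ≤ P := Real.sqrt_nonneg _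
  have hQ0 : 0 ≤ √W + ν * P := by positivity
  refine ⟨fun t ht F => (h2 t ht F).trans ?_, fun k hk => ((h.norm_deriv_le hk).trans h3).trans ?_,
    h4.trans ?_⟩
  · linarith [le_abs_self N]
  · linarith [abs_nonneg N]
  · linarith [abs_nonneg N]

theorem norm_sq_le_of_sum_fourth_le {u : L2} (h0 : fc 0 u = 0) {K : ℝ}
    (hK : ∀ F : Finset ℤ, ∑ m ∈ F, (m : ℝ) ^ 4 * ‖fc m u‖ ^ 2 ≤ K) : ‖u‖ ^ 2 ≤ K := by
  refine norm_sq_le_of_sum_le fun F => (Finset.sum_le_sum fun m _ => ?_).trans (hK F)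
  rcases eq_or_ne m 0 with rfl | hm
  · simp [h0]
  · have h1 : (1 : ℝ) ≤ |(m : ℝ)| := by exact_mod_cast Int.one_le_abs hm
    have h2 : (1 : ℝ) ≤ (m : ℝ) ^ 4 := by
      rw [← (by decide : Even 4).pow_abs]
      exact one_le_pow₀ h1
    exact le_mul_of_one_le_left (by positivity) h2

/-- The basic energy estimate is run on the pair as one curve in `L2Pair`, since neither component
closes alone. Afterwards the coupling term is just bounded data and the components are bootstrapped
separately. -/
theorem exists_isBounded {ν T : ℝ} (hν : 0 < ν) (hT : 0 ≤ T) (α₁ α₂ K : ℝ) :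
    ∃ M, ∀ (S : Set ℤ) (f₁ f₂ : Control T) (u₁ u₂ : ℝ → L2) (v₁ v₂ : Control T)
      (D₁ D₂ : ℕ → Control T), IsApprox S ν α₁ f₁ u₁ v₁ D₁ (D₂ 2) →
      IsApprox S ν α₂ f₂ u₂ v₂ D₂ (D₁ 2) → ‖f₁‖ ^ 2 ≤ K → ‖f₂‖ ^ 2 ≤ K →
      (∀ F : Finset ℤ, ∑ m ∈ F, (m : ℝ) ^ 4 * ‖fc m (u₁ 0)‖ ^ 2 ≤ K) →
      (∀ F : Finset ℤ, ∑ m ∈ F, (m : ℝ) ^ 4 * ‖fc m (u₂ 0)‖ ^ 2 ≤ K) →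
      IsBounded M u₁ v₁ D₁ ∧ IsBounded M u₂ v₂ D₂ := by
  set A := 1 + |α₁| + |α₂| with hA
  set C := 4 * A ^ 2 / ν + 1 with hC
  have hC0 : 0 ≤ C := by positivity
  set M₀ := (K + K + (K + K)) * Real.exp (C * T) with hM₀
  obtain ⟨M₁, hM₁⟩ := exists_isBounded_of_second_deriv hν hT α₁ K (M₀ + ν⁻¹ * M₀)
  obtain ⟨M₂, hM₂⟩ := exists_isBounded_of_second_deriv hν hT α₂ K (M₀ + ν⁻¹ * M₀)
  refine ⟨max M₁ M₂, fun S f₁ f₂ u₁ u₂ v₁ v₂ D₁ D₂ h₁ h₂ hf₁ hf₂ hK₁ hK₂ => ?_⟩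
  have h0 : (0 : ℝ) ∈ Icc 0 T := ⟨le_rfl, hT⟩
  have hv₁ := control_intervalIntegrable hT v₁
  have hv₂ := control_intervalIntegrable hT v₂
  have hdi : IntervalIntegrable (fun s => ν * (‖D₁ 2 s‖ ^ 2 + ‖D₂ 2 s‖ ^ 2)) volume 0 T :=
    ((intervalIntegrable_norm_sq hT _).add (intervalIntegrable_norm_sq hT _)).const_mul ν
  have hfi : IntervalIntegrable (fun s => ‖f₁ s‖ ^ 2 + ‖f₂ s‖ ^ 2) volume 0 T :=
    (intervalIntegrable_norm_sq hT _).add (intervalIntegrable_norm_sq hT _)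
  have hfint : ∫ s in (0 : ℝ)..T, (‖f₁ s‖ ^ 2 + ‖f₂ s‖ ^ 2) = ‖f₁‖ ^ 2 + ‖f₂‖ ^ 2 := by
    rw [intervalIntegral.integral_of_le hT, integral_add (integrable_norm_sq _)
      (integrable_norm_sq _), ← control_norm_sq, ← control_norm_sq]
  have hen : ∀ t ∈ Icc 0 T, ‖u₁ t‖ ^ 2 + ‖u₂ t‖ ^ 2
      + ∫ s in (0 : ℝ)..t, ν * (‖D₁ 2 s‖ ^ 2 + ‖D₂ 2 s‖ ^ 2) ≤ M₀ := fun t ht => by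
    have key := energy_estimate (u := fun t => (WithLp.toLp 2 (u₁ t, u₂ t) : L2Pair))
      (v := fun s => WithLp.toLp 2 (v₁ s, v₂ s)) hT hC0 ?_ (fun t ht => ?_) hdi
      (fun t => by positivity) hfi (fun t => by positivity) ?_ ht
    · rw [norm_sq_toLp, norm_sq_toLp, hfint] at key
      refine key.trans ?_
      rw [hM₀]
      gcongr
      · exact norm_sq_le_of_sum_fourth_le (h₁.mean 0 h0) hK₁
      · exact norm_sq_le_of_sum_fourth_le (h₂.mean 0 h0) hK₂
    · simp only [toLp_eq_add]
      exact IntervalIntegrable.add ⟨pairInl.integrable_comp hv₁.1, pairInl.integrable_comp hv₁.2⟩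
        ⟨pairInr.integrable_comp hv₂.1, pairInr.integrable_comp hv₂.2⟩
    · rw [intervalIntegral_toLp (intervalIntegrable_of_mem hT hv₁ h0 ht)
        (intervalIntegrable_of_mem hT hv₂ h0 ht), h₁.eq_add t ht, h₂.eq_add t ht]
      rfl
    · filter_upwards [h₁.slice, h₂.slice] with s e1 e2
      rw [inner_toLp, norm_sq_toLp]
      exact energy_arith hν (norm_nonneg _) (norm_nonneg _) (norm_nonneg _) (norm_nonneg _) hA
        e1.inner_le e2.inner_le
  have hM₀0 : 0 ≤ M₀ := by
    have hK0 : 0 ≤ K := (sq_nonneg _).trans hf₁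
    positivity
  have hνM : 0 ≤ ν⁻¹ * M₀ := by positivity
  have hd0 : ∀ t ∈ Icc 0 T, 0 ≤ ∫ s in (0 : ℝ)..t, ν * (‖D₁ 2 s‖ ^ 2 + ‖D₂ 2 s‖ ^ 2) :=
    fun t ht => intervalIntegral.integral_nonneg ht.1 fun s _ => by positivity
  have hD : ‖D₁ 2‖ ^ 2 + ‖D₂ 2‖ ^ 2 ≤ ν⁻¹ * M₀ := by
    have h3 := hen T ⟨hT, le_rfl⟩
    rw [intervalIntegral.integral_const_mul, intervalIntegral.integral_of_le hT,
      integral_add (integrable_norm_sq _) (integrable_norm_sq _), ← control_norm_sq,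
      ← control_norm_sq] at h3
    rw [le_inv_mul_iff₀ hν]
    linarith [sq_nonneg ‖u₁ T‖, sq_nonneg ‖u₂ T‖]
  have hu₁ : ∀ t ∈ Icc 0 T, ‖u₁ t‖ ^ 2 ≤ M₀ + ν⁻¹ * M₀ := fun t ht => by
    linarith [hen t ht, hd0 t ht, sq_nonneg ‖u₂ t‖]
  have hu₂ : ∀ t ∈ Icc 0 T, ‖u₂ t‖ ^ 2 ≤ M₀ + ν⁻¹ * M₀ := fun t ht => by
    linarith [hen t ht, hd0 t ht, sq_nonneg ‖u₁ t‖]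
  have hD₁ : ‖D₁ 2‖ ^ 2 ≤ M₀ + ν⁻¹ * M₀ := by linarith [sq_nonneg ‖D₂ 2‖]
  have hD₂ : ‖D₂ 2‖ ^ 2 ≤ M₀ + ν⁻¹ * M₀ := by linarith [sq_nonneg ‖D₁ 2‖]
  exact ⟨(hM₁ S f₁ u₁ v₁ D₁ _ h₁ hf₁ hK₁ hu₁ hD₁ hD₂).mono (le_max_left _ _),
    (hM₂ S f₂ u₂ v₂ D₂ _ h₂ hf₂ hK₂ hu₂ hD₂ hD₁).mono (le_max_right _ _)⟩

end CoupledKS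

/-! ### Weak convergence along ultrafilters and identification of weak limits -/

namespace CoupledKS

open Filter Topology

/-- Weak convergence in a real inner product space. -/
def WeakTendsto {ι H : Type*} [NormedAddCommGroup H] [InnerProductSpace ℝ H] (x : ι → H)
    (l : Filter ι) (x₀ : H) : Prop :=
  ∀ y : H, Tendsto (fun i => inner ℝ y (x i)) l (𝓝 (inner ℝ y x₀))

namespace WeakTendsto

variable {ι H : Type*} [NormedAddCommGroup H] [InnerProductSpace ℝ H] {x y : ι → H}
  {l : Filter ι} {x₀ y₀ : H}

theorem add (hx : WeakTendsto x l x₀) (hy : WeakTendsto y l y₀) :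
    WeakTendsto (fun i => x i + y i) l (x₀ + y₀) := fun z => by
  simpa only [inner_add_right] using (hx z).add (hy z)

theorem sub (hx : WeakTendsto x l x₀) (hy : WeakTendsto y l y₀) :
    WeakTendsto (fun i => x i - y i) l (x₀ - y₀) := fun z => by
  simpa only [inner_sub_right] using (hx z).sub (hy z)

theorem const_smul (c : ℝ) (hx : WeakTendsto x l x₀) :
    WeakTendsto (fun i => c • x i) l (c • x₀) := fun z => by
  simpa only [inner_smul_right] using (hx z).const_mul c

theorem clm_real [CompleteSpace H] (hx : WeakTendsto x l x₀) (A : H →L[ℝ] ℝ) :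
    Tendsto (fun i => A (x i)) l (𝓝 (A x₀)) := by
  have := hx ((InnerProductSpace.toDual ℝ H).symm A)
  simpa only [InnerProductSpace.toDual_symm_apply] using this

theorem clm_complex [CompleteSpace H] (hx : WeakTendsto x l x₀) (A : H →L[ℝ] ℂ) :
    Tendsto (fun i => A (x i)) l (𝓝 (A x₀)) := by
  have h1 := hx.clm_real (Complex.reCLM.comp A)
  have h2 := hx.clm_real (Complex.imCLM.comp A)
  have h3 := Complex.equivRealProdCLM.symm.continuous.tendsto
    ((A x₀).re, (A x₀).im) |>.comp (h1.prodMk_nhds h2)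
  exact h3

theorem _root_.Filter.Tendsto.weakTendsto (hx : Tendsto x l (𝓝 x₀)) : WeakTendsto x l x₀ :=
  fun _ => tendsto_const_nhds.inner hx

theorem unique [l.NeBot] (hx : WeakTendsto x l x₀) (hy : WeakTendsto x l y₀) : x₀ = y₀ :=
  ext_inner_left ℝ fun z => tendsto_nhds_unique (hx z) (hy z)

end WeakTendsto

theorem exists_ultrafilter_tendsto_of_norm_le {ι E : Type*} [NormedAddCommGroup E] [ProperSpace E]
    (U : Ultrafilter ι) {x : ι → E} {M : ℝ} (h : ∀ i, ‖x i‖ ≤ M) :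
    ∃ a : E, ‖a‖ ≤ M ∧ Tendsto x U (𝓝 a) := by
  have hmem : Metric.closedBall (0 : E) M ∈ U.map x :=
    Ultrafilter.mem_map.2 (Filter.mem_of_superset Filter.univ_mem
      fun i _ => mem_closedBall_zero_iff.2 (h i))
  obtain ⟨a, ha, hle⟩ := (isCompact_closedBall (0 : E) M).ultrafilter_le_nhds' (U.map x) hmem
  exact ⟨a, mem_closedBall_zero_iff.1 ha, hle⟩

/-- Along an ultrafilter every bounded scalar family converges, so all pairings with `x i` converge
simultaneously and no subsequence is extracted. The limits form a bounded functional, represented by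
Riesz. -/
theorem exists_weakTendsto {ι H : Type*} [NormedAddCommGroup H] [InnerProductSpace ℝ H]
    [CompleteSpace H] (U : Ultrafilter ι) {x : ι → H} {M : ℝ} (h : ∀ i, ‖x i‖ ≤ M) :
    ∃ x₀ : H, WeakTendsto x U x₀ := by
  have hb : ∀ (y : H) (i : ι), ‖(inner ℝ y (x i) : ℝ)‖ ≤ M * ‖y‖ := fun y i => by
    refine (norm_inner_le_norm y (x i)).trans ?_
    rw [mul_comm]
    gcongr
    exact h i
  have hex : ∀ y : H, ∃ a : ℝ, ‖a‖ ≤ M * ‖y‖ ∧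
      Tendsto (fun i => (inner ℝ y (x i) : ℝ)) U (𝓝 a) :=
    fun y => exists_ultrafilter_tendsto_of_norm_le U (hb y)
  choose a ha hlim using hex
  let A : H →L[ℝ] ℝ := LinearMap.mkContinuous
    { toFun := a
      map_add' := fun y z => tendsto_nhds_unique (hlim (y + z)) (by
        simpa only [inner_add_left] using (hlim y).add (hlim z))
      map_smul' := fun c y => tendsto_nhds_unique (hlim (c • y)) (by
        simpa only [inner_smul_left, conj_trivial, RingHom.id_apply, smul_eq_mul] using
          (hlim y).const_mul c) } M ha
  refine ⟨(InnerProductSpace.toDual ℝ H).symm A, fun y => ?_⟩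
  rw [real_inner_comm, InnerProductSpace.toDual_symm_apply]
  exact hlim y

section ControlSpace

variable {T : ℝ} {ι : Type*} {l : Filter ι} {w : ι → Control T} {w₀ : Control T}

theorem WeakTendsto.setIntegral (hw : WeakTendsto w l w₀) {A : Set ℝ} (hA : MeasurableSet A) :
    WeakTendsto (fun i => ∫ s in A, w i s ∂(timeMeasure T)) l
      (∫ s in A, w₀ s ∂(timeMeasure T)) := fun c => by
  have := hw (indicatorConstLp 2 hA (measure_ne_top _ _) c)
  simpa only [L2.inner_indicatorConstLp_eq_inner_setIntegral] using this

/-- Cauchy–Schwarz, pairing `w` with the indicator of `A` times the integral itself. On intervals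
this gives the Hölder exponent 1/2 in time. -/
theorem norm_setIntegral_le (w : Control T) {A : Set ℝ} (hA : MeasurableSet A) :
    ‖∫ s in A, w s ∂(timeMeasure T)‖ ≤ √((timeMeasure T).real A) * ‖w‖ := by
  set c := ∫ s in A, w s ∂(timeMeasure T) with hc
  have h := real_inner_le_norm (indicatorConstLp 2 hA (measure_ne_top (timeMeasure T) A) c) w
  rw [L2.inner_indicatorConstLp_eq_inner_setIntegral, ← hc, real_inner_self_eq_norm_sq,
    norm_indicatorConstLp (by norm_num) (by norm_num), ENNReal.toReal_ofNat, ← Real.sqrt_eq_rpow,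
    sq, mul_assoc] at h
  rcases eq_or_lt_of_le (norm_nonneg c) with h0 | h0
  · rw [← h0]; positivity
  · exact le_of_mul_le_mul_left h h0

theorem intervalIntegral_eq_setIntegral (w : Control T) {s t : ℝ} (hs : 0 ≤ s) (hst : s ≤ t)
    (ht : t ≤ T) : ∫ r in s..t, w r = ∫ r in Ioc s t, w r ∂(timeMeasure T) := by
  rw [intervalIntegral.integral_of_le hst, Measure.restrict_restrict measurableSet_Ioc,
    inter_eq_left.2 (Ioc_subset_Ioc hs ht)]

theorem norm_intervalIntegral_le (w : Control T) {s t : ℝ} (hs : 0 ≤ s) (hst : s ≤ t)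
    (ht : t ≤ T) : ‖∫ r in s..t, w r‖ ≤ √(t - s) * ‖w‖ := by
  rw [intervalIntegral_eq_setIntegral w hs hst ht]
  refine (norm_setIntegral_le w measurableSet_Ioc).trans (le_of_eq ?_)
  rw [measureReal_restrict_apply measurableSet_Ioc, inter_eq_left.2 (Ioc_subset_Ioc hs ht),
    Real.volume_real_Ioc_of_le hst]

theorem tendsto_setIntegral_of_tendstoUniformlyOn {c : ι → ℝ → ℂ} {c₀ : ℝ → ℂ}
    (hc : TendstoUniformlyOn c c₀ l (Icc 0 T))
    (hci : ∀ᶠ i in l, Integrable (c i) (timeMeasure T))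
    (hc₀ : Integrable c₀ (timeMeasure T)) {A : Set ℝ} :
    Tendsto (fun i => ∫ s in A, c i s ∂(timeMeasure T)) l (𝓝 (∫ s in A, c₀ s ∂(timeMeasure T))) := by
  rw [Metric.tendsto_nhds]
  intro ε hε
  set m := (timeMeasure T).real univ with hm
  have hm0 : 0 ≤ m := measureReal_nonneg
  have h1 := Metric.tendstoUniformlyOn_iff.1 hc (ε / (m + 1)) (by positivity)
  filter_upwards [h1, hci] with i hi hii
  rw [dist_eq_norm, ← integral_sub hii.integrableOn hc₀.integrableOn]
  have h2 : ∀ᵐ s ∂((timeMeasure T).restrict A), ‖c i s - c₀ s‖ ≤ ε / (m + 1) := by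
    refine ae_restrict_of_ae ?_
    filter_upwards [ae_restrict_mem measurableSet_Ioc] with s hs
    rw [← dist_eq_norm, dist_comm]
    exact (hi s (Ioc_subset_Icc_self hs)).le
  refine (norm_integral_le_of_norm_le_const h2).trans_lt ?_
  have h3 : ((timeMeasure T).restrict A).real univ ≤ m := by
    rw [measureReal_restrict_apply_univ]
    exact measureReal_mono (subset_univ A)
  calc ε / (m + 1) * ((timeMeasure T).restrict A).real univ ≤ ε / (m + 1) * m := by gcongr
    _ < ε / (m + 1) * (m + 1) := by gcongr; linarith
    _ = ε := by field_simp

/-- A function of time is determined almost everywhere by its integrals over measurable sets. Such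
an integral of a fixed mode is a weakly continuous functional of `w`, whereas the right-hand sides
converge uniformly. -/
theorem WeakTendsto.ae_fc_eq [l.NeBot] (hw : WeakTendsto w l w₀) {m : ℤ} {c : ι → ℝ → ℂ}
    {c₀ : ℝ → ℂ} (hc : TendstoUniformlyOn c c₀ l (Icc 0 T))
    (hwc : ∀ᶠ i in l, ∀ᵐ s ∂(timeMeasure T), fc m (w i s) = c i s)
    (hc₀ : ContinuousOn c₀ (Icc 0 T)) : ∀ᵐ s ∂(timeMeasure T), fc m (w₀ s) = c₀ s := by
  have hint : ∀ f : Control T, Integrable (fun s => fc m (f s)) (timeMeasure T) := fun f =>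
    (fc m).integrable_comp (control_integrable f)
  have hc₀i : Integrable c₀ (timeMeasure T) :=
    hc₀.integrableOn_Icc.mono_set Ioc_subset_Icc_self
  refine Integrable.ae_eq_of_forall_setIntegral_eq _ _ (hint w₀) hc₀i fun A hA _ => ?_
  have e1 : ∀ f : Control T, ∫ s in A, fc m (f s) ∂(timeMeasure T)
      = fc m (∫ s in A, f s ∂(timeMeasure T)) := fun f =>
    (fc m).integral_comp_comm (control_integrable f).integrableOn
  have h1 : Tendsto (fun i => ∫ s in A, fc m (w i s) ∂(timeMeasure T)) l
      (𝓝 (∫ s in A, fc m (w₀ s) ∂(timeMeasure T))) := by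
    simp only [e1]
    exact (hw.setIntegral hA).clm_complex (fc m)
  have h2 := tendsto_setIntegral_of_tendstoUniformlyOn hc
    (hwc.mono fun i hi => (hint (w i)).congr hi) hc₀i (A := A)
  refine tendsto_nhds_unique h1 (h2.congr' ?_)
  filter_upwards [hwc] with i hi
  refine integral_congr_ae (ae_restrict_of_ae ?_)
  filter_upwards [hi] with s hs
  exact hs.symm

end ControlSpace

end CoupledKS

/-! ### Rellich and Arzelà–Ascoli compactness -/

namespace CoupledKS

open Filter Topology ComplexConjugate

/-- A bounded subset of the periodic Sobolev space of order two and mean zero. -/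
def sobolevBall (M : ℝ) : Set L2 :=
  {u | fc 0 u = 0 ∧ ∀ F : Finset ℤ, ∑ m ∈ F, (m : ℝ) ^ 4 * ‖fc m u‖ ^ 2 ≤ M}

/-- Tail control: modes outside the window satisfy `|m| ≥ N + 1`, hence `m ^ 4 ≥ N + 1`. This crude
rate is enough for compactness. -/
theorem norm_sq_le_sum_add {u : L2} {R : ℝ}
    (hR : ∀ F : Finset ℤ, ∑ m ∈ F, (m : ℝ) ^ 4 * ‖fc m u‖ ^ 2 ≤ R) (N : ℕ) :
    ‖u‖ ^ 2 ≤ ∑ m ∈ Finset.Icc (-(N : ℤ)) N, ‖fc m u‖ ^ 2 + R / (N + 1) := by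
  refine norm_sq_le_of_sum_le fun F => ?_
  rw [← Finset.sum_filter_add_sum_filter_not F (· ∈ Finset.Icc (-(N : ℤ)) N)]
  gcongr ?_ + ?_
  · exact Finset.sum_le_sum_of_subset_of_nonneg (fun m hm => (Finset.mem_filter.1 hm).2)
      fun _ _ _ => by positivity
  · rw [le_div_iff₀ (by positivity), Finset.sum_mul]
    refine le_trans (Finset.sum_le_sum fun m hm => ?_) (hR (F.filter (· ∉ Finset.Icc (-(N : ℤ)) N)))
    have hm' := (Finset.mem_filter.1 hm).2
    rw [Finset.mem_Icc, ← abs_le, not_le] at hm'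
    have h1 : ((N : ℝ) + 1) ≤ |(m : ℝ)| := by exact_mod_cast hm'
    have h2 : ((N : ℝ) + 1) ≤ (m : ℝ) ^ 4 := by
      rw [← (by decide : Even 4).pow_abs]
      refine h1.trans (le_self_pow₀ ?_ (by norm_num))
      have : (0 : ℝ) ≤ N := by positivity
      linarith
    rw [mul_comm]
    gcongr

theorem sum_fourth_sub_le {u w : L2} {M : ℝ} (hu : u ∈ sobolevBall M) (hw : w ∈ sobolevBall M)
    (F : Finset ℤ) : ∑ m ∈ F, (m : ℝ) ^ 4 * ‖fc m (u - w)‖ ^ 2 ≤ 4 * M := by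
  have h : ∑ m ∈ F, (m : ℝ) ^ 4 * ‖fc m (u - w)‖ ^ 2
      ≤ 2 * ∑ m ∈ F, (m : ℝ) ^ 4 * ‖fc m u‖ ^ 2 + 2 * ∑ m ∈ F, (m : ℝ) ^ 4 * ‖fc m w‖ ^ 2 := by
    rw [Finset.mul_sum, Finset.mul_sum, ← Finset.sum_add_distrib]
    refine Finset.sum_le_sum fun m _ => ?_
    have h1 : ‖fc m (u - w)‖ ^ 2 ≤ 2 * ‖fc m u‖ ^ 2 + 2 * ‖fc m w‖ ^ 2 := by
      rw [map_sub]
      have h2 : ‖fc m u - fc m w‖ ^ 2 ≤ (‖fc m u‖ + ‖fc m w‖) ^ 2 := by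
        gcongr
        exact norm_sub_le _ _
      nlinarith [sq_nonneg (‖fc m u‖ - ‖fc m w‖)]
    have h3 : (0 : ℝ) ≤ (m : ℝ) ^ 4 := by positivity
    nlinarith
  linarith [hu.2 F, hw.2 F]

/-- Along an ultrafilter each coefficient converges, and the limits are square summable and respect
the weighted bound. The uniformly small tails turn coefficientwise convergence into norm
convergence. -/
theorem isCompact_sobolevBall (M : ℝ) : IsCompact (sobolevBall M) := by
  rw [isCompact_iff_ultrafilter_le_nhds']
  intro U hU
  have hmem : ∀ᶠ u in (U : Filter L2), u ∈ sobolevBall M := hU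
  have hex : ∀ m : ℤ, ∃ a : ℂ, Tendsto (fun u => fc m u) U (𝓝 a) := fun m => by
    have hb : Metric.closedBall (0 : ℂ) (√M) ∈ U.map (fun u => fc m u) := by
      refine Ultrafilter.mem_map.2 (Filter.mem_of_superset hU fun u hu => ?_)
      refine mem_closedBall_zero_iff.2 ((norm_fc_le m u).trans ?_)
      exact Real.le_sqrt_of_sq_le (norm_sq_le_of_sum_fourth_le hu.1 hu.2)
    obtain ⟨a, -, ha⟩ := (isCompact_closedBall (0 : ℂ) _).ultrafilter_le_nhds' _ hb
    exact ⟨a, ha⟩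
  choose a ha using hex
  have hconj : ∀ m, a (-m) = conj (a m) := fun m =>
    tendsto_nhds_unique (ha (-m)) (by
      simpa only [fc_neg, Function.comp_def] using
        (Complex.continuous_conj.tendsto (a m)).comp (ha m))
  have h0 : a 0 = 0 := tendsto_nhds_unique (ha 0)
    (tendsto_const_nhds.congr' (hmem.mono fun u hu => hu.1.symm))
  have hsum : ∀ F : Finset ℤ, ∑ m ∈ F, (m : ℝ) ^ 4 * ‖a m‖ ^ 2 ≤ M := fun F =>
    le_of_tendsto (tendsto_finsetSum F fun m _ => ((ha m).norm.pow 2).const_mul _)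
      (hmem.mono fun u hu => hu.2 F)
  have hsumm : Summable fun m => ‖a m‖ ^ 2 := by
    refine summable_of_sum_le (c := M) (fun _ => by positivity) fun F => ?_
    refine le_of_tendsto (tendsto_finsetSum F fun m _ => (ha m).norm.pow 2) (hmem.mono fun u hu => ?_)
    exact (sum_fc_sq_le u F).trans (norm_sq_le_of_sum_fourth_le hu.1 hu.2)
  obtain ⟨w, hw⟩ := exists_fc_eq a hconj hsumm
  have hwM : w ∈ sobolevBall M := ⟨by rw [hw, h0], fun F => by simpa only [hw] using hsum F⟩
  have hM0 : 0 ≤ M := by simpa using hwM.2 ∅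
  refine ⟨w, hwM, ?_⟩
  have : Tendsto (fun u => u) (U : Filter L2) (𝓝 w) := by
    rw [tendsto_iff_norm_sub_tendsto_zero]
    have hsq : Tendsto (fun u => ‖u - w‖ ^ 2) (U : Filter L2) (𝓝 0) := by
      rw [Metric.tendsto_nhds]
      intro ε hε
      obtain ⟨N, hN⟩ := exists_nat_gt (4 * M / (ε / 2))
      have hfin : Tendsto (fun u => ∑ m ∈ Finset.Icc (-(N : ℤ)) N, ‖fc m (u - w)‖ ^ 2)
          (U : Filter L2) (𝓝 0) := by
        have : Tendsto (fun u => ∑ m ∈ Finset.Icc (-(N : ℤ)) N, ‖fc m u - fc m w‖ ^ 2)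
            (U : Filter L2) (𝓝 (∑ m ∈ Finset.Icc (-(N : ℤ)) N, ‖a m - fc m w‖ ^ 2)) :=
          tendsto_finsetSum _ fun m _ => ((ha m).sub_const _).norm.pow 2
        simpa [hw] using this
      filter_upwards [hmem, hfin.eventually (gt_mem_nhds (half_pos hε))] with u hu hu2
      have h1 := norm_sq_le_sum_add (sum_fourth_sub_le hu hwM) N
      have h2 : 4 * M / (N + 1) < ε / 2 := by
        rw [div_lt_iff₀ (by positivity)] at hN ⊢
        nlinarith
      rw [Real.dist_eq, sub_zero, abs_of_nonneg (by positivity)]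
      linarith
    have := hsq.sqrt
    simpa using this
  exact this

/-- Compactness in `C([0,T]; L²)` of sequences bounded in `H²` and equicontinuous in time. -/
theorem exists_tendstoUniformlyOn {T M : ℝ} (hT : 0 ≤ T) {ι : Type*} (U : Ultrafilter ι)
    {u : ι → ℝ → L2} (hM : ∀ i, ∀ t ∈ Icc 0 T, u i t ∈ sobolevBall M)
    (hH : ∀ i, ∀ s ∈ Icc 0 T, ∀ t ∈ Icc 0 T, dist (u i s) (u i t) ≤ √|s - t| * M) :
    ∃ u₀ : ℝ → L2, ContinuousOn u₀ (Icc 0 T) ∧ TendstoUniformlyOn u u₀ U (Icc 0 T) ∧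
      ∀ t ∈ Icc 0 T, u₀ t ∈ sobolevBall M := by
  have hcont : ∀ i, Continuous fun t : Icc (0 : ℝ) T => u i t := fun i => by
    rw [continuous_iff_continuousAt]
    intro s
    rw [ContinuousAt, tendsto_iff_dist_tendsto_zero]
    have h1 : Tendsto (fun t : Icc (0 : ℝ) T => √|(t : ℝ) - s| * M) (𝓝 s) (𝓝 0) := by
      have hc : Continuous fun t : Icc (0 : ℝ) T => √|(t : ℝ) - s| * M := by fun_prop
      simpa using hc.tendsto s
    exact squeeze_zero (fun _ => dist_nonneg) (fun t => hH i t t.2 s s.2) h1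
  let F : ι → BoundedContinuousFunction (Icc (0 : ℝ) T) L2 := fun i =>
    BoundedContinuousFunction.mkOfCompact ⟨_, hcont i⟩
  let A : Set (BoundedContinuousFunction (Icc (0 : ℝ) T) L2) :=
    {g | (∀ t, g t ∈ sobolevBall M) ∧ ∀ s t : Icc (0 : ℝ) T, dist (g s) (g t) ≤ √|(s : ℝ) - t| * M}
  have hA : IsCompact (closure A) := by
    refine BoundedContinuousFunction.arzela_ascoli (sobolevBall M) (isCompact_sobolevBall M) A
      (fun g t hg => hg.1 t) ?_
    refine Metric.equicontinuous_of_continuity_modulus (fun r => √r * M) ?_ _ fun s t g => ?_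
    · have hc : Continuous fun r : ℝ => √r * M := by fun_prop
      simpa using hc.tendsto 0
    · simpa [Subtype.dist_eq, Real.dist_eq] using g.2.2 s t
  have hFA : closure A ∈ U.map F :=
    Ultrafilter.mem_map.2 (Filter.mem_of_superset Filter.univ_mem fun i _ =>
      subset_closure ⟨fun t => hM i t t.2, fun s t => hH i s s.2 t t.2⟩)
  obtain ⟨g, -, hg⟩ := hA.ultrafilter_le_nhds' _ hFA
  have hg' : Tendsto F U (𝓝 g) := hg
  rw [BoundedContinuousFunction.tendsto_iff_tendstoUniformly] at hg'
  have hproj : ∀ t (ht : t ∈ Icc 0 T), g (projIcc 0 T hT t) = g ⟨t, ht⟩ := fun t ht => by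
    rw [projIcc_of_mem hT ht]
  refine ⟨fun t => g (projIcc 0 T hT t), (g.continuous.comp continuous_projIcc).continuousOn, ?_,
    fun t ht => ?_⟩
  · rw [Metric.tendstoUniformlyOn_iff]
    intro ε hε
    filter_upwards [Metric.tendstoUniformly_iff.1 hg' ε hε] with i hi t ht
    rw [hproj t ht]
    exact hi ⟨t, ht⟩
  · refine (isCompact_sobolevBall M).isClosed.mem_of_tendsto
      (hg'.tendsto_at (projIcc 0 T hT t)) (Eventually.of_forall fun i => ?_)
    exact hM i _ (projIcc 0 T hT t).2

end CoupledKS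

/-! ### Passage to the limit in the equations -/

namespace CoupledKS

open Filter Topology ComplexConjugate

theorem continuous_sqc (m : ℤ) : Continuous (sqc m) := by
  rw [continuous_iff_continuousAt]
  intro u
  rw [ContinuousAt, tendsto_iff_norm_sub_tendsto_zero]
  refine squeeze_zero (fun _ => norm_nonneg _) (fun w => norm_sqc_sub_le m w u) ?_
  have hc : Continuous fun w : L2 => ‖w - u‖ * ‖w + u‖ := by fun_prop
  simpa using hc.tendsto u

/-- By `norm_sqc_sub_le` only `‖u₀ s + u i s‖` must be controlled; once the deviation is below 1 it
is at most `2 * |B| + 1`. -/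
theorem tendstoUniformlyOn_sqc {ι : Type*} {l : Filter ι} {u : ι → ℝ → L2} {u₀ : ℝ → L2} {T : ℝ}
    (hu : TendstoUniformlyOn u u₀ l (Icc 0 T)) (hc : ContinuousOn u₀ (Icc 0 T)) (m : ℤ) (c : ℂ) :
    TendstoUniformlyOn (fun i s => c * sqc m (u i s)) (fun s => c * sqc m (u₀ s)) l (Icc 0 T) := by
  obtain ⟨B, hB⟩ := isCompact_Icc.exists_bound_of_continuousOn hc
  rw [Metric.tendstoUniformlyOn_iff] at hu ⊢
  intro ε hε
  set R := (‖c‖ + 1) * (2 * |B| + 1) with hR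
  have hR0 : 0 < R := by positivity
  filter_upwards [hu (min 1 (ε / R)) (by positivity)] with i hi s hs
  have h1 := hi s hs
  rw [dist_eq_norm] at h1
  have h2 : ‖u₀ s - u i s‖ < 1 := h1.trans_le (min_le_left _ _)
  have h3 : ‖u₀ s - u i s‖ < ε / R := h1.trans_le (min_le_right _ _)
  have h4 : ‖u₀ s + u i s‖ ≤ 2 * |B| + 1 := by
    have e : u₀ s + u i s = (2 : ℝ) • u₀ s - (u₀ s - u i s) := by rw [two_smul]; abel
    rw [e]
    refine (norm_sub_le _ _).trans ?_
    rw [norm_smul, Real.norm_of_nonneg (by norm_num)]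
    have := (hB s hs).trans (le_abs_self B)
    linarith
  rw [dist_eq_norm, ← mul_sub, norm_mul]
  calc ‖c‖ * ‖sqc m (u₀ s) - sqc m (u i s)‖
      ≤ (‖c‖ + 1) * (‖u₀ s - u i s‖ * (2 * |B| + 1)) := by
        gcongr
        · linarith
        · exact (norm_sqc_sub_le m _ _).trans (by gcongr)
    _ = ‖u₀ s - u i s‖ * R := by rw [hR]; ring
    _ < ε / R * R := by gcongr
    _ = ε := by field_simp

theorem tendstoUniformlyOn_const_mul_fc {ι : Type*} {l : Filter ι} {u : ι → ℝ → L2} {u₀ : ℝ → L2}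
    {T : ℝ} (hu : TendstoUniformlyOn u u₀ l (Icc 0 T)) (m : ℤ) (c : ℂ) :
    TendstoUniformlyOn (fun i s => c * fc m (u i s)) (fun s => c * fc m (u₀ s)) l (Icc 0 T) :=
  ((ContinuousLinearMap.mul ℝ ℂ c).comp (fc m)).uniformContinuous.comp_tendstoUniformlyOn hu

theorem memHdot_two {u : L2} {M : ℝ} (h : u ∈ sobolevBall M) : MemHdot 2 u := by
  refine ⟨(hasZeroMean_iff u).2 h.1, fun k hk => ?_⟩
  have hle : ∀ m : ℤ, ‖(m * Complex.I) ^ k * fc m u‖ ^ 2 ≤ (m : ℝ) ^ 4 * ‖fc m u‖ ^ 2 := fun m => by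
    rcases eq_or_ne m 0 with rfl | hm
    · simp [h.1]
    · have h1 : (1 : ℝ) ≤ |(m : ℝ)| := by exact_mod_cast Int.one_le_abs hm
      rw [norm_mul, norm_pow, norm_mul, Complex.norm_I, mul_one, Complex.norm_intCast, mul_pow,
        ← pow_mul, ← (by decide : Even 4).pow_abs]
      gcongr
      omega
  obtain ⟨v, hv⟩ := exists_fc_eq (fun m => (m * Complex.I) ^ k * fc m u) (fun m => by
      rw [fc_neg, map_mul, map_pow, map_mul, Complex.conj_I, map_intCast]
      congr 2; push_cast; ring)
    (summable_of_sum_le (c := M) (fun _ => by positivity) fun F =>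
      (Finset.sum_le_sum fun m _ => hle m).trans (h.2 F))
  exact ⟨v, isWeakDeriv_iff.2 hv⟩

section Limit

variable {ι : Type*} {U : Ultrafilter ι} {T M ν α : ℝ} {S : ι → Set ℤ} {f : ι → Control T}
  {u : ι → ℝ → L2} {v : ι → Control T} {D : ι → ℕ → Control T} {e : ι → Control T}

theorem exists_limit_component (hT : 0 ≤ T)
    (h : ∀ i, IsApprox (S i) ν α (f i) (u i) (v i) (D i) (e i))
    (hb : ∀ i, IsBounded M (u i) (v i) (D i)) :
    ∃ (u₀ : ℝ → L2) (v₀ : Control T) (D₀ : ℕ → Control T),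
      TendstoUniformlyOn u u₀ U (Icc 0 T) ∧ WeakTendsto v U v₀ ∧
      (∀ k ≤ 4, WeakTendsto (fun i => D i k) U (D₀ k)) ∧
      ContinuousOn u₀ (Icc 0 T) ∧ (∀ t ∈ Icc 0 T, u₀ t ∈ sobolevBall M) ∧
      (∀ t ∈ Icc 0 T, u₀ t = u₀ 0 + ∫ s in (0 : ℝ)..t, v₀ s) ∧
      ∀ᵐ s ∂(timeMeasure T), ∀ k ≤ 4, ∀ m : ℤ,
        fc m (D₀ k s) = (m * Complex.I) ^ k * fc m (u₀ s) := by
  have hH : ∀ i, ∀ s ∈ Icc 0 T, ∀ t ∈ Icc 0 T, dist (u i s) (u i t) ≤ √|s - t| * M := by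
    have key : ∀ i, ∀ s ∈ Icc 0 T, ∀ t ∈ Icc 0 T, s ≤ t →
        dist (u i s) (u i t) ≤ √|s - t| * M := fun i s hs t ht hst => by
      rw [dist_comm, dist_eq_norm,
        sub_eq_integral hT (control_intervalIntegrable hT (v i)) (h i).eq_add hs ht, abs_sub_comm,
        abs_of_nonneg (sub_nonneg.2 hst)]
      refine (norm_intervalIntegral_le (v i) hs.1 hst ht.2).trans ?_
      gcongr
      exact (hb i).time_le
    intro i s hs t ht
    rcases le_total s t with hst | hst
    · exact key i s hs t ht hst
    · rw [dist_comm, abs_sub_comm]; exact key i t ht s hs hst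
  obtain ⟨u₀, hu₀c, hu₀, hu₀M⟩ := exists_tendstoUniformlyOn hT U
    (fun i t ht => ⟨(h i).mean t ht, (hb i).sum_le t ht⟩) hH
  obtain ⟨v₀, hv₀⟩ := exists_weakTendsto U fun i => (hb i).time_le
  have hD : ∀ k, ∃ d : Control T, k ≤ 4 → WeakTendsto (fun i => D i k) U d := fun k => by
    by_cases hk : k ≤ 4
    · obtain ⟨d, hd⟩ := exists_weakTendsto U fun i => (hb i).deriv_le k hk
      exact ⟨d, fun _ => hd⟩
    · exact ⟨0, fun h => absurd h hk⟩
  choose D₀ hD₀ using hD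
  refine ⟨u₀, v₀, D₀, hu₀, hv₀, hD₀, hu₀c, hu₀M, fun t ht => ?_, ?_⟩
  · have h0 : (0 : ℝ) ∈ Icc 0 T := ⟨le_rfl, hT⟩
    have h1 : WeakTendsto (fun i => u i t - u i 0) U (u₀ t - u₀ 0) :=
      ((hu₀.tendsto_at ht).sub (hu₀.tendsto_at h0)).weakTendsto
    have h2 := hv₀.setIntegral (measurableSet_Ioc (a := (0 : ℝ)) (b := t))
    rw [← intervalIntegral_eq_setIntegral v₀ le_rfl ht.1 ht.2] at h2
    have h3 : (fun i => ∫ s in Ioc 0 t, v i s ∂(timeMeasure T)) = fun i => u i t - u i 0 := by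
      funext i
      rw [← intervalIntegral_eq_setIntegral (v i) le_rfl ht.1 ht.2, (h i).eq_add t ht,
        add_sub_cancel_left]
    rw [h3] at h2
    rw [← h1.unique h2]; abel
  · rw [ae_all_iff]
    intro k
    by_cases hk : k ≤ 4
    · have : ∀ᵐ s ∂(timeMeasure T), ∀ m : ℤ,
          fc m (D₀ k s) = (m * Complex.I) ^ k * fc m (u₀ s) := by
        rw [ae_all_iff]
        intro m
        refine (hD₀ k hk).ae_fc_eq (tendstoUniformlyOn_const_mul_fc hu₀ m _)
          (Eventually.of_forall fun i => ?_)
          (continuousOn_const.mul ((fc m).continuous.comp_continuousOn hu₀c))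
        filter_upwards [(h i).deriv] with s hs
        exact hs k hk m
      filter_upwards [this] with s hs _
      exact hs
    · exact Eventually.of_forall fun s h => absurd h hk

theorem limit_equation {f₀ v₀ e₀ : Control T} {u₀ : ℝ → L2} {D₀ : ℕ → Control T}
    (h : ∀ i, IsApprox (S i) ν α (f i) (u i) (v i) (D i) (e i))
    (hS : ∀ m, ∀ᶠ i in U, m ∈ S i) (hf : WeakTendsto f U f₀)
    (hu : TendstoUniformlyOn u u₀ U (Icc 0 T)) (hv : WeakTendsto v U v₀)
    (hD : ∀ k ≤ 4, WeakTendsto (fun i => D i k) U (D₀ k)) (he : WeakTendsto e U e₀)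
    (hc : ContinuousOn u₀ (Icc 0 T)) :
    ∀ᵐ s ∂(timeMeasure T), ∀ m : ℤ, fc m (v₀ s) + ν * fc m (D₀ 4 s) + fc m (D₀ 2 s)
      + m * Complex.I / 2 * sqc m (u₀ s) + α * fc m (e₀ s) = fc m (f₀ s) := by
  have expand : ∀ (m : ℤ) (a b c d g : Control T), ∀ᵐ s ∂(timeMeasure T),
      fc m ((a + ν • b + c + α • d - g : Control T) s)
        = fc m (a s) + ν * fc m (b s) + fc m (c s) + α * fc m (d s) - fc m (g s) := by
    intro m a b c d g
    filter_upwards [Lp.coeFn_sub (a + ν • b + c + α • d) g, Lp.coeFn_add (a + ν • b + c) (α • d),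
      Lp.coeFn_add (a + ν • b) c, Lp.coeFn_add a (ν • b), Lp.coeFn_smul ν b, Lp.coeFn_smul α d]
      with s h1 h2 h3 h4 h5 h6
    rw [h1, Pi.sub_apply, h2, Pi.add_apply, h3, Pi.add_apply, h4, Pi.add_apply, h5, h6,
      Pi.smul_apply, Pi.smul_apply]
    simp only [map_add, map_sub, map_smul, Complex.real_smul]
  rw [ae_all_iff]
  intro m
  -- All linear terms, the control included, form one weakly convergent family. Its `m`-th mode
  -- equals minus the convection term, which converges uniformly.
  have hw := ((((hv.add ((hD 4 le_rfl).const_smul ν)).add (hD 2 (by norm_num))).add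
    (he.const_smul α)).sub hf).ae_fc_eq (m := m)
    (tendstoUniformlyOn_sqc hu hc m (-(m * Complex.I / 2))) ((hS m).mono fun i hi => ?_)
    (continuousOn_const.mul ((continuous_sqc m).comp_continuousOn hc))
  · filter_upwards [hw, expand m v₀ (D₀ 4) (D₀ 2) e₀ f₀] with s h1 h2
    rw [h2] at h1
    linear_combination h1
  · filter_upwards [(h i).eqn, expand m (v i) (D i 4) (D i 2) (e i) (f i)] with s h1 h2
    rw [h2]
    linear_combination h1 m hi

end Limit

end CoupledKS

/-! ### From the differential equations to modal equations and back -/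

namespace CoupledKS

open Filter Topology ComplexConjugate

/-- Since u u_x is itself an L² element with known coefficients, both sides of the equation lie in
L² and are compared by uniqueness of Fourier coefficients. -/
theorem ae_eq_iff_fc_eq {ν α : ℝ} {f u v d₁ d₂ d₄ e : L2} (h0 : fc 0 u = 0)
    (h₁ : ∀ m : ℤ, fc m d₁ = m * Complex.I * fc m u)
    (h₂ : ∀ m : ℤ, fc m d₂ = (m * Complex.I) ^ 2 * fc m u) :
    (∀ᵐ x ∂circ, v x + ν * d₄ x + d₂ x + u x * d₁ x + α * e x = f x) ↔
      ∀ m : ℤ, fc m v + ν * fc m d₄ + fc m d₂ + m * Complex.I / 2 * sqc m u + α * fc m e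
        = fc m f := by
  obtain ⟨b, hb, hbc, -, -⟩ := exists_convection h0 h₁ h₂
  have hae : (v + ν • d₄ + d₂ + b + α • e : L2) =ᵐ[circ]
      fun x => v x + ν * d₄ x + d₂ x + u x * d₁ x + α * e x := by
    filter_upwards [hb, Lp.coeFn_add (v + ν • d₄ + d₂ + b) (α • e),
      Lp.coeFn_add (v + ν • d₄ + d₂) b, Lp.coeFn_add (v + ν • d₄) d₂, Lp.coeFn_add v (ν • d₄),
      Lp.coeFn_smul ν d₄, Lp.coeFn_smul α e] with x h1 h2 h3 h4 h5 h6 h7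
    rw [h2, Pi.add_apply, h3, Pi.add_apply, h4, Pi.add_apply, h5, Pi.add_apply, h6, h7, h1,
      Pi.smul_apply, Pi.smul_apply, smul_eq_mul, smul_eq_mul]
  have hfc : ∀ m : ℤ, fc m (v + ν • d₄ + d₂ + b + α • e) = fc m v + ν * fc m d₄ + fc m d₂
      + m * Complex.I / 2 * sqc m u + α * fc m e := fun m => by
    simp only [map_add, map_smul, Complex.real_smul, hbc]
  constructor
  · intro h m
    have : (v + ν • d₄ + d₂ + b + α • e : L2) = f := Lp.ext (hae.trans h)
    rw [← hfc, this]
  · intro h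
    have : (v + ν • d₄ + d₂ + b + α • e : L2) = f := eq_of_fc_eq fun m => by rw [hfc, h]
    rw [this] at hae
    exact hae.symm

theorem exists_control_of_memLp {T : ℝ} {v : ℝ → L2}
    (hv : MemLp v 2 (timeMeasure T)) : ∃ w : Control T, (w =ᵐ[timeMeasure T] v) ∧
      ∀ t ∈ Icc 0 T, ∫ s in (0 : ℝ)..t, w s = ∫ s in (0 : ℝ)..t, v s := by
  refine ⟨hv.toLp v, hv.coeFn_toLp, fun t ht => ?_⟩
  rw [intervalIntegral.integral_of_le ht.1, intervalIntegral.integral_of_le ht.1]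
  exact integral_congr_ae
    (ae_restrict_of_ae_restrict_of_subset (Ioc_subset_Ioc_right ht.2) hv.coeFn_toLp)

theorem exists_controls_of_isSpaceDeriv {T : ℝ} {u : ℝ → L2} {D : ℕ → ℝ → L2}
    (hD : ∀ k ≤ 4, IsSpaceDeriv T k u (D k)) : ∃ E : ℕ → Control T,
      (∀ k ≤ 4, E k =ᵐ[timeMeasure T] D k) ∧
      ∀ᵐ s ∂(timeMeasure T), ∀ k ≤ 4, ∀ m : ℤ, fc m (E k s) = (m * Complex.I) ^ k * fc m (u s) := by
  have : ∀ k, ∃ w : Control T, k ≤ 4 → w =ᵐ[timeMeasure T] D k := fun k => by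
    by_cases hk : k ≤ 4
    · exact ⟨(hD k hk).1.toLp _, fun _ => (hD k hk).1.coeFn_toLp⟩
    · exact ⟨0, fun h => absurd h hk⟩
  choose E hE using this
  refine ⟨E, hE, ?_⟩
  rw [ae_all_iff]
  intro k
  by_cases hk : k ≤ 4
  · filter_upwards [hE k hk, (hD k hk).2] with s h1 h2 _ m
    rw [h1, h2.fc_eq]
  · exact Eventually.of_forall fun s h => absurd h hk

theorem IsState.exists_isApprox {ν α₁ α₂ T : ℝ} {u₀₁ u₀₂ : L2} {f₁ f₂ : Control T}
    {u₁ u₂ : ℝ → L2} (h : IsState ν α₁ α₂ T u₀₁ u₀₂ f₁ f₂ u₁ u₂) :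
    ∃ (v₁ v₂ : Control T) (D₁ D₂ : ℕ → Control T),
      IsApprox univ ν α₁ f₁ u₁ v₁ D₁ (D₂ 2) ∧ IsApprox univ ν α₂ f₂ u₂ v₂ D₂ (D₁ 2) := by
  obtain ⟨-, -, hH, w₁, w₂, E₁, E₂, hw₁, hw₂, hE, heq⟩ := h
  obtain ⟨v₁, hv₁, hvi₁⟩ := exists_control_of_memLp hw₁.1
  obtain ⟨v₂, hv₂, hvi₂⟩ := exists_control_of_memLp hw₂.1
  obtain ⟨D₁, hD₁, hd₁⟩ := exists_controls_of_isSpaceDeriv fun k hk => (hE k hk).1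
  obtain ⟨D₂, hD₂, hd₂⟩ := exists_controls_of_isSpaceDeriv fun k hk => (hE k hk).2
  have hm₁ : ∀ t ∈ Icc 0 T, fc 0 (u₁ t) = 0 := fun t ht => (hasZeroMean_iff _).1 (hH t ht).1.1
  have hm₂ : ∀ t ∈ Icc 0 T, fc 0 (u₂ t) = 0 := fun t ht => (hasZeroMean_iff _).1 (hH t ht).2.1
  refine ⟨v₁, v₂, D₁, D₂, ⟨fun t ht => ?_, hm₁, hd₁, by simp, ?_⟩,
    ⟨fun t ht => ?_, hm₂, hd₂, by simp, ?_⟩⟩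
  · rw [hvi₁ t ht]; exact hw₁.2 t ht
  · filter_upwards [heq, hv₁, hD₁ 1 (by norm_num), hD₁ 2 (by norm_num), hD₁ 4 le_rfl,
      hD₂ 2 (by norm_num), hd₁, ae_restrict_mem measurableSet_Ioc] with s h1 h2 h3 h4 h5 h6 h7 hs m _
    refine (ae_eq_iff_fc_eq (d₁ := D₁ 1 s) (hm₁ s (Ioc_subset_Icc_self hs))
      (by simpa using h7 1 (by norm_num)) (h7 2 (by norm_num))).1 ?_ m
    rw [h2, h3, h4, h5, h6]
    exact h1.mono fun x hx => hx.1
  · rw [hvi₂ t ht]; exact hw₂.2 t ht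
  · filter_upwards [heq, hv₂, hD₂ 1 (by norm_num), hD₂ 2 (by norm_num), hD₂ 4 le_rfl,
      hD₁ 2 (by norm_num), hd₂, ae_restrict_mem measurableSet_Ioc] with s h1 h2 h3 h4 h5 h6 h7 hs m _
    refine (ae_eq_iff_fc_eq (d₁ := D₂ 1 s) (hm₂ s (Ioc_subset_Icc_self hs))
      (by simpa using h7 1 (by norm_num)) (h7 2 (by norm_num))).1 ?_ m
    rw [h2, h3, h4, h5, h6]
    exact h1.mono fun x hx => hx.2

theorem isState_of_isApprox {ν α₁ α₂ T M : ℝ} {u₀₁ u₀₂ : L2} {f₁ f₂ : Control T}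
    {u₁ u₂ : ℝ → L2} {v₁ v₂ : Control T} {D₁ D₂ : ℕ → Control T}
    (h₁ : IsApprox univ ν α₁ f₁ u₁ v₁ D₁ (D₂ 2)) (h₂ : IsApprox univ ν α₂ f₂ u₂ v₂ D₂ (D₁ 2))
    (hM₁ : ∀ t ∈ Icc 0 T, u₁ t ∈ sobolevBall M) (hM₂ : ∀ t ∈ Icc 0 T, u₂ t ∈ sobolevBall M)
    (h0₁ : u₁ 0 = u₀₁) (h0₂ : u₂ 0 = u₀₂) :
    IsState ν α₁ α₂ T u₀₁ u₀₂ f₁ f₂ u₁ u₂ := by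
  refine ⟨h0₁, h0₂, fun t ht => ⟨memHdot_two (hM₁ t ht), memHdot_two (hM₂ t ht)⟩, v₁, v₂,
    fun k => D₁ k, fun k => D₂ k, ⟨Lp.memLp _, h₁.eq_add⟩, ⟨Lp.memLp _, h₂.eq_add⟩,
    fun k hk => ⟨⟨Lp.memLp _, ?_⟩, ⟨Lp.memLp _, ?_⟩⟩, ?_⟩
  · filter_upwards [h₁.deriv] with s hs
    exact isWeakDeriv_iff.2 (hs k hk)
  · filter_upwards [h₂.deriv] with s hs
    exact isWeakDeriv_iff.2 (hs k hk)
  · filter_upwards [h₁.slice, h₂.slice] with s e₁ e₂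
    have a₁ := (ae_eq_iff_fc_eq e₁.mean e₁.deriv₁ e₁.deriv₂).2 fun m => e₁.eqn m (mem_univ m)
    have a₂ := (ae_eq_iff_fc_eq e₂.mean e₂.deriv₁ e₂.deriv₂).2 fun m => e₂.eqn m (mem_univ m)
    filter_upwards [a₁, a₂] with x b₁ b₂
    exact ⟨b₁, b₂⟩

/-- Limits of bounded sequences of approximate solutions are states. -/
theorem exists_limit_state {ι : Type*} {U : Ultrafilter ι} {T M K ν α₁ α₂ : ℝ} (hT : 0 ≤ T)
    {S : ι → Set ℤ} {f₁ f₂ : ι → Control T} {u₁ u₂ : ι → ℝ → L2} {v₁ v₂ : ι → Control T}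
    {D₁ D₂ : ι → ℕ → Control T} {u₀₁ u₀₂ : L2}
    (h₁ : ∀ i, IsApprox (S i) ν α₁ (f₁ i) (u₁ i) (v₁ i) (D₁ i) (D₂ i 2))
    (h₂ : ∀ i, IsApprox (S i) ν α₂ (f₂ i) (u₂ i) (v₂ i) (D₂ i) (D₁ i 2))
    (hb₁ : ∀ i, IsBounded M (u₁ i) (v₁ i) (D₁ i)) (hb₂ : ∀ i, IsBounded M (u₂ i) (v₂ i) (D₂ i))
    (hf₁ : ∀ i, ‖f₁ i‖ ≤ K) (hf₂ : ∀ i, ‖f₂ i‖ ≤ K) (hS : ∀ m, ∀ᶠ i in U, m ∈ S i)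
    (h0₁ : ∀ m, ∀ᶠ i in U, fc m (u₁ i 0) = fc m u₀₁)
    (h0₂ : ∀ m, ∀ᶠ i in U, fc m (u₂ i 0) = fc m u₀₂) :
    ∃ (F₁ F₂ : Control T) (w₁ w₂ : ℝ → L2), WeakTendsto f₁ U F₁ ∧ WeakTendsto f₂ U F₂ ∧
      TendstoUniformlyOn u₁ w₁ U (Icc 0 T) ∧ TendstoUniformlyOn u₂ w₂ U (Icc 0 T) ∧
      IsState ν α₁ α₂ T u₀₁ u₀₂ F₁ F₂ w₁ w₂ := by
  have h0 : (0 : ℝ) ∈ Icc 0 T := ⟨le_rfl, hT⟩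
  obtain ⟨F₁, hF₁⟩ := exists_weakTendsto U hf₁
  obtain ⟨F₂, hF₂⟩ := exists_weakTendsto U hf₂
  obtain ⟨w₁, y₁, E₁, hw₁, hy₁, hE₁, hc₁, hM₁, ha₁, hd₁⟩ := exists_limit_component (U := U) hT h₁ hb₁
  obtain ⟨w₂, y₂, E₂, hw₂, hy₂, hE₂, hc₂, hM₂, ha₂, hd₂⟩ := exists_limit_component (U := U) hT h₂ hb₂
  have q₁ := limit_equation h₁ hS hF₁ hw₁ hy₁ hE₁ (hE₂ 2 (by norm_num)) hc₁
  have q₂ := limit_equation h₂ hS hF₂ hw₂ hy₂ hE₂ (hE₁ 2 (by norm_num)) hc₂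
  have init : ∀ {u : ι → ℝ → L2} {w : ℝ → L2} {u₀ : L2}, TendstoUniformlyOn u w U (Icc 0 T) →
      (∀ m, ∀ᶠ i in U, fc m (u i 0) = fc m u₀) → w 0 = u₀ := fun hu h => eq_of_fc_eq fun m =>
    tendsto_nhds_unique (((fc m).continuous.tendsto _).comp (hu.tendsto_at h0))
      (tendsto_const_nhds.congr' ((h m).mono fun i hi => hi.symm))
  refine ⟨F₁, F₂, w₁, w₂, hF₁, hF₂, hw₁, hw₂, isState_of_isApprox
    (v₁ := y₁) (v₂ := y₂) (D₁ := E₁) (D₂ := E₂)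
    ⟨ha₁, fun t ht => (hM₁ t ht).1, hd₁, by simp, q₁.mono fun s hs m _ => hs m⟩
    ⟨ha₂, fun t ht => (hM₂ t ht).1, hd₂, by simp, q₂.mono fun s hs m _ => hs m⟩ hM₁ hM₂
    (init hw₁ h0₁) (init hw₂ h0₂)⟩

end CoupledKS

/-! ### Galerkin approximation and existence of states -/

namespace CoupledKS

open Filter Topology ComplexConjugate NNReal

/-- The nonzero modes up to order `N`. -/
noncomputable def galerkinModes (N : ℕ) : Finset ℤ := (Finset.Icc (-(N : ℤ)) N).erase 0

theorem neg_mem_galerkinModes {N : ℕ} {m : ℤ} : -m ∈ galerkinModes N ↔ m ∈ galerkinModes N := by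
  simp only [galerkinModes, Finset.mem_erase, Finset.mem_Icc]
  omega

theorem norm_sq_eq_sum_of_modes {u : L2} {F : Finset ℤ} (h : ∀ m ∉ F, fc m u = 0) :
    ‖u‖ ^ 2 = ∑ m ∈ F, ‖fc m u‖ ^ 2 :=
  (hasSum_fc_sq u).unique (hasSum_sum_of_ne_finset_zero fun m hm => by simp [h m hm])

/-- The projections to the modes up to order `N` of the space derivatives and of the nonlinearity. -/
structure IsGalerkin (N : ℕ) (A : ℕ → L2 →L[ℝ] L2) (Q : L2 → L2) : Prop where
  lin : ∀ k u m, fc m (A k u) = if m ∈ galerkinModes N then (m * Complex.I) ^ k * fc m u else 0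
  quad : ∀ u m, fc m (Q u) = if m ∈ galerkinModes N then m * Complex.I / 2 * sqc m u else 0

theorem exists_isGalerkin (N : ℕ) : ∃ A Q, IsGalerkin N A Q := by
  have hA : ∀ k : ℕ, ∃ A : L2 →L[ℝ] L2, ∀ u m, fc m (A u)
      = (if m ∈ galerkinModes N then ((m : ℂ) * Complex.I) ^ k else 0) * fc m u := fun k => by
    refine exists_multiplier _ (fun m => ?_)
      (C := ∑ m ∈ galerkinModes N, ‖((m : ℂ) * Complex.I) ^ k‖) fun m => ?_
    · simp only [neg_mem_galerkinModes]
      split_ifs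
      · rw [map_pow, map_mul, Complex.conj_I, map_intCast]
        congr 1; push_cast; ring
      · simp
    · split_ifs with hm
      · exact Finset.single_le_sum (f := fun m : ℤ => ‖((m : ℂ) * Complex.I) ^ k‖)
          (fun _ _ => norm_nonneg _) hm
      · rw [norm_zero]; positivity
  have hQ : ∀ u : L2, ∃ w : L2, ∀ m, fc m w
      = if m ∈ galerkinModes N then (m : ℂ) * Complex.I / 2 * sqc m u else 0 := fun u => by
    refine exists_fc_eq _ (fun m => ?_) ?_
    · simp only [neg_mem_galerkinModes]
      split_ifs
      · rw [sqc_neg, map_mul, map_div₀, map_mul, Complex.conj_I, map_intCast, Complex.conj_ofNat]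
        congr 1; push_cast; ring
      · simp
    · refine summable_of_ne_finset_zero (s := galerkinModes N) fun m hm => ?_
      simp [hm]
  choose A hA using hA
  choose Q hQ using hQ
  exact ⟨A, Q, fun k u m => by rw [hA, ite_mul, zero_mul], hQ⟩

namespace IsGalerkin

variable {N : ℕ} {A : ℕ → L2 →L[ℝ] L2} {Q : L2 → L2}

theorem exists_quad_lipschitz (h : IsGalerkin N A Q) :
    ∃ κ : ℝ, 0 ≤ κ ∧ ∀ u w, ‖Q u - Q w‖ ≤ κ * (‖u - w‖ * ‖u + w‖) := by
  set c : ℝ := ∑ m ∈ galerkinModes N, ‖(m : ℂ) * Complex.I / 2‖ ^ 2 with hc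
  have hc0 : 0 ≤ c := by positivity
  refine ⟨√c, Real.sqrt_nonneg _, fun u w => ?_⟩
  rw [← sq_le_sq₀ (norm_nonneg _) (by positivity), mul_pow, Real.sq_sqrt hc0,
    norm_sq_eq_sum_of_modes (F := galerkinModes N) fun m hm => by simp [h.quad, hm], hc,
    Finset.sum_mul]
  refine Finset.sum_le_sum fun m hm => ?_
  rw [map_sub, h.quad, h.quad, if_pos hm, if_pos hm, ← mul_sub, norm_mul, mul_pow]
  gcongr
  exact norm_sqc_sub_le m u w

/-- One component of the vector field of the Galerkin system. -/
noncomputable def _root_.CoupledKS.galerkinField (A : ℕ → L2 →L[ℝ] L2) (Q : L2 → L2) (ν α : ℝ)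
    (u w : L2) : L2 := -(ν • A 4 u) - A 2 u - Q (A 0 u) - α • A 2 w

theorem fc_field (h : IsGalerkin N A Q) (ν α : ℝ) (u w : L2) (m : ℤ) :
    fc m (galerkinField A Q ν α u w) = -(ν * fc m (A 4 u)) - fc m (A 2 u)
      - (if m ∈ galerkinModes N then m * Complex.I / 2 * sqc m (A 0 u) else 0)
      - α * fc m (A 2 w) := by
  simp only [galerkinField, map_sub, map_neg, map_smul, Complex.real_smul, h.quad]

theorem fc_field_of_notMem (h : IsGalerkin N A Q) (ν α : ℝ) (u w : L2) {m : ℤ}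
    (hm : m ∉ galerkinModes N) : fc m (galerkinField A Q ν α u w) = 0 := by
  rw [h.fc_field]
  simp [h.lin, hm]

theorem fc_proj (h : IsGalerkin N A Q) (u : L2) (m : ℤ) :
    fc m (A 0 u) = if m ∈ galerkinModes N then fc m u else 0 := by simp [h.lin]

theorem norm_proj_le (h : IsGalerkin N A Q) (u : L2) : ‖A 0 u‖ ≤ ‖u‖ := by
  rw [← sq_le_sq₀ (norm_nonneg _) (norm_nonneg _)]
  refine norm_sq_le_of_sum_le fun F => (Finset.sum_le_sum fun m _ => ?_).trans (sum_fc_sq_le u F)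
  rw [h.fc_proj]
  split_ifs
  · exact le_rfl
  · simp

/-- The Galerkin equation is posed on all of L², not on a finite-dimensional subspace. This lemma
permits replacing the state by its projection when pairing with the vector field. -/
theorem inner_proj (h : IsGalerkin N A Q) {u v : L2} (hv : ∀ m ∉ galerkinModes N, fc m v = 0) :
    inner ℝ u v = inner ℝ (A 0 u) v := by
  refine (hasSum_inner_fc u v).unique ?_
  convert! hasSum_inner_fc (A 0 u) v using 1
  funext m
  by_cases hm : m ∈ galerkinModes N
  · rw [h.fc_proj, if_pos hm]
  · rw [hv m hm, inner_zero_right, inner_zero_right]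

theorem zero_notMem : (0 : ℤ) ∉ galerkinModes N := by simp [galerkinModes]

theorem isSlice (h : IsGalerkin N A Q) (ν α : ℝ) (u w : L2) :
    IsSlice (galerkinModes N : Set ℤ) ν α 0 (A 0 u) (galerkinField A Q ν α u w)
      (A 1 u) (A 2 u) (A 4 u) (A 2 w) where
  mean := by rw [h.fc_proj, if_neg zero_notMem]
  deriv₁ m := by simp only [h.lin]; split_ifs <;> simp
  deriv₂ m := by simp only [h.lin]; split_ifs <;> simp
  deriv₄ m := by simp only [h.lin]; split_ifs <;> simp
  out m hm := by
    have hm' : m ∉ galerkinModes N := hm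
    exact ⟨by rw [h.fc_proj, if_neg hm'], h.fc_field_of_notMem ν α u w hm'⟩
  eqn m hm := by
    have hm' : m ∈ galerkinModes N := hm
    rw [h.fc_field, if_pos hm', map_zero]
    ring

/-- The vector field of the Galerkin system. -/
noncomputable def _root_.CoupledKS.galerkinPair (A : ℕ → L2 →L[ℝ] L2) (Q : L2 → L2)
    (ν α₁ α₂ : ℝ) (x : L2Pair) : L2Pair :=
  WithLp.toLp 2 (galerkinField A Q ν α₁ (pairFst x) (pairSnd x),
    galerkinField A Q ν α₂ (pairSnd x) (pairFst x))

theorem exists_field_lipschitz (h : IsGalerkin N A Q) (ν α : ℝ) (B₁ B₂ : L2Pair →L[ℝ] L2) (R : ℝ) :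
    ∃ K : ℝ≥0, LipschitzOnWith K (fun x => galerkinField A Q ν α (B₁ x) (B₂ x))
      (Metric.closedBall 0 R) := by
  obtain ⟨κ, hκ0, hκ⟩ := h.exists_quad_lipschitz
  set L : L2Pair →L[ℝ] L2 := -(ν • (A 4).comp B₁) - (A 2).comp B₁ - α • (A 2).comp B₂ with hL
  set P : L2Pair →L[ℝ] L2 := (A 0).comp B₁ with hP
  set K : ℝ := ‖L‖ + κ * (‖P‖ * (‖P‖ * (2 * |R|))) with hK
  have hK0 : 0 ≤ K := by positivity
  refine ⟨⟨K, hK0⟩, LipschitzOnWith.of_dist_le_mul fun x hx y hy => ?_⟩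
  rw [mem_closedBall_zero_iff] at hx hy
  have e : galerkinField A Q ν α (B₁ x) (B₂ x) - galerkinField A Q ν α (B₁ y) (B₂ y)
      = L (x - y) - (Q (P x) - Q (P y)) := by
    simp only [galerkinField, hL, hP, sub_apply, neg_apply, smul_apply,
      ContinuousLinearMap.comp_apply, map_sub]
    abel
  rw [dist_eq_norm, dist_eq_norm, e]
  refine (norm_sub_le _ _).trans ?_
  have h1 : ‖L (x - y)‖ ≤ ‖L‖ * ‖x - y‖ := L.le_opNorm _
  have h2 : ‖Q (P x) - Q (P y)‖ ≤ κ * (‖P‖ * ‖x - y‖ * (‖P‖ * (2 * |R|))) := by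
    refine (hκ _ _).trans ?_
    rw [← map_sub, ← map_add]
    have h3 : ‖x + y‖ ≤ 2 * |R| := by
      refine (norm_add_le _ _).trans ?_
      linarith [le_abs_self R]
    gcongr
    · exact P.le_opNorm _
    · exact (P.le_opNorm _).trans (by gcongr)
  calc _ ≤ ‖L‖ * ‖x - y‖ + κ * (‖P‖ * ‖x - y‖ * (‖P‖ * (2 * |R|))) := add_le_add h1 h2
    _ = K * ‖x - y‖ := by rw [hK]; ring

theorem exists_pair_lipschitz (h : IsGalerkin N A Q) (ν α₁ α₂ R : ℝ) :
    ∃ K : ℝ≥0, LipschitzOnWith K (galerkinPair A Q ν α₁ α₂) (Metric.closedBall 0 R) := by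
  obtain ⟨K₁, hK₁⟩ := h.exists_field_lipschitz ν α₁ pairFst pairSnd R
  obtain ⟨K₂, hK₂⟩ := h.exists_field_lipschitz ν α₂ pairSnd pairFst R
  have e : galerkinPair A Q ν α₁ α₂ = fun x =>
      pairInl (galerkinField A Q ν α₁ (pairFst x) (pairSnd x))
        + pairInr (galerkinField A Q ν α₂ (pairSnd x) (pairFst x)) :=
    funext fun x => toLp_eq_add _ _
  rw [e]
  exact ⟨_, (pairInl.lipschitz.comp_lipschitzOnWith hK₁).add
    (pairInr.lipschitz.comp_lipschitzOnWith hK₂)⟩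

/-- Because the nonlinearity is evaluated at the projection `A 0 u`, the projected state and the
field satisfy the relations of `IsSlice` with zero control. The energy inequality then yields
dissipativity on the whole space. -/
theorem inner_pair_le (h : IsGalerkin N A Q) {ν α₁ α₂ : ℝ} (hν : 0 < ν) (x : L2Pair) :
    inner ℝ x (galerkinPair A Q ν α₁ α₂ x)
      ≤ (4 * (1 + |α₁| + |α₂|) ^ 2 / ν + 1) * ‖x‖ ^ 2 := by
  set C := 4 * (1 + |α₁| + |α₂|) ^ 2 / ν + 1 with hC
  have hC0 : 0 ≤ C := by positivity
  have h₁ := (h.isSlice ν α₁ (pairFst x) (pairSnd x)).inner_le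
  have h₂ := (h.isSlice ν α₂ (pairSnd x) (pairFst x)).inner_le
  have key := energy_arith hν (norm_nonneg _) (norm_nonneg _) (norm_nonneg _) (norm_nonneg _) rfl
    h₁ h₂
  rw [← h.inner_proj fun m hm => h.fc_field_of_notMem _ _ _ _ hm,
    ← h.inner_proj fun m hm => h.fc_field_of_notMem _ _ _ _ hm, ← hC, norm_zero] at key
  have e1 : inner ℝ x (galerkinPair A Q ν α₁ α₂ x)
      = inner ℝ (pairFst x) (galerkinField A Q ν α₁ (pairFst x) (pairSnd x))
        + inner ℝ (pairSnd x) (galerkinField A Q ν α₂ (pairSnd x) (pairFst x)) := by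
    conv_lhs => rw [← toLp_pairFst_pairSnd x]
    exact inner_toLp _ _ _ _
  have e2 : ‖x‖ ^ 2 = ‖pairFst x‖ ^ 2 + ‖pairSnd x‖ ^ 2 := by
    conv_lhs => rw [← toLp_pairFst_pairSnd x]
    exact norm_sq_toLp _ _
  have e3 : ‖A 0 (pairFst x)‖ ^ 2 + ‖A 0 (pairSnd x)‖ ^ 2 ≤ ‖x‖ ^ 2 := by
    rw [e2]
    have := h.norm_proj_le (pairFst x)
    have := h.norm_proj_le (pairSnd x)
    gcongr
  have e4 : C * (‖A 0 (pairFst x)‖ ^ 2 + ‖A 0 (pairSnd x)‖ ^ 2) ≤ C * ‖x‖ ^ 2 := by gcongr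
  have e5 : 0 ≤ ν * (‖A 2 (pairFst x)‖ ^ 2 + ‖A 2 (pairSnd x)‖ ^ 2) := by positivity
  have e6 : 0 ≤ C * ‖x‖ ^ 2 := by positivity
  rw [e1]
  linarith

end IsGalerkin

theorem memLp_of_continuousOn {T : ℝ} {c : ℝ → L2} (hc : ContinuousOn c (Icc 0 T)) :
    MemLp c 2 (timeMeasure T) := by
  obtain ⟨M, hM⟩ := isCompact_Icc.exists_bound_of_continuousOn hc
  refine MemLp.of_bound
    ((hc.mono Ioc_subset_Icc_self).aestronglyMeasurable measurableSet_Ioc) M ?_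
  filter_upwards [ae_restrict_mem measurableSet_Ioc] with s hs
  exact hM s (Ioc_subset_Icc_self hs)

/-- A continuous solution of one component of the Galerkin system is an approximate solution. -/
theorem IsGalerkin.exists_isApprox {N : ℕ} {A : ℕ → L2 →L[ℝ] L2} {Q : L2 → L2}
    (h : IsGalerkin N A Q) {ν α T : ℝ} (hT : 0 ≤ T) {f : Control T}
    (hf : ∀ᵐ s ∂(timeMeasure T), fc 0 (f s) = 0) {u w : ℝ → L2} {u₀ : L2}
    (hu : ContinuousOn u (Icc 0 T)) (hw : ContinuousOn w (Icc 0 T)) (hu0 : u 0 = A 0 u₀)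
    (heq : ∀ t ∈ Icc 0 T,
      u t = A 0 u₀ + ∫ s in (0 : ℝ)..t, (galerkinField A Q ν α (u s) (w s) + A 0 (f s))) :
    ∃ (v : Control T) (D : ℕ → Control T), (∀ k, D k =ᵐ[timeMeasure T] fun s => A k (u s)) ∧
      ∀ e : Control T, (e =ᵐ[timeMeasure T] fun s => A 2 (w s)) →
        IsApprox {m | |m| ≤ N} ν α f u v D e := by
  have h0 : (0 : ℝ) ∈ Icc 0 T := ⟨le_rfl, hT⟩
  have hQc : Continuous Q := by
    obtain ⟨κ, hκ0, hκ⟩ := h.exists_quad_lipschitz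
    rw [continuous_iff_continuousAt]
    intro x
    rw [ContinuousAt, tendsto_iff_norm_sub_tendsto_zero]
    refine squeeze_zero (fun _ => norm_nonneg _) (fun y => hκ y x) ?_
    have hc : Continuous fun y : L2 => κ * (‖y - x‖ * ‖y + x‖) := by fun_prop
    simpa using hc.tendsto x
  have hGc : ContinuousOn (fun s => galerkinField A Q ν α (u s) (w s)) (Icc 0 T) := by
    have hA : ∀ (k : ℕ) {z : ℝ → L2}, ContinuousOn z (Icc 0 T) →
        ContinuousOn (fun s => A k (z s)) (Icc 0 T) := fun k z hz =>
      (A k).continuous.comp_continuousOn hz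
    exact (((hA 4 hu).const_smul ν).neg.sub (hA 2 hu)).sub
      (hQc.comp_continuousOn (hA 0 hu)) |>.sub ((hA 2 hw).const_smul α)
  have hgm : MemLp (fun s => galerkinField A Q ν α (u s) (w s) + A 0 (f s)) 2 (timeMeasure T) :=
    (memLp_of_continuousOn hGc).add ((A 0).comp_memLp' (Lp.memLp f))
  have hgi : IntervalIntegrable (fun s => galerkinField A Q ν α (u s) (w s) + A 0 (f s))
      volume 0 T :=
    (intervalIntegrable_iff_integrableOn_Ioc_of_le hT).2 (hgm.integrable (by norm_num))
  have hfcg : ∀ s, ∀ m ∉ galerkinModes N,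
      fc m (galerkinField A Q ν α (u s) (w s) + A 0 (f s)) = 0 := fun s m hm => by
    rw [map_add, h.fc_field_of_notMem _ _ _ _ hm, h.fc_proj, if_neg hm, add_zero]
  have hfcu : ∀ t ∈ Icc 0 T, ∀ m ∉ galerkinModes N, fc m (u t) = 0 := fun t ht m hm => by
    rw [heq t ht, map_add, h.fc_proj, if_neg hm, zero_add,
      ← (fc m).intervalIntegral_comp_comm (intervalIntegrable_of_mem hT hgi h0 ht)]
    simp only [hfcg _ m hm, intervalIntegral.integral_zero]
  obtain ⟨v, hv, hvi⟩ := exists_control_of_memLp hgm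
  have hD : ∀ k, ∃ d : Control T, d =ᵐ[timeMeasure T] fun s => A k (u s) := fun k =>
    ⟨_, (memLp_of_continuousOn ((A k).continuous.comp_continuousOn hu)).coeFn_toLp⟩
  choose D hD using hD
  refine ⟨v, D, hD, fun e he => ⟨fun t ht => ?_, fun t ht => hfcu t ht 0 IsGalerkin.zero_notMem,
    ?_, ?_, ?_⟩⟩
  · rw [hvi t ht, hu0, heq t ht]
  · have hall : ∀ᵐ s ∂(timeMeasure T), ∀ k, D k s = A k (u s) := ae_all_iff.2 hD
    filter_upwards [hall, ae_restrict_mem measurableSet_Ioc] with s hs hsT k _ m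
    rw [hs, h.lin]
    split_ifs with hm
    · rfl
    · rw [hfcu s (Ioc_subset_Icc_self hsT) m hm, mul_zero]
  · filter_upwards [hv, ae_restrict_mem measurableSet_Ioc] with s hs hsT m hm
    have hm' : m ∉ galerkinModes N := fun hmem => hm (by
      have := Finset.mem_Icc.1 (Finset.mem_of_mem_erase hmem)
      exact abs_le.2 this)
    exact ⟨hfcu s (Ioc_subset_Icc_self hsT) m hm', by rw [hs]; exact hfcg s m hm'⟩
  · filter_upwards [hv, hD 4, hD 2, he, hf, ae_restrict_mem measurableSet_Ioc]
      with s h1 h2 h3 h4 h5 hsT m hm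
    rw [h1, h2, h3, h4]
    -- The zero mode is not a Galerkin mode but belongs to `{m | |m| ≤ N}`, so that every mode is
    -- eventually covered. Its equation reads 0 = 0 because the control has mean zero.
    by_cases hm0 : m = 0
    · subst hm0
      rw [hfcg s 0 IsGalerkin.zero_notMem, h5]
      simp [h.lin, IsGalerkin.zero_notMem]
    · have hm' : m ∈ galerkinModes N := Finset.mem_erase.2 ⟨hm0, Finset.mem_Icc.2 (abs_le.1 hm)⟩
      have hPu : A 0 (u s) = u s := eq_of_fc_eq fun n => by
        rw [h.fc_proj]
        split_ifs with hn
        · rfl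
        · rw [hfcu s (Ioc_subset_Icc_self hsT) n hn]
      rw [map_add, h.fc_field, if_pos hm', h.fc_proj, if_pos hm', hPu]
      ring

theorem exists_galerkin_solution {ν α₁ α₂ T : ℝ} (hν : 0 < ν) (hT : 0 ≤ T) {f₁ f₂ : Control T}
    (hf₁ : ∀ᵐ s ∂(timeMeasure T), fc 0 (f₁ s) = 0) (hf₂ : ∀ᵐ s ∂(timeMeasure T), fc 0 (f₂ s) = 0)
    (u₀₁ u₀₂ : L2) (N : ℕ) :
    ∃ (u₁ u₂ : ℝ → L2) (v₁ v₂ : Control T) (D₁ D₂ : ℕ → Control T),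
      IsApprox {m | |m| ≤ N} ν α₁ f₁ u₁ v₁ D₁ (D₂ 2) ∧
      IsApprox {m | |m| ≤ N} ν α₂ f₂ u₂ v₂ D₂ (D₁ 2) ∧
      (∀ m, fc m (u₁ 0) = if m ∈ galerkinModes N then fc m u₀₁ else 0) ∧
      ∀ m, fc m (u₂ 0) = if m ∈ galerkinModes N then fc m u₀₂ else 0 := by
  obtain ⟨A, Q, h⟩ := exists_isGalerkin N
  have hgm : MemLp (fun s => (WithLp.toLp 2 (A 0 (f₁ s), A 0 (f₂ s)) : L2Pair)) 2
      (timeMeasure T) := by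
    simp only [toLp_eq_add]
    exact (pairInl.comp_memLp' ((A 0).comp_memLp' (Lp.memLp f₁))).add
      (pairInr.comp_memLp' ((A 0).comp_memLp' (Lp.memLp f₂)))
  obtain ⟨x, hxc, hx0, hx⟩ := exists_solution_of_dissipative
    (h.exists_pair_lipschitz ν α₁ α₂) (by positivity) (h.inner_pair_le hν) hT hgm
    (WithLp.toLp 2 (A 0 u₀₁, A 0 u₀₂))
  have hGc : ContinuousOn (fun s => galerkinPair A Q ν α₁ α₂ (x s)) (Icc 0 T) := by
    obtain ⟨M, hM⟩ := isCompact_Icc.exists_bound_of_continuousOn hxc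
    obtain ⟨K, hK⟩ := h.exists_pair_lipschitz ν α₁ α₂ M
    exact hK.continuousOn.comp hxc fun t ht => mem_closedBall_zero_iff.2 (hM t ht)
  have hint : ∀ t ∈ Icc 0 T, IntervalIntegrable (fun s => galerkinPair A Q ν α₁ α₂ (x s)
      + WithLp.toLp 2 (A 0 (f₁ s), A 0 (f₂ s))) volume 0 t := fun t ht => by
    refine intervalIntegrable_of_mem hT (IntervalIntegrable.add ?_ ?_) ⟨le_rfl, hT⟩ ht
    · exact ContinuousOn.intervalIntegrable (by rwa [uIcc_of_le hT])
    · exact (intervalIntegrable_iff_integrableOn_Ioc_of_le hT).2 (hgm.integrable (by norm_num))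
  have hc₁ : ContinuousOn (fun t => pairFst (x t)) (Icc 0 T) :=
    pairFst.continuous.comp_continuousOn hxc
  have hc₂ : ContinuousOn (fun t => pairSnd (x t)) (Icc 0 T) :=
    pairSnd.continuous.comp_continuousOn hxc
  obtain ⟨v₁, D₁, hD₁, hA₁⟩ := h.exists_isApprox (u₀ := u₀₁) hT hf₁ hc₁ hc₂ (by rw [hx0]; rfl)
    fun t ht => by
      rw [hx t ht, map_add, ← pairFst.intervalIntegral_comp_comm (hint t ht)]
      rfl
  obtain ⟨v₂, D₂, hD₂, hA₂⟩ := h.exists_isApprox (u₀ := u₀₂) hT hf₂ hc₂ hc₁ (by rw [hx0]; rfl)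
    fun t ht => by
      rw [hx t ht, map_add, ← pairSnd.intervalIntegral_comp_comm (hint t ht)]
      rfl
  refine ⟨_, _, v₁, v₂, D₁, D₂, hA₁ _ (hD₂ 2), hA₂ _ (hD₁ 2), fun m => ?_, fun m => ?_⟩
  · rw [← h.fc_proj, hx0]; rfl
  · rw [← h.fc_proj, hx0]; rfl

theorem exists_mem_sobolevBall {u : L2} (hu : MemHdot 2 u) : ∃ K, u ∈ sobolevBall K := by
  obtain ⟨d, hd⟩ := hu.2 2 le_rfl
  refine ⟨‖d‖ ^ 2, (hasZeroMean_iff u).1 hu.1, fun F => ?_⟩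
  refine le_trans (le_of_eq (Finset.sum_congr rfl fun m _ => ?_)) (sum_fc_sq_le d F)
  rw [hd.fc_eq, norm_mul, norm_pow, norm_mul, Complex.norm_I, mul_one, Complex.norm_intCast,
    mul_pow, sq_abs]
  ring

/-- Every control with mean zero has a state. -/
theorem exists_isState {ν α₁ α₂ T : ℝ} (hν : 0 < ν) (hT : 0 ≤ T) {f₁ f₂ : Control T}
    (hf₁ : ∀ᵐ s ∂(timeMeasure T), HasZeroMean (f₁ s))
    (hf₂ : ∀ᵐ s ∂(timeMeasure T), HasZeroMean (f₂ s)) {u₀₁ u₀₂ : L2} (hu₀₁ : MemHdot 2 u₀₁)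
    (hu₀₂ : MemHdot 2 u₀₂) : ∃ u₁ u₂ : ℝ → L2,
      IsState ν α₁ α₂ T u₀₁ u₀₂ f₁ f₂ u₁ u₂ := by
  obtain ⟨K₁, hK₁⟩ := exists_mem_sobolevBall hu₀₁
  obtain ⟨K₂, hK₂⟩ := exists_mem_sobolevBall hu₀₂
  set K := max (max K₁ K₂) (max (‖f₁‖ ^ 2) (‖f₂‖ ^ 2)) with hK
  have hsol := exists_galerkin_solution (α₁ := α₁) (α₂ := α₂) hν hT
    (hf₁.mono fun s hs => (hasZeroMean_iff _).1 hs) (hf₂.mono fun s hs => (hasZeroMean_iff _).1 hs)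
    u₀₁ u₀₂
  choose u₁ u₂ v₁ v₂ D₁ D₂ h₁ h₂ h0₁ h0₂ using hsol
  obtain ⟨M, hM⟩ := exists_isBounded hν hT α₁ α₂ K
  have init : ∀ {u₀ : L2} {w : ℕ → L2} {K' : ℝ}, K' ≤ K → u₀ ∈ sobolevBall K' →
      (∀ N m, fc m (w N) = if m ∈ galerkinModes N then fc m u₀ else 0) → ∀ N (F : Finset ℤ),
      ∑ m ∈ F, (m : ℝ) ^ 4 * ‖fc m (w N)‖ ^ 2 ≤ K := fun hle hu h N F => by
    refine (Finset.sum_le_sum fun m _ => ?_).trans ((hu.2 F).trans hle)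
    rw [h]
    split_ifs
    · exact le_rfl
    · rw [norm_zero, zero_pow two_ne_zero, mul_zero]; positivity
  have hb := fun N => hM _ _ _ _ _ _ _ _ _ (h₁ N) (h₂ N) (by rw [hK]; simp) (by rw [hK]; simp)
    (init (by rw [hK]; simp) hK₁ h0₁ N) (init (by rw [hK]; simp) hK₂ h0₂ N)
  -- Each nonzero mode of the initial value is eventually reproduced exactly; the zero mode agrees
  -- because the datum has mean zero.
  have hlim : ∀ {u₀ : L2} {w : ℕ → L2} {K' : ℝ}, u₀ ∈ sobolevBall K' →
      (∀ N m, fc m (w N) = if m ∈ galerkinModes N then fc m u₀ else 0) →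
      ∀ m, ∀ᶠ N in ((hyperfilter ℕ : Ultrafilter ℕ) : Filter ℕ), fc m (w N) = fc m u₀ :=
    fun hu h m => by
      refine Filter.Eventually.filter_mono Nat.hyperfilter_le_atTop ?_
      filter_upwards [eventually_ge_atTop m.natAbs] with N hN
      rw [h]
      split_ifs with hm
      · rfl
      · have : m = 0 := by
          by_contra hm0
          exact hm (Finset.mem_erase.2 ⟨hm0, Finset.mem_Icc.2 ⟨by omega, by omega⟩⟩)
        rw [this, hu.1]
  obtain ⟨F₁, F₂, w₁, w₂, hF₁, hF₂, -, -, hst⟩ := exists_limit_state (U := hyperfilter ℕ)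
    (K := max ‖f₁‖ ‖f₂‖) hT h₁ h₂ (fun N => (hb N).1) (fun N => (hb N).2)
    (fun _ => le_max_left _ _) (fun _ => le_max_right _ _) (fun m => by
      refine Filter.Eventually.filter_mono Nat.hyperfilter_le_atTop ?_
      filter_upwards [eventually_ge_atTop m.natAbs] with N hN
      rw [abs_le]
      omega) (hlim hK₁ h0₁) (hlim hK₂ h0₂)
  -- The controls do not vary with `N`, so their weak limits are the given ones.
  obtain rfl := hF₁.unique tendsto_const_nhds.weakTendsto
  obtain rfl := hF₂.unique tendsto_const_nhds.weakTendsto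
  exact ⟨w₁, w₂, hst⟩

end CoupledKS

/-! ### Lower semicontinuity of the cost -/

namespace CoupledKS

open Filter Topology

theorem eventually_norm_sub_sq_le {ι : Type*} {l : Filter ι} {T : ℝ} {u : ι → ℝ → L2} {w : ℝ → L2}
    (hu : TendstoUniformlyOn u w l (Icc 0 T)) (hw : ContinuousOn w (Icc 0 T)) (a : L2) {ε : ℝ}
    (hε : 0 < ε) : ∀ᶠ i in l, ∀ t ∈ Icc 0 T, ‖w t - a‖ ^ 2 ≤ ‖u i t - a‖ ^ 2 + ε := by
  obtain ⟨B, hB⟩ := isCompact_Icc.exists_bound_of_continuousOn (hw.sub continuousOn_const)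
  have hB' : 0 < 2 * (|B| + 1) := by positivity
  filter_upwards [Metric.tendstoUniformlyOn_iff.1 hu _ (div_pos hε hB')] with i hi t ht
  have h1 := (hi t ht).le
  rw [dist_eq_norm, le_div_iff₀ hB'] at h1
  have h2 : ‖w t - a‖ ≤ |B| + 1 := (hB t ht).trans ((le_abs_self B).trans (by linarith))
  have h3 := norm_sub_sq_real (w t - a) (w t - u i t)
  rw [show w t - a - (w t - u i t) = u i t - a by abel] at h3
  have h4 := real_inner_le_norm (w t - a) (w t - u i t)
  have h5 := mul_le_mul_of_nonneg_right h2 (norm_nonneg (w t - u i t))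
  nlinarith [sq_nonneg ‖w t - u i t‖]

/-- Expanding ‖x₀ − x‖² ≥ 0 gives ‖x‖² ≥ 2⟨x₀, x⟩ − ‖x₀‖², whose right-hand side tends to ‖x₀‖². -/
theorem WeakTendsto.eventually_norm_sq_le {ι H : Type*} [NormedAddCommGroup H]
    [InnerProductSpace ℝ H] {l : Filter ι} {x : ι → H} {x₀ : H} (hx : WeakTendsto x l x₀) {ε : ℝ}
    (hε : 0 < ε) : ∀ᶠ i in l, ‖x₀‖ ^ 2 ≤ ‖x i‖ ^ 2 + ε := by
  have h := hx x₀
  rw [real_inner_self_eq_norm_sq] at h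
  filter_upwards [h.eventually (lt_mem_nhds (show ‖x₀‖ ^ 2 - ε / 2 < ‖x₀‖ ^ 2 by linarith))]
    with i hi
  have h3 := norm_sub_sq_real x₀ (x i)
  rw [real_inner_comm] at h3
  nlinarith [sq_nonneg ‖x₀ - x i‖, real_inner_comm x₀ (x i)]

/-- Mazur's theorem: a point outside a closed convex set is separated from it by a continuous
functional, and weak limits respect the separating inequality. -/
theorem WeakTendsto.mem_of_convex {ι H : Type*} [NormedAddCommGroup H]
    [InnerProductSpace ℝ H] [CompleteSpace H] {l : Filter ι} [l.NeBot] {x : ι → H} {x₀ : H}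
    (hx : WeakTendsto x l x₀) {C : Set H} (hC : Convex ℝ C) (hC' : IsClosed C)
    (hmem : ∀ i, x i ∈ C) : x₀ ∈ C := by
  by_contra h
  obtain ⟨f, c, hf, hc⟩ := geometric_hahn_banach_closed_point hC hC' h
  exact absurd (le_of_tendsto (hx.clm_real f) (Eventually.of_forall fun i => (hf _ (hmem i)).le))
    (not_le.2 hc)

theorem intervalIntegral_norm_sq_add {T : ℝ} (hT : 0 ≤ T) (f₁ f₂ : Control T) :
    ∫ t in (0 : ℝ)..T, (‖f₁ t‖ ^ 2 + ‖f₂ t‖ ^ 2) = ‖f₁‖ ^ 2 + ‖f₂‖ ^ 2 := by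
  rw [intervalIntegral.integral_of_le hT, integral_add (integrable_norm_sq f₁)
    (integrable_norm_sq f₂), control_norm_sq, control_norm_sq]

theorem IsState.continuousOn {ν α₁ α₂ T : ℝ} (hT : 0 ≤ T) {u₀₁ u₀₂ : L2} {f₁ f₂ : Control T}
    {u₁ u₂ : ℝ → L2} (h : IsState ν α₁ α₂ T u₀₁ u₀₂ f₁ f₂ u₁ u₂) :
    ContinuousOn u₁ (Icc 0 T) ∧ ContinuousOn u₂ (Icc 0 T) := by
  obtain ⟨v₁, v₂, D₁, D₂, h₁, h₂⟩ := h.exists_isApprox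
  exact ⟨continuousOn_of_eq_add_integral hT (control_intervalIntegrable hT v₁) h₁.eq_add,
    continuousOn_of_eq_add_integral hT (control_intervalIntegrable hT v₂) h₂.eq_add⟩

theorem cost_nonneg {γ T : ℝ} (hγ : 0 ≤ γ) (hT : 0 ≤ T) (a₁ a₂ : L2) (u₁ u₂ : ℝ → L2)
    (f₁ f₂ : Control T) : 0 ≤ cost γ T a₁ a₂ u₁ u₂ f₁ f₂ := by
  have h1 : 0 ≤ ∫ t in (0 : ℝ)..T, (‖u₁ t - a₁‖ ^ 2 + ‖u₂ t - a₂‖ ^ 2) :=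
    intervalIntegral.integral_nonneg hT fun t _ => by positivity
  have h2 : 0 ≤ ∫ t in (0 : ℝ)..T, (‖f₁ t‖ ^ 2 + ‖f₂ t‖ ^ 2) :=
    intervalIntegral.integral_nonneg hT fun t _ => by positivity
  rw [cost]
  positivity

/-- The three summands of `T + 1 + γ` come from the running, the terminal and the control cost. -/
theorem cost_le_add {γ T ε : ℝ} (hγ : 0 ≤ γ) (hT : 0 ≤ T) {a₁ a₂ : L2} {u₁ u₂ w₁ w₂ : ℝ → L2}
    {f₁ f₂ g₁ g₂ : Control T} (hu₁ : ContinuousOn u₁ (Icc 0 T)) (hu₂ : ContinuousOn u₂ (Icc 0 T))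
    (hw₁ : ContinuousOn w₁ (Icc 0 T)) (hw₂ : ContinuousOn w₂ (Icc 0 T))
    (h₁ : ∀ t ∈ Icc 0 T, ‖w₁ t - a₁‖ ^ 2 ≤ ‖u₁ t - a₁‖ ^ 2 + ε)
    (h₂ : ∀ t ∈ Icc 0 T, ‖w₂ t - a₂‖ ^ 2 ≤ ‖u₂ t - a₂‖ ^ 2 + ε)
    (hg₁ : ‖g₁‖ ^ 2 ≤ ‖f₁‖ ^ 2 + ε) (hg₂ : ‖g₂‖ ^ 2 ≤ ‖f₂‖ ^ 2 + ε) :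
    cost γ T a₁ a₂ w₁ w₂ g₁ g₂ ≤ cost γ T a₁ a₂ u₁ u₂ f₁ f₂ + (T + 1 + γ) * ε := by
  have hi : ∀ {y₁ y₂ : ℝ → L2}, ContinuousOn y₁ (Icc 0 T) → ContinuousOn y₂ (Icc 0 T) →
      IntervalIntegrable (fun t => ‖y₁ t - a₁‖ ^ 2 + ‖y₂ t - a₂‖ ^ 2) volume 0 T :=
    fun h h' => ContinuousOn.intervalIntegrable (by
      rw [uIcc_of_le hT]
      exact ((h.sub continuousOn_const).norm.pow 2).add ((h'.sub continuousOn_const).norm.pow 2))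
  have h3 := intervalIntegral.integral_mono_on hT (hi hw₁ hw₂)
    ((hi hu₁ hu₂).add (_root_.intervalIntegrable_const (c := 2 * ε)))
    fun t ht => (add_le_add (h₁ t ht) (h₂ t ht)).trans_eq (by ring)
  rw [intervalIntegral.integral_add (hi hu₁ hu₂) _root_.intervalIntegrable_const,
    intervalIntegral.integral_const, sub_zero, smul_eq_mul] at h3
  have h4 := h₁ T ⟨hT, le_rfl⟩
  have h5 := h₂ T ⟨hT, le_rfl⟩
  have h6 : γ / 2 * (‖g₁‖ ^ 2 + ‖g₂‖ ^ 2) ≤ γ / 2 * (‖f₁‖ ^ 2 + ε + (‖f₂‖ ^ 2 + ε)) := by gcongr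
  rw [cost, cost, intervalIntegral_norm_sq_add hT, intervalIntegral_norm_sq_add hT]
  linarith

/-- A sequence of states with bounded controls has a limit state, along which the cost is lower
semicontinuous. -/
theorem exists_state_cost_le {ν α₁ α₂ γ T R c : ℝ} (hν : 0 < ν) (hγ : 0 ≤ γ) (hT : 0 ≤ T)
    {u₀₁ u₀₂ : L2} (hu₀₁ : MemHdot 2 u₀₁) (hu₀₂ : MemHdot 2 u₀₂) (a₁ a₂ : L2)
    {f₁ f₂ : ℕ → Control T} {u₁ u₂ : ℕ → ℝ → L2} (hf₁ : ∀ n, ‖f₁ n‖ ≤ R) (hf₂ : ∀ n, ‖f₂ n‖ ≤ R)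
    (hu : ∀ n, IsState ν α₁ α₂ T u₀₁ u₀₂ (f₁ n) (f₂ n) (u₁ n) (u₂ n))
    (hc : Tendsto (fun n => cost γ T a₁ a₂ (u₁ n) (u₂ n) (f₁ n) (f₂ n)) atTop (𝓝 c)) :
    ∃ (F₁ F₂ : Control T) (w₁ w₂ : ℝ → L2), WeakTendsto f₁ (hyperfilter ℕ : Filter ℕ) F₁ ∧
      WeakTendsto f₂ (hyperfilter ℕ : Filter ℕ) F₂ ∧ IsState ν α₁ α₂ T u₀₁ u₀₂ F₁ F₂ w₁ w₂ ∧
      cost γ T a₁ a₂ w₁ w₂ F₁ F₂ ≤ c := by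
  have hR : 0 ≤ R := (norm_nonneg _).trans (hf₁ 0)
  obtain ⟨K₁, hK₁⟩ := exists_mem_sobolevBall hu₀₁
  obtain ⟨K₂, hK₂⟩ := exists_mem_sobolevBall hu₀₂
  obtain ⟨M, hM⟩ := exists_isBounded hν hT α₁ α₂ (max (max K₁ K₂) (R ^ 2))
  choose v₁ v₂ D₁ D₂ h₁ h₂ using fun n => (hu n).exists_isApprox
  have hb := fun n => hM _ _ _ _ _ _ _ _ _ (h₁ n) (h₂ n)
    (le_max_of_le_right (pow_le_pow_left₀ (norm_nonneg _) (hf₁ n) 2))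
    (le_max_of_le_right (pow_le_pow_left₀ (norm_nonneg _) (hf₂ n) 2))
    (fun F => by
      rw [(hu n).1]
      exact le_max_of_le_left (le_max_of_le_left (hK₁.2 F)))
    (fun F => by
      rw [(hu n).2.1]
      exact le_max_of_le_left (le_max_of_le_right (hK₂.2 F)))
  obtain ⟨F₁, F₂, w₁, w₂, hF₁, hF₂, hw₁, hw₂, hst⟩ := exists_limit_state (U := hyperfilter ℕ)
    hT h₁ h₂ (fun n => (hb n).1) (fun n => (hb n).2) hf₁ hf₂
    (fun m => Eventually.of_forall fun n => mem_univ m)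
    (u₀₁ := u₀₁) (u₀₂ := u₀₂) (fun m => Eventually.of_forall fun n => by rw [(hu n).1])
    (fun m => Eventually.of_forall fun n => by rw [(hu n).2.1])
  refine ⟨F₁, F₂, w₁, w₂, hF₁, hF₂, hst, le_of_forall_pos_le_add fun δ hδ => ?_⟩
  have hA : 0 < T + 1 + γ := by positivity
  have hε : 0 < δ / (T + 1 + γ) := div_pos hδ hA
  refine ge_of_tendsto ((hc.mono_left Nat.hyperfilter_le_atTop).add_const δ) ?_
  filter_upwards [eventually_norm_sub_sq_le hw₁ (hst.continuousOn hT).1 a₁ hε,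
    eventually_norm_sub_sq_le hw₂ (hst.continuousOn hT).2 a₂ hε, hF₁.eventually_norm_sq_le hε,
    hF₂.eventually_norm_sq_le hε] with n e₁ e₂ e₃ e₄
  have := cost_le_add hγ hT ((hu n).continuousOn hT).1 ((hu n).continuousOn hT).2
    (hst.continuousOn hT).1 (hst.continuousOn hT).2 e₁ e₂ e₃ e₄
  rwa [mul_div_cancel₀ _ hA.ne'] at this

end CoupledKS

/-! ### The direct method -/

theorem theorem2 (ν α₁ α₂ γ T : ℝ) (hν : 0 < ν) (hγ : 0 ≤ γ) (hT : 0 < T)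
    (u₀₁ u₀₂ : CoupledKS.L2)
    (hu₀₁ : CoupledKS.MemHdot 2 u₀₁) (hu₀₂ : CoupledKS.MemHdot 2 u₀₂)
    (ubar₁ ubar₂ : CoupledKS.L2)
    (Fad : Set (CoupledKS.Control T)) (hne : Fad.Nonempty)
    (hbdd : Bornology.IsBounded Fad) (hclosed : IsClosed Fad) (hconv : Convex ℝ Fad)
    (hmean : ∀ f ∈ Fad, ∀ᵐ t ∂(MeasureTheory.volume.restrict (Set.Ioc (0 : ℝ) T)),
      CoupledKS.HasZeroMean (f t)) :
    ∃ (f₁ f₂ : CoupledKS.Control T) (u₁ u₂ : ℝ → CoupledKS.L2),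
      CoupledKS.IsOptimal ν α₁ α₂ γ T u₀₁ u₀₂ ubar₁ ubar₂ Fad f₁ f₂ u₁ u₂ := by
  set J : Set ℝ := {c | ∃ g₁ ∈ Fad, ∃ g₂ ∈ Fad, ∃ w₁ w₂ : ℝ → CoupledKS.L2,
    CoupledKS.IsState ν α₁ α₂ T u₀₁ u₀₂ g₁ g₂ w₁ w₂ ∧
      CoupledKS.cost γ T ubar₁ ubar₂ w₁ w₂ g₁ g₂ = c} with hJ
  have hJb : BddBelow J := ⟨0, by
    rintro _ ⟨g₁, -, g₂, -, w₁, w₂, -, rfl⟩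
    exact CoupledKS.cost_nonneg hγ hT.le ..⟩
  -- The existence of states enters here: without it the infimum could be over the empty set. One
  -- admissible `f` is used in both slots.
  have hJn : J.Nonempty := by
    obtain ⟨f, hf⟩ := hne
    obtain ⟨w₁, w₂, hw⟩ := CoupledKS.exists_isState (α₁ := α₁) (α₂ := α₂) hν hT.le (hmean f hf)
      (hmean f hf) hu₀₁ hu₀₂
    exact ⟨_, f, hf, f, hf, w₁, w₂, hw, rfl⟩
  obtain ⟨c, -, hc, hcJ⟩ := exists_seq_tendsto_sInf hJn hJb
  choose f₁ hf₁ f₂ hf₂ u₁ u₂ hu hcost using hcJ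
  obtain ⟨R, hR⟩ := hbdd.exists_norm_le
  rw [← funext hcost] at hc
  obtain ⟨F₁, F₂, w₁, w₂, hF₁, hF₂, hst, hle⟩ := CoupledKS.exists_state_cost_le hν hγ hT.le hu₀₁
    hu₀₂ ubar₁ ubar₂ (fun n => hR _ (hf₁ n)) (fun n => hR _ (hf₂ n)) hu hc
  exact ⟨F₁, F₂, w₁, w₂, hF₁.mem_of_convex hconv hclosed hf₁, hF₂.mem_of_convex hconv hclosed hf₂,
    hst, fun g₁ hg₁ g₂ hg₂ y₁ y₂ hy =>
      hle.trans (csInf_le hJb ⟨g₁, hg₁, g₂, hg₂, y₁, y₂, hy, rfl⟩)⟩
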